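/- **Ground-structures.** Types are generated by (with $\wp$ for the connective par) $C ::= 1 \mid \bot \mid C\otimes C \mid C\wp C \mid {!}C \mid {?}C$; labels are $\otimes, \wp , 1, \bot, !, ?, \circ$. A *differential ground-structure* $\mathcal G$ consists of a finite set $\mathcal P$ of *ports*, a label $l(p)$ and a type $\mathsf T(p)$ for every $p\in\mathcal P$, a set $\mathcal W\subseteq\{p\in\mathcal P: l(p)\neq\circ\}$ of *wires*, a *target* function $t:\mathcal W\to\{p\in\mathcal P: l(p)\notin\{1,\bot\}\}$ and a set $\mathcal L\subseteq\mathcal W$ of *left wires*, such that: every port labelled $\otimes$ or $\wp $ has exactly two premises (the premises of $p$ are the wires with target $p$), exactly one of them in $\mathcal L$; the target of every left wire is labelled $\otimes$ or $\wp $; $\mathsf T(p)=l(p)$ if $l(p)\in\{1,\bot\}$; $\mathsf T(p)=C_1\otimes C_2$ (resp. $C_1\wp C_2$) if $l(p)=\otimes$ (resp. $\wp $) and $C_1,C_2$ are the types of the left and of the other premise of $p$; if $l(p)={!}$ (resp. $l(p)\in\{?,\circ\}$), then there is $C$ with $\mathsf T(p)={!}C$ (resp. ${?}C$) such that all the premises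 of $p$ have type $C$. The *conclusions* of $\mathcal G$ are the elements of $\mathcal P\setminus\mathcal W$; the ports labelled $!,?,\circ$ are *exponential*. $\mathcal G$ is a *ground-structure* if no port labelled $!$ or $\circ$ has a premise. **$\circ$-PS's.** By induction on the depth, a *differential $\circ$-PS* (resp. a *$\circ$-PS*) is $S=(\mathcal G,\mathcal B_0,B,b)$, where $\mathcal G$ is a differential ground-structure (resp. a ground-structure); $\mathcal B_0$ (the *boxes at depth $0$*) is a set of $!$-ports without premises (resp. the set of all the $!$-ports); $B$ maps every $o\in\mathcal B_0$ to a $\circ$-PS $B(o)$ of smaller depth; and $b$ maps every $o\in\mathcal B_0$ to a function $b(o)$ from the conclusions of $B(o)$ to the set consisting of $o$, the $?$-ports and the $\circ$-ports of $\mathcal G$, such that: $o\in\operatorname{im} b(o)$; $b(o)$ is injective (resp. the identity) on the $\circ$-ports of $B(o)$ and does not send them to $!$-ports; $b(o)$ preserves the types of the $\circ$-ports, and a conclusion of type $C$ with another label is sent to a port of type ${?}C$ or ${!}C$; (resp. moreover every $\circ$-port of $\mathcal G$ is in the image of some $b(o)$, and no port of $\mathcal G$ is a sequence). The depth is $0$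 if $\mathcal B_0=\emptyset$, and $1+\max_o \operatorname{depth}B(o)$ otherwise. Write $\mathcal P_0(S)$ for the set of ports of $\mathcal G$ ("at depth $0$"), $\mathcal C(S)$ for the set of conclusions and $\mathcal C^\circ(S)$ for the set of $\circ$-ports. The set $\mathcal B(S)$ of the *boxes* of $S$ consists of the $o\in\mathcal B_0$ and of the sequences $o{:}o'$ with $o\in\mathcal B_0$ and $o'\in\mathcal B(B(o))$. The *arity* $a_S(q)$ of a port $q$ at depth $0$ is $$a_{S}(q)=\#\{\text{premises of }q\}+\sum_{o\in\mathcal B_0}\Big(\#\{p\in\mathcal C(B(o))\setminus\mathcal C^\circ(B(o)):b(o)(p)=q\}+\sum_{p\in\mathcal C^\circ(B(o)),\,b(o)(p)=q}a_{B(o)}(p)\Big),$$ and $\operatorname{cosize}(S)$ is the maximum of the $a_S(q)$, $q\in\mathcal P_0(S)$, and of the $\operatorname{cosize}(B(o))$, $o\in\mathcal B_0$ ($0$ if there are none). An *isomorphism* $S\simeq S'$ consists of a bijection $\varphi$ between the ports at depth $0$ that preserves labels, wires, targets, left wires, types and the boxes at depth $0$ and, for every $o\in\mathcal B_0$, an isomorphism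 $\varphi_o:B(o)\simeq B'(\varphi(o))$ such that $b'(\varphi(o))(\varphi_o(q))=\varphi(b(o)(q))$ for every conclusion $q$ of $B(o)$. Write $S\equiv S'$ if there is an isomorphism with $\varphi(p)=p$ for every $p\in\mathcal C(S)$. **Pseudo-experiments.** By induction on the depth, a *pseudo-experiment* $e$ of a $\circ$-PS $R$ consists of an integer $m\in\mathbb N$ and, for every $o\in\mathcal B_0(R)$, of a finite set $e(o)$ of pseudo-experiments of $B_R(o)$. For $o\in\mathcal B_0(R)$ put $e^\#(o)=\{\#e(o)\}$ and, for $o'\in\mathcal B(B_R(o))$, $e^\#(o{:}o')=\bigcup_{e_1\in e(o)}e_1^\#(o')$. Let $k>1$. By induction, $e$ is *$k$-injective* if: for every $o\in\mathcal B(R)$, every $m\in e^\#(o)$ is $k^j$ for some $j>0$; for all $o\in\mathcal B_0(R)$, $o'\in\mathcal B(B_R(o))$ and $e_1,e_2\in e(o)$, $e_1^\#(o')\cap e_2^\#(o')\ne\emptyset$ implies $e_1=e_2$; for all $o_1,o_2\in\mathcal B(R)$, $e^\#(o_1)\cap e^\#(o_2)\neq\emptyset$ implies $o_1=o_2$; and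 every $e_1\in e(o)$, $o\in\mathcal B_0(R)$, is $k$-injective. Put $\mathcal M_0(e)=\bigcup_{o\in\mathcal B(R)}\{j: k^j\in e^\#(o)\}$; let $\mathcal M_{i+1}(e)$ be the set of the $j>0$ such that the $j$-th digit of $\#\mathcal M_i(e)$ in base $k$ is nonzero; and $\mathcal N_i(e)=\mathcal M_i(e)\setminus\mathcal M_{i+1}(e)$. **Partial expansions.** For a pseudo-experiment $e$ of $R$ and $i\in\mathbb N$, the differential $\circ$-PS $\mathcal T(e)[i]$ is obtained from $R$ by replacing every box of depth $\geq i$ (i.e. whose content has depth $\ge i$) by the copies prescribed by $e$. By induction: its ports are those of $R$ at depth $0$ and the $(o_1,e_1){:}p$ with $o_1\in\mathcal B_0(R)$, $\operatorname{depth}B_R(o_1)\ge i$, $e_1\in e(o_1)$, $p$ a port of $\mathcal T(e_1)[i]$ at depth $0$ and $p\notin\mathcal C^\circ(B_R(o_1))$. Labels, types, left wires, boxes at depth $0$ and their contents are those of $R$ (only the boxes with a content of depth $<i$ are kept) and of the $\mathcal T(e_1)[i]$. All the new ports are wires; the targets of the wires of $R$ are unchanged, and the target of $(o_1,e_1){:}w$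 is $(o_1,e_1){:}t(w)$ if $w$ is a wire of $\mathcal T(e_1)[i]$ with target $t(w)\notin\mathcal C^\circ(B_R(o_1))$, it is $b_R(o_1)(t(w))$ if $t(w)\in\mathcal C^\circ(B_R(o_1))$, and it is $b_R(o_1)(w)$ if $w$ is a conclusion of $B_R(o_1)$ that is not labelled $\circ$. The functions $b$ are those of $R$ on the boxes that are kept; on $(o_1,e_1){:}o'$ it is the function $b(o')$ of $\mathcal T(e_1)[i]$ followed by the renaming that fixes $\mathcal C^\circ(B_R(o_1))$ and sends any other $q$ to $(o_1,e_1){:}q$. **Components.** Let $S$ be a differential $\circ$-PS, $\mathcal Q$ a set of exponential ports of $S$ at depth $0$ and $\mathcal Q_0\subseteq\mathcal P_0(S)$. For a differential $\circ$-PS $T$, write $T\sqsubseteq_{\mathcal Q}S$ if the ports of $T$ at depth $0$ are ports of $S$ at depth $0$; the wires of $T$ are the wires $w$ of $S$ with $w\in\mathcal P_0(T)\setminus\mathcal Q$ and with target in $\mathcal P_0(T)$; labels, types and targets are the restrictions of those of $S$; the left wires of $T$ are the left wires of $S$ whose target is a $\otimes$- or $\wp $-port of $T$; the boxes of $T$ at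 depth $0$ are those of $S$ that are ports of $T$, with the same $B$ and $b$. Write $T\sqsubseteq S$ if $T\sqsubseteq_{\mathcal Q}S$ for some $\mathcal Q$. For $p,p'\in\mathcal P_0(S)$, write $p\frown_S p'$ if one of $p,p'$ is the target of the other one, or if $p,p'\in\operatorname{im} b_S(o)$ for some box $o$ of $S$ at depth $0$. Write $T\trianglelefteq_{\mathcal Q}S$ if $T\sqsubseteq_{\mathcal Q}S$ and any two $p,p'\in\mathcal P_0(T)$ are joined by a sequence $p=p_0,\dots,p_n=p'$ in $\mathcal P_0(T)$ with $p_j\frown_S p_{j+1}$ and ($p_j\in\mathcal Q\Rightarrow j=0$) for all $j<n$. Let $\mathcal S^k_S(\mathcal Q,\mathcal Q_0)$ be the set of the $T\trianglelefteq_{\mathcal Q}S$ such that $\operatorname{cosize}(T)<k$, $\mathcal C(T)\subseteq\mathcal Q\cup\mathcal Q_0$, $\mathcal P_0(T)\not\subseteq\mathcal Q$ and, for all $p\in\mathcal P_0(T)$, $q\in\mathcal P_0(S)\setminus\mathcal P_0(T)$, $p\frown_S q$ implies $p\in\mathcal Q$. For $J\subseteq\mathbb N$ let $\mathcal K_{k,J}(S)$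 (the *critical ports*) be the set of the exponential ports $p$ of $S$ at depth $0$ such that the $j$-th digit of $a_S(p)$ in base $k$ is nonzero for some $j\in J$. **Proposition.** Let $R$ be a $\circ$-PS, let $k>1$ be such that $k>\#\mathcal B(R)$ and $k>\operatorname{cosize}(R)$, let $e$ be a $k$-injective pseudo-experiment of $R$, and let $i\in\mathbb N$. Put $\mathcal K=\mathcal K_{k,\mathcal N_i(e)}(\mathcal T(e)[i])$, let $T\in\mathcal S^k_{\mathcal T(e)[i]}(\mathcal K,\mathcal C(R))$ and put $$\mathfrak T=\{T'\in\mathcal S^k_{\mathcal T(e)[i]}(\mathcal K,\mathcal C(R)) : T\equiv T'\},\qquad \mathfrak T'=\{T'\in\mathcal S^k_{\mathcal T(e)[i+1]}(\mathcal K,\mathcal C(R)) : T\equiv T'\}.$$ Then $\mathfrak T$ and $\mathfrak T'$ are finite. Write $\#\mathfrak T=\sum_j m_jk^j$ and $\#\mathfrak T'=\sum_j m'_jk^j$ with $m_j,m'_j\in\{0,\dots,k-1\}$. Then 1. $\{j>0: m_j\neq0\}\subseteq\mathcal M_i(e)$; 2. $\{j>0: m'_j\neq0\}\subseteq\mathcal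 M_{i+1}(e)$; 3. $m'_j=m_j$ for every $j\in\mathcal M_{i+1}(e)$; 4. if $\{T'\in\mathfrak T: T'\sqsubseteq R\}\neq\emptyset$, then $m'_0=\#\{T'\in\mathfrak T: T'\sqsubseteq R\}=m_0$. -/

import Mathlib

open Classical

universe u v

/-- Types of multiplicative exponential linear logic without atoms. -/
inductive MTy : Type
  | one : MTy
  | bot : MTy
  | tensor : MTy → MTy → MTy
  | par : MTy → MTy → MTy
  | bang : MTy → MTy
  | whynot : MTy → MTy

/-- Labels of ports; `circ` is the label of the pre-contractions. -/
inductive PortLabel : Type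
  | tensor | par | one | bot | bang | whynot | circ

/-- The data of a (differential) ground-structure with ports named by elements of `N`.
Partial functions are `Option`-valued; the wires are the ports where `target` is defined. -/
structure Ground (N : Type u) where
  ports : Finset N
  label : N → Option PortLabel
  target : N → Option N
  left : Set N
  typ : N → Option MTy

namespace Ground

variable {N : Type u}

noncomputable def wires (G : Ground N) : Finset N :=
  G.ports.filter fun p => G.target p ≠ none

noncomputable def conclusions (G : Ground N) : Finset N :=
  G.ports.filter fun p => G.target p = none

/-- The ports labelled by `l`. -/
noncomputable def portsOf (G : Ground N) (l : PortLabel) : Finset N :=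
  G.ports.filter fun p => G.label p = some l

noncomputable def multiplicative (G : Ground N) : Finset N :=
  G.portsOf .tensor ∪ G.portsOf .par

noncomputable def exponential (G : Ground N) : Finset N :=
  G.portsOf .bang ∪ G.portsOf .whynot ∪ G.portsOf .circ

/-- The conclusions that are not labelled by `circ` (every port labelled by `circ` is a
conclusion of a ground-structure). -/
noncomputable def plainConclusions (G : Ground N) : Finset N :=
  G.conclusions \ G.portsOf .circ

/-- The set of the premises of `p`. -/
noncomputable def premises (G : Ground N) (p : N) : Finset N :=
  G.wires.filter fun w => G.target w = some p

/-- The number of premises of `p`. -/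
noncomputable def arity (G : Ground N) (p : N) : ℕ := (G.premises p).card

/-- The data form a differential ground-structure. -/
structure IsDifferential (G : Ground N) : Prop where
  label_dom : ∀ p, G.label p ≠ none ↔ p ∈ G.ports
  typ_dom : ∀ p, G.typ p ≠ none ↔ p ∈ G.ports
  wire : ∀ w p, G.target w = some p →
    w ∈ G.ports ∧ G.label w ≠ some .circ ∧
      p ∈ G.ports ∧ G.label p ≠ some .one ∧ G.label p ≠ some .bot
  mult_arity : ∀ p ∈ G.multiplicative, G.arity p = 2
  left_wire : ∀ w ∈ G.left, ∃ p ∈ G.multiplicative, G.target w = some p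
  mult_left : ∀ p ∈ G.multiplicative, ((G.premises p).filter (· ∈ G.left)).card = 1
  typ_one : ∀ p ∈ G.portsOf .one, G.typ p = some .one
  typ_bot : ∀ p ∈ G.portsOf .bot, G.typ p = some .bot
  typ_tensor : ∀ p ∈ G.portsOf .tensor, ∀ w₁ ∈ G.premises p, ∀ w₂ ∈ G.premises p,
    w₁ ∈ G.left → w₂ ∉ G.left →
      ∃ C₁ C₂, G.typ w₁ = some C₁ ∧ G.typ w₂ = some C₂ ∧ G.typ p = some (.tensor C₁ C₂)
  typ_par : ∀ p ∈ G.portsOf .par, ∀ w₁ ∈ G.premises p, ∀ w₂ ∈ G.premises p,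
    w₁ ∈ G.left → w₂ ∉ G.left →
      ∃ C₁ C₂, G.typ w₁ = some C₁ ∧ G.typ w₂ = some C₂ ∧ G.typ p = some (.par C₁ C₂)
  typ_bang : ∀ p ∈ G.portsOf .bang,
    ∃ C, G.typ p = some (.bang C) ∧ ∀ w ∈ G.premises p, G.typ w = some C
  typ_whynot : ∀ p ∈ G.portsOf .whynot ∪ G.portsOf .circ,
    ∃ C, G.typ p = some (.whynot C) ∧ ∀ w ∈ G.premises p, G.typ w = some C

/-- A ground-structure: no port labelled by `bang` or `circ` has a premise. -/
def IsGround (G : Ground N) : Prop :=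
  G.IsDifferential ∧
    ∀ w p, G.target w = some p → G.label p ≠ some .bang ∧ G.label p ≠ some .circ

/-- The restriction of `f` to the ports of `G` is an isomorphism from `G` to `G'`. -/
structure IsIso (G G' : Ground N) (f : N → N) : Prop where
  bij : Set.BijOn f G.ports G'.ports
  label : ∀ p ∈ G.ports, G'.label (f p) = G.label p
  target : ∀ p ∈ G.ports, G'.target (f p) = (G.target p).map f
  left : ∀ p ∈ G.ports, f p ∈ G'.left ↔ p ∈ G.left
  typ : ∀ p ∈ G.ports, G'.typ (f p) = G.typ p

end Ground

/-- The data of a `∘`-PS: a ground-structure `G`, the set `B0` of its boxes at depth `0`, the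
contents `box o` of these boxes and the partial functions `door o`, which send the
conclusions of `box o` to ports of `G`. -/
inductive CircPS (α : Type u) : Type u
  | mk (G : Ground α) (B0 : Finset α) (box : {o // o ∈ B0} → CircPS α)
      (door : {o // o ∈ B0} → α → Option α) : CircPS α

namespace CircPS

variable {α : Type u}

def ground : CircPS α → Ground α
  | mk G _ _ _ => G

/-- The boxes at depth `0`. -/
def boxes0 : CircPS α → Finset α
  | mk _ B0 _ _ => B0

def box : (R : CircPS α) → {o // o ∈ R.boxes0} → CircPS α
  | mk _ _ box _ => box

def door : (R : CircPS α) → {o // o ∈ R.boxes0} → α → Option α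
  | mk _ _ _ door => door

noncomputable def conclusions (R : CircPS α) : Finset α := R.ground.conclusions

noncomputable def circConclusions (R : CircPS α) : Finset α := R.ground.portsOf .circ

noncomputable def plainConclusions (R : CircPS α) : Finset α := R.ground.plainConclusions

/-- `0` if there is no box, otherwise one more than the maximal depth of a content. -/
noncomputable def depth : CircPS α → ℕ
  | mk _ B0 box _ => Finset.univ.sup fun o : {o // o ∈ B0} => (box o).depth + 1

/-- The conditions that are common to all the (differential) `∘`-PS's on the function `b` that
sends the conclusions of the content `A` of the box `o` to ports of `G`. -/
structure IsDoor {N : Type v} (G : Ground N) (A : CircPS α) (o : N) (b : α → Option N) :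
    Prop where
  dom : ∀ p, b p ≠ none ↔ p ∈ A.conclusions
  cod : ∀ p q, b p = some q → q = o ∨ q ∈ G.portsOf .whynot ∨ q ∈ G.portsOf .circ
  inj : ∀ p ∈ A.circConclusions, ∀ p' ∈ A.circConclusions, b p = b p' → p = p'
  main : ∃ p, b p = some o
  circ_not_bang : ∀ p ∈ A.circConclusions, ∀ q, b p = some q → q ∉ G.portsOf .bang
  typ_circ : ∀ p ∈ A.circConclusions, ∀ q, b p = some q → G.typ q = A.ground.typ p
  typ_plain : ∀ p ∈ A.plainConclusions, ∀ q, b p = some q →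
    ∃ C, A.ground.typ p = some C ∧
      (G.typ q = some (.whynot C) ∨ G.typ q = some (.bang C))

/-- The data form a `∘`-PS. -/
def IsCircPS : CircPS α → Prop
  | mk G B0 box door =>
    G.IsGround ∧ B0 = G.portsOf .bang ∧ (∀ o, (box o).IsCircPS) ∧
    (∀ q ∈ G.portsOf .circ, ∃ o p, door o p = some q) ∧
    ∀ o, IsDoor G (box o) o.1 (door o) ∧ ∀ p ∈ (box o).circConclusions, door o p = some p

/-- All the boxes, at any depth; a box is given by the sequence of the main doors that lead
to it. -/
noncomputable def boxes : CircPS α → Finset (List α)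
  | mk _ B0 box _ => Finset.univ.biUnion fun o : {o // o ∈ B0} =>
      insert [o.1] ((box o).boxes.image fun l => o.1 :: l)

/-- The arity of a port. Since the door functions are injective on the `∘`-conclusions of the
contents, there is at most one term in the innermost sum. -/
noncomputable def arity : CircPS α → α → ℕ
  | mk G B0 box door, q =>
    G.arity q
    + ∑ o : {o // o ∈ B0}, ((box o).plainConclusions.filter fun p => door o p = some q).card
    + ∑ o : {o // o ∈ B0},
        ∑ p ∈ (box o).circConclusions.filter (fun p => door o p = some q), (box o).arity p

noncomputable def cosize : CircPS α → ℕ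
  | mk G B0 box door =>
    max (G.ports.sup (mk G B0 box door).arity)
      (Finset.univ.sup fun o : {o // o ∈ B0} => (box o).cosize)

/-- `f` is the action on the ports at depth `0` of an isomorphism between two `∘`-PS's. -/
def IsIso : CircPS α → CircPS α → (α → α) → Prop
  | mk G B0 box door, R', f =>
    G.IsIso R'.ground f ∧ f '' B0 = R'.boxes0 ∧
    ∀ (o : {o // o ∈ B0}) (o' : {o // o ∈ R'.boxes0}), f o.1 = o'.1 →
      ∃ g, (box o).IsIso (R'.box o') g ∧
        ∀ q ∈ (box o).conclusions, R'.door o' (g q) = (door o q).map f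

end CircPS

/-- The data of a differential `∘`-PS with ports at depth `0` named by elements of `N` and with
boxes whose contents have ports in `α`. The domain of the partial function `box` is the set of
boxes at depth `0`. -/
structure DiffPS (N : Type u) (α : Type v) where
  ground : Ground N
  boxes0 : Finset N
  box : N → Option (CircPS α)
  door : N → α → Option N

namespace DiffPS

variable {N : Type u} {α : Type v}

noncomputable def conclusions (S : DiffPS N α) : Finset N := S.ground.conclusions

/-- The data form a differential `∘`-PS. -/
structure IsDiffPS (S : DiffPS N α) : Prop where
  isDifferential : S.ground.IsDifferential
  boxes0_bang : ∀ o ∈ S.boxes0, o ∈ S.ground.portsOf .bang ∧ S.ground.arity o = 0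
  box_dom : ∀ o, S.box o ≠ none ↔ o ∈ S.boxes0
  door_dom : ∀ o, o ∉ S.boxes0 → ∀ p, S.door o p = none
  isCircPS : ∀ o A, S.box o = some A → A.IsCircPS
  isDoor : ∀ o A, S.box o = some A → CircPS.IsDoor S.ground A o (S.door o)

noncomputable def arity (S : DiffPS N α) (q : N) : ℕ :=
  S.ground.arity q
  + ∑ o ∈ S.boxes0, (S.box o).elim 0
      (fun A => (A.plainConclusions.filter fun p => S.door o p = some q).card)
  + ∑ o ∈ S.boxes0, (S.box o).elim 0
      (fun A => ∑ p ∈ A.circConclusions.filter (fun p => S.door o p = some q), A.arity p)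

noncomputable def cosize (S : DiffPS N α) : ℕ :=
  max (S.ground.ports.sup S.arity) (S.boxes0.sup fun o => (S.box o).elim 0 CircPS.cosize)

/-- `f` is the action on the ports at depth `0` of an isomorphism between two differential
`∘`-PS's. -/
structure IsIso (S S' : DiffPS N α) (f : N → N) : Prop where
  ground : S.ground.IsIso S'.ground f
  boxes0 : f '' S.boxes0 = S'.boxes0
  box : ∀ o ∈ S.boxes0, ∀ A A', S.box o = some A → S'.box (f o) = some A' →
    ∃ g, A.IsIso A' g ∧ ∀ q ∈ A.conclusions, S'.door (f o) (g q) = (S.door o q).map f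

/-- The relation `≡`: there is an isomorphism that is the identity on the conclusions. -/
def Equivalent (S S' : DiffPS N α) : Prop :=
  ∃ f, S.IsIso S' f ∧ ∀ p ∈ S.conclusions, f p = p

/-- `T ⊑_Q S`, where `T` is a differential `∘`-PS and `Q` is a set of exponential ports
of `S`. -/
structure SubstructureAt (Q : Set N) (T S : DiffPS N α) : Prop where
  isDiffPS : T.IsDiffPS
  exponential : Q ⊆ S.ground.exponential
  ports : T.ground.ports ⊆ S.ground.ports
  wires : ∀ w, w ∈ T.ground.wires ↔
    w ∈ S.ground.wires ∧ w ∈ T.ground.ports ∧ w ∉ Q ∧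
      ∃ p ∈ T.ground.ports, S.ground.target w = some p
  label : ∀ p ∈ T.ground.ports, T.ground.label p = S.ground.label p
  target : ∀ w ∈ T.ground.wires, T.ground.target w = S.ground.target w
  left : ∀ w, w ∈ T.ground.left ↔
    w ∈ S.ground.left ∧ ∃ p ∈ T.ground.multiplicative, S.ground.target w = some p
  typ : ∀ p ∈ T.ground.ports, T.ground.typ p = S.ground.typ p
  boxes0 : ∀ o, o ∈ T.boxes0 ↔ o ∈ S.boxes0 ∧ o ∈ T.ground.ports
  box : ∀ o ∈ T.boxes0, T.box o = S.box o
  door : ∀ o ∈ T.boxes0, T.door o = S.door o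

/-- `T ⊑ S`. -/
def Substructure (T S : DiffPS N α) : Prop := ∃ Q, SubstructureAt Q T S

/-- The relation `p ¨ p'` on the ports at depth `0` of `S`: one of the ports is the target of the
other one, or both are doors of a same box. -/
def Coh (S : DiffPS N α) (p p' : N) : Prop :=
  p ∈ S.ground.ports ∧ p' ∈ S.ground.ports ∧
    (S.ground.target p = some p' ∨ S.ground.target p' = some p ∨
      ∃ o ∈ S.boxes0, (∃ r, S.door o r = some p) ∧ ∃ r', S.door o r' = some p')

/-- `T ⊴_Q S`: a substructure that is connected via other ports than those of `Q`. -/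
def ConnectedSubstructureAt (Q : Set N) (T S : DiffPS N α) : Prop :=
  SubstructureAt Q T S ∧
    ∀ p ∈ T.ground.ports, ∀ p' ∈ T.ground.ports, ∃ (n : ℕ) (s : ℕ → N),
      s 0 = p ∧ s n = p' ∧ (∀ j ≤ n, s j ∈ T.ground.ports) ∧
        ∀ j < n, S.Coh (s j) (s (j + 1)) ∧ (s j ∈ Q → j = 0)

/-- The components `T` of `S` above `Q` and `Q₀` that are connected via other ports than `Q` and
such that `cosize T < k`. -/
def components (S : DiffPS N α) (Q Q₀ : Set N) (k : ℕ) : Set (DiffPS N α) :=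
  {T | ConnectedSubstructureAt Q T S ∧ T.cosize < k ∧ ↑T.conclusions ⊆ Q ∪ Q₀ ∧
    (∃ p ∈ T.ground.ports, p ∉ Q) ∧
    ∀ p ∈ T.ground.ports, ∀ q ∈ S.ground.ports, S.Coh p q → q ∉ T.ground.ports → p ∈ Q}

end DiffPS

/-- The `j`-th digit of `n` in base `k`. -/
def baseDigit (k n j : ℕ) : ℕ := n / k ^ j % k

/-- The critical ports of `S`: the exponential ports whose arity, written in base `k`, has a
nonzero digit at some position `j ∈ J`. -/
def DiffPS.criticalPorts {N : Type u} {α : Type v} (S : DiffPS N α) (k : ℕ) (J : Set ℕ) : Set N :=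
  {p | p ∈ S.ground.exponential ∧ ∃ j ∈ J, baseDigit k (S.arity p) j ≠ 0}

/-- The pseudo-experiments of `R`: pairs of an integer and of a function that associates with
every box `o` of `R` at depth `0` a finite set of pseudo-experiments of the content of `o`. -/
def PseudoExp {α : Type u} : CircPS α → Type u
  | .mk _ B0 box _ => ℕ × ((o : {o // o ∈ B0}) → Finset (PseudoExp (box o)))

namespace PseudoExp

variable {α : Type u}

/-- The set of pseudo-experiments that `e` associates with the box `o`. -/
def copies : {R : CircPS α} → PseudoExp R → (o : {o // o ∈ R.boxes0}) →
    Finset (PseudoExp (R.box o))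
  | .mk _ _ _ _, e => e.2

/-- The function `e^#`: `numCopies R e l` is the set of the numbers of copies of the box `l` that
are taken by `e`. -/
def numCopies : (R : CircPS α) → PseudoExp R → List α → Set ℕ
  | .mk _ B0 box _, e, l =>
    {m | ∃ o : {o // o ∈ B0}, (l = [o.1] ∧ m = (e.2 o).card) ∨
      ∃ l' ∈ (box o).boxes, l = o.1 :: l' ∧ ∃ e₁ ∈ e.2 o, m ∈ numCopies (box o) e₁ l'}

/-- `k`-injective pseudo-experiments. The condition that different copies of a box take different
numbers of copies of the boxes they contain is required for boxes at any depth. -/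
def KInjective (k : ℕ) : (R : CircPS α) → PseudoExp R → Prop
  | .mk G B0 box door, e =>
    (∀ l ∈ (CircPS.mk G B0 box door).boxes, ∀ m ∈ numCopies (.mk G B0 box door) e l,
      ∃ j > 0, m = k ^ j) ∧
    (∀ o : {o // o ∈ B0}, ∀ l ∈ (box o).boxes, ∀ e₁ ∈ e.2 o, ∀ e₂ ∈ e.2 o,
      (numCopies (box o) e₁ l ∩ numCopies (box o) e₂ l).Nonempty → e₁ = e₂) ∧
    (∀ l₁ ∈ (CircPS.mk G B0 box door).boxes, ∀ l₂ ∈ (CircPS.mk G B0 box door).boxes,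
      (numCopies (.mk G B0 box door) e l₁ ∩ numCopies (.mk G B0 box door) e l₂).Nonempty →
        l₁ = l₂) ∧
    ∀ o : {o // o ∈ B0}, ∀ e₁ ∈ e.2 o, KInjective k (box o) e₁

/-- The sets `M_i(e)`. -/
noncomputable def setM (k : ℕ) {R : CircPS α} (e : PseudoExp R) : ℕ → Set ℕ
  | 0 => {j | ∃ l ∈ R.boxes, k ^ j ∈ numCopies R e l}
  | i + 1 => {j | 0 < j ∧ baseDigit k (setM k e i).ncard j ≠ 0}

/-- The sets `N_i(e)`. -/
noncomputable def setN (k : ℕ) {R : CircPS α} (e : PseudoExp R) (i : ℕ) : Set ℕ :=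
  setM k e i \ setM k e (i + 1)

end PseudoExp

/-- Names of the ports of the partial expansions of `R`: either a name `p` of `α`, or a sequence
`(o, e₁) : n` where `o` is a box of `R` at depth `0`, `e₁` is a pseudo-experiment of its content
and `n` is the name of a port of a partial expansion of its content. -/
inductive PortName {α : Type u} : CircPS α → Type u
  | base {R : CircPS α} (p : α) : PortName R
  | copy {R : CircPS α} (o : {o // o ∈ R.boxes0}) (e₁ : PseudoExp (R.box o))
      (n : PortName (R.box o)) : PortName R

namespace PortName

variable {α : Type u}

/-- The element of `α` that the name is, if it is not a sequence. -/
def asBase {R : CircPS α} : PortName R → Option α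
  | base p => some p
  | copy _ _ _ => none

/-- The name is the one of a `∘`-conclusion of `R`. -/
def IsCirc {R : CircPS α} (n : PortName R) : Prop :=
  ∃ q ∈ R.circConclusions, n = base q

/-- The port of an expansion of `R` that corresponds to the port `n` of the copy `(o, e₁)` of the
content of `o`: the `∘`-conclusions of the content keep their names (they are also names of ports
of `R`), the other ports are renamed. -/
noncomputable def glue {R : CircPS α} (o : {o // o ∈ R.boxes0}) (e₁ : PseudoExp (R.box o)) :
    PortName (R.box o) → PortName R
  | base q => if q ∈ (R.box o).circConclusions then base q else copy o e₁ (base q)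
  | copy o' e₂ n => copy o e₁ (copy o' e₂ n)

end PortName

/-- A `∘`-PS as a differential `∘`-PS, with the names used for the partial expansions. -/
noncomputable def CircPS.toDiffPS {α : Type u} (R : CircPS α) : DiffPS (PortName R) α where
  ground :=
    { ports := R.ground.ports.image .base
      label := fun n => n.asBase.bind R.ground.label
      target := fun n => n.asBase.bind fun p => (R.ground.target p).map .base
      left := .base '' R.ground.left
      typ := fun n => n.asBase.bind R.ground.typ }
  boxes0 := R.boxes0.image .base
  box := fun n => n.asBase.bind fun p => if h : p ∈ R.boxes0 then some (R.box ⟨p, h⟩) else none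
  door := fun n r => n.asBase.bind fun p =>
    if h : p ∈ R.boxes0 then (R.door ⟨p, h⟩ r).map .base else none

/-- The ports `(o, e₁) : n` obtained by replacing the boxes of depth `≥ i` at depth `0` of `R` by
copies of the differential `∘`-PS's `S o e₁`, where `e₁` is in the set associated by `e`
with `o`. -/
def IsCopied {α : Type u} (i : ℕ) (R : CircPS α) (e : PseudoExp R)
    (S : (o : {o // o ∈ R.boxes0}) → PseudoExp (R.box o) → DiffPS (PortName (R.box o)) α)
    (o : {o // o ∈ R.boxes0}) (e₁ : PseudoExp (R.box o)) (n : PortName (R.box o)) : Prop :=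
  i ≤ (R.box o).depth ∧ e₁ ∈ e.copies o ∧ n ∈ (S o e₁).ground.ports ∧ ¬ n.IsCirc

/-- The differential `∘`-PS obtained by replacing the boxes `o` of depth `≥ i` at depth `0` of `R`
by the `S o e₁`, where `e₁` is in the set associated by `e` with `o`. -/
noncomputable def expand {α : Type u} (i : ℕ) (R : CircPS α) (e : PseudoExp R)
    (S : (o : {o // o ∈ R.boxes0}) → PseudoExp (R.box o) → DiffPS (PortName (R.box o)) α) :
    DiffPS (PortName R) α where
  ground :=
    { ports := R.ground.ports.image .base ∪
        R.boxes0.attach.biUnion fun o => (e.copies o).biUnion fun e₁ =>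
          ((S o e₁).ground.ports.filter fun n => IsCopied i R e S o e₁ n).image (.copy o e₁)
      label := fun
        | .base p => R.ground.label p
        | .copy o e₁ n => if IsCopied i R e S o e₁ n then (S o e₁).ground.label n else none
      target := fun
        | .base p => (R.ground.target p).map .base
        | .copy o e₁ n =>
          if IsCopied i R e S o e₁ n then
            match (S o e₁).ground.target n with
            | some n' => some (.glue o e₁ n')
            -- in this case `n` is a conclusion of the content of `o`
            | none => (n.asBase.bind (R.door o)).map .base
          else none
      left := {n | match n with
        | .base p => p ∈ R.ground.left
        | .copy o e₁ n => IsCopied i R e S o e₁ n ∧ n ∈ (S o e₁).ground.left}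
      typ := fun
        | .base p => R.ground.typ p
        | .copy o e₁ n => if IsCopied i R e S o e₁ n then (S o e₁).ground.typ n else none }
  boxes0 := (R.boxes0.attach.filter fun o => (R.box o).depth < i).image (fun o => .base o.1) ∪
    R.boxes0.attach.biUnion fun o => (e.copies o).biUnion fun e₁ =>
      ((S o e₁).boxes0.filter fun n => IsCopied i R e S o e₁ n).image (.copy o e₁)
  box := fun
    | .base p => if h : p ∈ R.boxes0 then
        (if (R.box ⟨p, h⟩).depth < i then some (R.box ⟨p, h⟩) else none) else none
    | .copy o e₁ n => if IsCopied i R e S o e₁ n then (S o e₁).box n else none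
  door := fun
    | .base p => fun r => if h : p ∈ R.boxes0 then
        (if (R.box ⟨p, h⟩).depth < i then (R.door ⟨p, h⟩ r).map .base else none) else none
    | .copy o e₁ n => fun r =>
      if IsCopied i R e S o e₁ n then ((S o e₁).door n r).map (.glue o e₁) else none

/-- The partial expansion `T(e)[i]`. -/
noncomputable def taylor {α : Type u} (i : ℕ) :
    (R : CircPS α) → PseudoExp R → DiffPS (PortName R) α
  | .mk G B0 box door, e => expand i (.mk G B0 box door) e fun o e₁ => taylor i (box o) e₁

/-! A port of a partial expansion is located by two data: the path of copies of boxes that leads to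
it (`lvl`) and a port of the content reached by this path (`core`). The levels for `i` are the paths
all of whose contents have depth at least `i`. Targets, doors and arities depend on a path only
through its shape, in which the boxes and their contents are recorded but the pseudo-experiments are
forgotten.

The proof rests on one counting principle, `baseDigit_sum_levels`. Let `F` be a function on levels
that vanishes off the extensions of a level `t`, depends only on shapes, and is less than `k`. Group
the extensions of `t` other than `t` by their parent level `l` and their last box `o`. A group has
as many elements as there are copies of `o` in `l`, which is `k ^ j` with `j > 0`, and by
`k`-injectivity distinct pairs `(l, o)` have distinct exponents (`KInj.ncop_inj`). So the sum of `F`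
is already written in base `k`: digit `0` is `F t`, and digit `j` is the common value of `F` on the
group with exponent `j`.

The principle is used three times. With `F` the number of boxes expanded in a copy, it gives
`setM_eq`: `M_i(e)` is the set of exponents of the boxes whose content has depth at least `i`, so
`N_i(e)` corresponds to depth exactly `i`. With `F` the contribution of a level to the arity of a
port, bounded by the cosize (`contrib_le`), it gives `mem_criticalPorts`: the critical ports are
those reached from inside a copy of a content of depth exactly `i`. With `F` the number of
components equivalent to `T` at a level, it gives the theorem.

For this last use, a link between noncritical ports of a component at two different levels would be
repeated at least `k` times, against `cosize T < k`; so the noncritical ports of a component share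
one level (`exists_level`). If every conclusion of `T` is critical and has an input in `T`, the
conclusions lie along one path, and `t` is the longest of their levels. Swapping two levels of the
same shape above `t` then moves components to components (`rename_mem`), so that `F` depends only on
shapes. In the other case some conclusion determines the component, and both cardinals are at most
`1`.

Away from the critical ports, two successive expansions have the same links (`coh_iff`). Hence the
two cardinals are sums of the same `F` over the levels for `i` and for `i + 1`: the digits at
positions in `M_{i+1}(e)` coincide, and digit `0` is `F t` for both. When some component equivalent
to `T` lies in `R`, its conclusions force `t = []`. -/

section

/-! ### Boxes and arities of a `∘`-PS, with contents and doors as total functions. -/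

namespace CircPS

variable {α : Type u}

/-- The content of the box `o`, with a junk value if `o` is not a box at depth `0`. -/
noncomputable def content (A : CircPS α) (o : α) : CircPS α :=
  if h : o ∈ A.boxes0 then A.box ⟨o, h⟩ else A

/-- The function `b(o)`, with a junk value if `o` is not a box at depth `0`. -/
noncomputable def doorFn (A : CircPS α) (o r : α) : Option α :=
  if h : o ∈ A.boxes0 then A.door ⟨o, h⟩ r else none

theorem content_coe (A : CircPS α) (o : {o // o ∈ A.boxes0}) : A.content o = A.box o := by
  simp [content, o.2]

theorem content_of_mem (A : CircPS α) {o : α} (h : o ∈ A.boxes0) :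
    A.content o = A.box ⟨o, h⟩ := by
  simp [content, h]

theorem doorFn_coe (A : CircPS α) (o : {o // o ∈ A.boxes0}) : A.doorFn o = A.door o := by
  funext r
  simp [doorFn, o.2]

theorem doorFn_of_mem (A : CircPS α) {o : α} (h : o ∈ A.boxes0) :
    A.doorFn o = A.door ⟨o, h⟩ := by
  funext r
  simp [doorFn, h]

theorem mem_boxes0_of_doorFn {A : CircPS α} {o r q : α} (h : A.doorFn o r = some q) :
    o ∈ A.boxes0 := by
  by_contra h'
  simp [doorFn, h'] at h

namespace IsCircPS

theorem isGround {A : CircPS α} (h : A.IsCircPS) : A.ground.IsGround := by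
  cases A; rw [IsCircPS] at h; exact h.1

theorem boxes0_eq {A : CircPS α} (h : A.IsCircPS) : A.boxes0 = A.ground.portsOf .bang := by
  cases A; rw [IsCircPS] at h; exact h.2.1

theorem box {A : CircPS α} (h : A.IsCircPS) (o : {o // o ∈ A.boxes0}) : (A.box o).IsCircPS := by
  cases A; rw [IsCircPS] at h; exact h.2.2.1 o

theorem content {A : CircPS α} (h : A.IsCircPS) (o : α) : (A.content o).IsCircPS := by
  unfold CircPS.content
  split_ifs with ho
  exacts [h.box _, h]

theorem exists_door_circ {A : CircPS α} (h : A.IsCircPS) {q : α} (hq : q ∈ A.circConclusions) :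
    ∃ o p, A.doorFn o p = some q := by
  cases A with
  | mk G B0 box door =>
    rw [IsCircPS] at h
    obtain ⟨o, p, hp⟩ := h.2.2.2.1 q hq
    exact ⟨o, p, by rw [doorFn_coe (mk G B0 box door) o]; exact hp⟩

theorem isDoor {A : CircPS α} (h : A.IsCircPS) {o : α} (ho : o ∈ A.boxes0) :
    IsDoor A.ground (A.content o) o (A.doorFn o) := by
  rw [content_of_mem A ho, doorFn_of_mem A ho]
  cases A; rw [IsCircPS] at h; exact (h.2.2.2.2 ⟨o, ho⟩).1

theorem doorFn_circ {A : CircPS α} (h : A.IsCircPS) {o : α} (ho : o ∈ A.boxes0) {p : α}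
    (hp : p ∈ (A.content o).circConclusions) : A.doorFn o p = some p := by
  rw [content_of_mem A ho] at hp
  rw [doorFn_of_mem A ho]
  cases A; rw [IsCircPS] at h; exact (h.2.2.2.2 ⟨o, ho⟩).2 p hp

end IsCircPS

theorem arity_eq (A : CircPS α) (q : α) : A.arity q = A.ground.arity q
    + ∑ o ∈ A.boxes0, ((A.content o).plainConclusions.filter fun p => A.doorFn o p = some q).card
    + ∑ o ∈ A.boxes0, ∑ p ∈ (A.content o).circConclusions.filter
        (fun p => A.doorFn o p = some q), (A.content o).arity p := by
  rw [← Finset.sum_coe_sort A.boxes0, ← Finset.sum_coe_sort A.boxes0]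
  simp only [content_coe, doorFn_coe]
  cases A
  rw [arity]
  rfl

theorem depth_content_lt (A : CircPS α) {o : α} (ho : o ∈ A.boxes0) :
    (A.content o).depth < A.depth := by
  rw [content_of_mem A ho]
  cases A with
  | mk G B0 box door =>
    rw [depth]
    exact Finset.le_sup (f := fun o : {o // o ∈ B0} => (box o).depth + 1)
      (Finset.mem_univ (⟨o, ho⟩ : {o // o ∈ B0}))

theorem exists_content_depth (A : CircPS α) {i : ℕ} (h : i < A.depth) :
    ∃ o ∈ A.boxes0, i ≤ (A.content o).depth := by
  cases A with
  | mk G B0 box door =>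
    rw [depth] at h
    obtain ⟨o, -, ho⟩ := (Finset.lt_sup_iff).1 h
    refine ⟨o.1, o.2, ?_⟩
    have := content_coe (mk G B0 box door) o
    rw [this]
    exact Nat.lt_succ_iff.1 ho

theorem cosize_content_le (A : CircPS α) {o : α} (ho : o ∈ A.boxes0) :
    (A.content o).cosize ≤ A.cosize := by
  rw [content_of_mem A ho]
  cases A with
  | mk G B0 box door =>
    rw [cosize]
    exact le_max_of_le_right (Finset.le_sup (f := fun o : {o // o ∈ B0} => (box o).cosize)
      (Finset.mem_univ (⟨o, ho⟩ : {o // o ∈ B0})))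

theorem arity_le_cosize (A : CircPS α) {q : α} (hq : q ∈ A.ground.ports) :
    A.arity q ≤ A.cosize := by
  cases A with
  | mk G B0 box door =>
    rw [cosize]
    exact le_max_of_le_left (Finset.le_sup (f := (mk G B0 box door).arity) hq)

theorem mem_boxes (A : CircPS α) (l : List α) : l ∈ A.boxes ↔
    ∃ o ∈ A.boxes0, l = [o] ∨ ∃ l' ∈ (A.content o).boxes, l = o :: l' := by
  cases A with
  | mk G B0 box door =>
    rw [boxes]
    simp only [Finset.mem_biUnion, Finset.mem_univ, true_and, Finset.mem_insert,
      Finset.mem_image]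
    constructor
    · rintro ⟨o, ho⟩
      refine ⟨o.1, o.2, ?_⟩
      rw [content_coe (mk G B0 box door) o]
      rcases ho with ho | ⟨l', h1, h2⟩
      exacts [Or.inl ho, Or.inr ⟨l', h1, h2.symm⟩]
    · rintro ⟨o, ho, h⟩
      refine ⟨⟨o, ho⟩, ?_⟩
      rw [content_of_mem (mk G B0 box door) ho] at h
      rcases h with h | ⟨l', h1, h2⟩
      exacts [Or.inl h, Or.inr ⟨l', h1, h2.symm⟩]

theorem mem_plain_or_circ {A : CircPS α} {q : α} (hq : q ∈ A.conclusions) :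
    q ∈ A.plainConclusions ∨ q ∈ A.circConclusions := by
  by_cases h : q ∈ A.circConclusions
  · exact Or.inr h
  · exact Or.inl (Finset.mem_sdiff.2 ⟨hq, h⟩)

theorem mem_conclusions_of_plain {A : CircPS α} {q : α} (hq : q ∈ A.plainConclusions) :
    q ∈ A.conclusions := (Finset.mem_sdiff.1 hq).1

theorem not_circ_of_plain {A : CircPS α} {q : α} (hq : q ∈ A.plainConclusions) :
    q ∉ A.circConclusions := (Finset.mem_sdiff.1 hq).2

/-- Every `∘`-port has a positive arity. -/
theorem arity_pos_of_circ : ∀ {A : CircPS α}, A.IsCircPS → ∀ {q : α},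
    q ∈ A.circConclusions → 0 < A.arity q
  | mk G B0 box door, h, q, hq => by
    set A := mk G B0 box door with hA
    obtain ⟨o, p, hp⟩ := h.exists_door_circ hq
    have ho := mem_boxes0_of_doorFn hp
    have hpc : p ∈ (A.content o).conclusions := ((h.isDoor ho).dom p).1 (by simp [hp])
    rw [arity_eq]
    rcases mem_plain_or_circ hpc with hpl | hci
    · have : 0 < ∑ o ∈ A.boxes0,
          ((A.content o).plainConclusions.filter fun p => A.doorFn o p = some q).card :=
        lt_of_lt_of_le (Finset.card_pos.2 ⟨p, Finset.mem_filter.2 ⟨hpl, hp⟩⟩)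
          (Finset.single_le_sum (f := fun o => ((A.content o).plainConclusions.filter
            fun p => A.doorFn o p = some q).card) (fun _ _ => Nat.zero_le _) ho)
      omega
    · have hpos : 0 < (A.content o).arity p := by
        have hb := arity_pos_of_circ (h.box ⟨o, ho⟩) (q := p)
          (by rwa [content_of_mem A ho] at hci)
        rwa [content_of_mem A ho]
      have : 0 < ∑ o ∈ A.boxes0, ∑ p ∈ (A.content o).circConclusions.filter
          (fun p => A.doorFn o p = some q), (A.content o).arity p :=
        lt_of_lt_of_le (lt_of_lt_of_le hpos
          (Finset.single_le_sum (f := fun p => (A.content o).arity p) (fun _ _ => Nat.zero_le _)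
            (Finset.mem_filter.2 ⟨hci, hp⟩)))
          (Finset.single_le_sum (f := fun o => ∑ p ∈ (A.content o).circConclusions.filter
            (fun p => A.doorFn o p = some q), (A.content o).arity p)
            (fun _ _ => Nat.zero_le _) ho)
      omega

/-- The contribution to the arity of `q` of a box with content `A` and door function `d`. -/
noncomputable def boxArity {N : Type v} (A : CircPS α) (d : α → Option N) (q : N) : ℕ :=
  (A.plainConclusions.filter fun p => d p = some q).card +
    ∑ p ∈ A.circConclusions.filter (fun p => d p = some q), A.arity p

theorem arity_eq_boxArity (A : CircPS α) (q : α) : A.arity q = A.ground.arity q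
    + ∑ o ∈ A.boxes0, (A.content o).boxArity (A.doorFn o) q := by
  rw [arity_eq, add_assoc, ← Finset.sum_add_distrib]
  rfl

theorem boxArity_congr {N N' : Type v} (A : CircPS α) {d : α → Option N} {q : N}
    {d' : α → Option N'} {q' : N'} (h : ∀ p, d p = some q ↔ d' p = some q') :
    A.boxArity d q = A.boxArity d' q' := by
  unfold boxArity
  rw [Finset.filter_congr fun p _ => h p, Finset.filter_congr fun p _ => h p]

theorem boxArity_pos {N : Type v} {A : CircPS α} (h : A.IsCircPS) {d : α → Option N} {q : N}
    {r : α} (hr : r ∈ A.conclusions) (hd : d r = some q) : 0 < A.boxArity d q := by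
  unfold boxArity
  rcases mem_plain_or_circ hr with hpl | hci
  · have := Finset.card_pos.2 ⟨r, (Finset.mem_filter (p := fun p => d p = some q)).2 ⟨hpl, hd⟩⟩
    omega
  · have := lt_of_lt_of_le (arity_pos_of_circ h hci)
      (Finset.single_le_sum (f := fun p => A.arity p) (fun _ _ => Nat.zero_le _)
        ((Finset.mem_filter (p := fun p => d p = some q)).2 ⟨hci, hd⟩))
    omega

theorem exists_of_boxArity_ne_zero {N : Type v} {A : CircPS α} {d : α → Option N}
    {q : N} (h : A.boxArity d q ≠ 0) : ∃ r, d r = some q := by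
  by_contra! hc
  apply h
  simp [boxArity, hc]

/-- A `∘`-port of the content keeps its name outside, so its inner arity is one summand of the outer
arity; the plain conclusions sent to the same port form another. `contrib_le` needs the sum of both.
-/
theorem arity_le_of_circ {A : CircPS α} (h : A.IsCircPS) {o q : α} (ho : o ∈ A.boxes0)
    (hq : q ∈ (A.content o).circConclusions) :
    ((A.content o).plainConclusions.filter fun p => A.doorFn o p = some q).card
      + (A.content o).arity q ≤ A.arity q := by
  rw [A.arity_eq_boxArity]
  have h1 := Finset.single_le_sum (f := fun o => (A.content o).boxArity (A.doorFn o) q)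
    (fun _ _ => Nat.zero_le _) ho
  have h2 := Finset.single_le_sum (f := fun p => (A.content o).arity p)
    (fun _ _ => Nat.zero_le _) ((Finset.mem_filter
    (p := fun p => A.doorFn o p = some q)).2 ⟨hq, h.doorFn_circ ho hq⟩)
  simp only [boxArity] at h1 ⊢
  omega

end CircPS

theorem DiffPS.arity_eq_boxArity {N : Type u} {α : Type v} (S : DiffPS N α) (q : N) :
    S.arity q = S.ground.arity q
      + ∑ o ∈ S.boxes0, (S.box o).elim 0 fun A => A.boxArity (S.door o) q := by
  rw [DiffPS.arity, add_assoc, ← Finset.sum_add_distrib]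
  congr 1
  refine Finset.sum_congr rfl fun o _ => ?_
  cases S.box o <;> rfl

end

/-! ### Paths of copies, their shapes, and targets and doors in terms of paths. -/

section

/-- A `∘`-PS together with one of its pseudo-experiments. -/
abbrev ExpState (α : Type u) := Σ R : CircPS α, PseudoExp R

/-- A box together with a copy of its content. -/
abbrev ExpStep (α : Type u) := α × ExpState α

namespace ExpState

variable {α : Type u}

/-- The copies of the contents of depth `≥ i` of the boxes at depth `0`. -/
noncomputable def children (i : ℕ) (ρ : ExpState α) : Finset (ExpStep α) :=
  ρ.1.boxes0.attach.biUnion fun o => if i ≤ (ρ.1.box o).depth then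
    (ρ.2.copies o).image fun e₁ => (o.1, ⟨ρ.1.box o, e₁⟩) else ∅

theorem mem_children {i : ℕ} {ρ : ExpState α} {x : ExpStep α} : x ∈ children i ρ ↔
    ∃ o : {o // o ∈ ρ.1.boxes0}, i ≤ (ρ.1.box o).depth ∧ ∃ e₁ ∈ ρ.2.copies o,
      x = (o.1, ⟨ρ.1.box o, e₁⟩) := by
  simp only [children, Finset.mem_biUnion, Finset.mem_attach, true_and]
  refine exists_congr fun o => ?_
  split_ifs with h
  · simp only [Finset.mem_image, h, true_and, eq_comm]
  · simp [h]

theorem child_mem {i : ℕ} {ρ : ExpState α} {x : ExpStep α} (h : x ∈ children i ρ) :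
    x.1 ∈ ρ.1.boxes0 := by
  obtain ⟨o, -, e₁, -, rfl⟩ := mem_children.1 h
  exact o.2

theorem child_content {i : ℕ} {ρ : ExpState α} {x : ExpStep α} (h : x ∈ children i ρ) :
    x.2.1 = ρ.1.content x.1 := by
  obtain ⟨o, -, e₁, -, rfl⟩ := mem_children.1 h
  exact (ρ.1.content_coe o).symm

theorem child_depth {i : ℕ} {ρ : ExpState α} {x : ExpStep α} (h : x ∈ children i ρ) :
    i ≤ x.2.1.depth := by
  obtain ⟨o, h', e₁, -, rfl⟩ := mem_children.1 h
  exact h'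

theorem child_mono {i i' : ℕ} {ρ : ExpState α} {x : ExpStep α} (h : x ∈ children i ρ)
    (hi : i' ≤ x.2.1.depth) : x ∈ children i' ρ := by
  obtain ⟨o, -, e₁, h', rfl⟩ := mem_children.1 h
  exact mem_children.2 ⟨o, hi, e₁, h', rfl⟩

/-- The paths of copies of boxes with contents of depth `≥ i`. -/
def IsLevel (i : ℕ) : ExpState α → List (ExpStep α) → Prop
  | _, [] => True
  | ρ, x :: l => x ∈ children i ρ ∧ IsLevel i x.2 l

/-- The copy to which a path leads. -/
def endSt : ExpState α → List (ExpStep α) → ExpState α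
  | ρ, [] => ρ
  | _, x :: l => endSt x.2 l

@[simp] theorem endSt_nil (ρ : ExpState α) : endSt ρ [] = ρ := rfl

@[simp] theorem endSt_cons (ρ : ExpState α) (x : ExpStep α) (l : List (ExpStep α)) :
    endSt ρ (x :: l) = endSt x.2 l := rfl

@[simp] theorem isLevel_nil (i : ℕ) (ρ : ExpState α) : IsLevel i ρ [] := trivial

@[simp] theorem isLevel_cons (i : ℕ) (ρ : ExpState α) (x : ExpStep α) (l : List (ExpStep α)) :
    IsLevel i ρ (x :: l) ↔ x ∈ children i ρ ∧ IsLevel i x.2 l := Iff.rfl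

theorem endSt_append (ρ : ExpState α) (l l' : List (ExpStep α)) :
    endSt ρ (l ++ l') = endSt (endSt ρ l) l' := by
  induction l generalizing ρ with
  | nil => rfl
  | cons x l ih => exact ih _

@[simp] theorem endSt_snoc (ρ : ExpState α) (l : List (ExpStep α)) (x : ExpStep α) :
    endSt ρ (l ++ [x]) = x.2 := by
  rw [endSt_append]; rfl

theorem isLevel_append (i : ℕ) (ρ : ExpState α) (l l' : List (ExpStep α)) :
    IsLevel i ρ (l ++ l') ↔ IsLevel i ρ l ∧ IsLevel i (endSt ρ l) l' := by
  induction l generalizing ρ with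
  | nil => simp
  | cons x l ih => simp [ih, and_assoc]

theorem isLevel_snoc {i : ℕ} {ρ : ExpState α} {l : List (ExpStep α)} {x : ExpStep α} :
    IsLevel i ρ (l ++ [x]) ↔ IsLevel i ρ l ∧ x ∈ children i (endSt ρ l) := by
  rw [isLevel_append]; simp

theorem IsLevel.of_prefix {i : ℕ} {ρ : ExpState α} {l l' : List (ExpStep α)} (h : IsLevel i ρ l')
    (hl : l <+: l') : IsLevel i ρ l := by
  obtain ⟨u, rfl⟩ := hl
  exact ((isLevel_append _ _ _ _).1 h).1

theorem IsLevel.isCircPS {i : ℕ} {ρ : ExpState α} {l : List (ExpStep α)} (h : IsLevel i ρ l)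
    (hρ : ρ.1.IsCircPS) : (endSt ρ l).1.IsCircPS := by
  induction l generalizing ρ with
  | nil => exact hρ
  | cons x l ih =>
    refine ih h.2 ?_
    rw [child_content h.1]
    exact hρ.content _

theorem IsLevel.cosize_le {i : ℕ} {ρ : ExpState α} {l : List (ExpStep α)} (h : IsLevel i ρ l) :
    (endSt ρ l).1.cosize ≤ ρ.1.cosize := by
  induction l generalizing ρ with
  | nil => exact le_rfl
  | cons x l ih =>
    refine (ih h.2).trans ?_
    rw [child_content h.1]
    exact CircPS.cosize_content_le _ (child_mem h.1)

theorem IsLevel.depth_le {i : ℕ} {ρ : ExpState α} {l : List (ExpStep α)} (h : IsLevel i ρ l) :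
    (endSt ρ l).1.depth ≤ ρ.1.depth := by
  induction l generalizing ρ with
  | nil => exact le_rfl
  | cons x l ih =>
    refine (ih h.2).trans ?_
    rw [child_content h.1]
    exact (CircPS.depth_content_lt _ (child_mem h.1)).le

theorem IsLevel.depth_end {i : ℕ} {ρ : ExpState α} {l : List (ExpStep α)} (h : IsLevel i ρ l)
    (hl : l ≠ []) : i ≤ (endSt ρ l).1.depth := by
  obtain ⟨l, x, rfl⟩ := (List.eq_nil_or_concat' l).resolve_left hl
  simp only [endSt_snoc]
  exact child_depth (isLevel_snoc.1 h).2

/-- Depths decrease along a path, so the last content decides. -/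
theorem IsLevel.of_depth {i i' : ℕ} {ρ : ExpState α} {l : List (ExpStep α)} (h : IsLevel i ρ l)
    (hd : i' ≤ (endSt ρ l).1.depth) : IsLevel i' ρ l := by
  induction l generalizing ρ with
  | nil => trivial
  | cons x l ih => exact ⟨child_mono h.1 (hd.trans h.2.depth_le), ih h.2 hd⟩

theorem IsLevel.mono {i i' : ℕ} {ρ : ExpState α} {l : List (ExpStep α)} (h : IsLevel i ρ l)
    (hi : i' ≤ i) : IsLevel i' ρ l := by
  by_cases hl : l = []
  · subst hl; trivial
  · exact h.of_depth (hi.trans (h.depth_end hl))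

theorem finite_isLevel (i : ℕ) (ρ : ExpState α) : {l | IsLevel i ρ l}.Finite := by
  induction hn : ρ.1.depth using Nat.strong_induction_on generalizing ρ with
  | _ n ih =>
    have : {l | IsLevel i ρ l} ⊆
        {[]} ∪ ⋃ x ∈ children i ρ, (x :: ·) '' {l | IsLevel i x.2 l} := by
      rintro (_ | ⟨x, l⟩) h
      · exact Or.inl rfl
      · exact Or.inr (Set.mem_biUnion (show x ∈ (children i ρ : Set (ExpStep α)) from h.1)
          ⟨l, h.2, rfl⟩)
    refine Set.Finite.subset ((Set.finite_singleton _).union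
      (Set.Finite.biUnion (children i ρ).finite_toSet fun x hx => (ih _ ?_ x.2 rfl).image _)) this
    rw [← hn, child_content hx]
    exact CircPS.depth_content_lt _ (child_mem hx)

noncomputable def levels (i : ℕ) (ρ : ExpState α) : Finset (List (ExpStep α)) :=
  (finite_isLevel i ρ).toFinset

@[simp] theorem mem_levels {i : ℕ} {ρ : ExpState α} {l : List (ExpStep α)} :
    l ∈ levels i ρ ↔ IsLevel i ρ l := by
  simp [levels]

/-- The boxes of a path and their contents, without the choice of the copies. -/
def shape (l : List (ExpStep α)) : List (α × CircPS α) := l.map fun x => (x.1, x.2.1)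

@[simp] theorem shape_nil : shape ([] : List (ExpStep α)) = [] := rfl

@[simp] theorem shape_cons (x : ExpStep α) (l : List (ExpStep α)) :
    shape (x :: l) = (x.1, x.2.1) :: shape l := rfl

@[simp] theorem shape_append (l l' : List (ExpStep α)) :
    shape (l ++ l') = shape l ++ shape l' := List.map_append

theorem length_eq_of_shape {l l' : List (ExpStep α)} (h : shape l = shape l') :
    l.length = l'.length := by
  simpa [shape] using congrArg List.length h

theorem endSt_congr {ρ ρ' : ExpState α} (hρ : ρ.1 = ρ'.1) {l l' : List (ExpStep α)}
    (h : shape l = shape l') : (endSt ρ l).1 = (endSt ρ' l').1 := by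
  induction l generalizing ρ ρ' l' with
  | nil =>
    cases l' with
    | nil => exact hρ
    | cons => simp at h
  | cons x l ih =>
    cases l' with
    | nil => simp at h
    | cons x' l' =>
      simp only [shape_cons, List.cons.injEq, Prod.mk.injEq] at h
      exact ih h.1.2 h.2

/-- The level of the port that stands for the port `q` of the copy at level `l`: the `∘`-ports
are ports of the copies outside. -/
noncomputable def resL : List (ExpStep α) → α → List (ExpStep α)
  | [], _ => []
  | x :: l, q => if resL l q = [] ∧ q ∈ x.2.1.circConclusions then [] else x :: resL l q

@[simp] theorem resL_nil (q : α) : resL [] q = [] := rfl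

theorem resL_cons (x : ExpStep α) (l : List (ExpStep α)) (q : α) : resL (x :: l) q =
    if resL l q = [] ∧ q ∈ x.2.1.circConclusions then [] else x :: resL l q := rfl

/-- `resL` recurses from the outermost step, whereas a `∘`-port is passed outwards from the
innermost one. This form serves inductions in the second order. -/
theorem resL_snoc (l : List (ExpStep α)) (x : ExpStep α) (q : α) : resL (l ++ [x]) q =
    if q ∈ x.2.1.circConclusions then resL l q else l ++ [x] := by
  induction l with
  | nil => simp [resL_cons]
  | cons y l ih =>
    rw [List.cons_append, resL_cons, ih, resL_cons]
    by_cases h1 : q ∈ x.2.1.circConclusions <;> simp [h1]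

theorem resL_prefix (l : List (ExpStep α)) (q : α) : resL l q <+: l := by
  induction l with
  | nil => simp
  | cons x l ih =>
    rw [resL_cons]
    split_ifs
    · exact List.nil_prefix
    · exact List.cons_prefix_cons.2 ⟨rfl, ih⟩

/-- The test in `resL` looks at contents only, never at pseudo-experiments. -/
theorem resL_length_congr {l l' : List (ExpStep α)} (h : shape l = shape l') (q : α) :
    (resL l q).length = (resL l' q).length := by
  induction l generalizing l' with
  | nil =>
    cases l' with
    | nil => rfl
    | cons => simp at h
  | cons x l ih =>
    cases l' with
    | nil => simp at h
    | cons x' l' =>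
      simp only [shape_cons, List.cons.injEq, Prod.mk.injEq] at h
      have := ih h.2
      have h0 : resL l q = [] ↔ resL l' q = [] := by
        rw [← List.length_eq_zero_iff, this, List.length_eq_zero_iff]
      rw [resL_cons, resL_cons, h.1.2]
      simp only [h0]
      split_ifs
      · rfl
      · simp [this]

/-- The target of the port `p` of the copy at level `l`. -/
noncomputable def tgtL (ρ : ExpState α) (l : List (ExpStep α)) (p : α) :
    Option (List (ExpStep α) × α) :=
  match (endSt ρ l).1.ground.target p with
  | some p' => some (resL l p', p')
  | none => l.getLast?.bind fun x =>
      ((endSt ρ l.dropLast).1.doorFn x.1 p).map fun q => (resL l.dropLast q, q)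

/-- The function `b(o)` of the box `o` of the copy at level `l`. -/
noncomputable def doorL (ρ : ExpState α) (l : List (ExpStep α)) (o r : α) :
    Option (List (ExpStep α) × α) :=
  ((endSt ρ l).1.doorFn o r).map fun q => (resL l q, q)

theorem tgtL_of_some {ρ : ExpState α} {l : List (ExpStep α)} {p p' : α}
    (h : (endSt ρ l).1.ground.target p = some p') : tgtL ρ l p = some (resL l p', p') := by
  simp [tgtL, h]

theorem tgtL_nil {ρ : ExpState α} {p : α} :
    tgtL ρ [] p = (ρ.1.ground.target p).map fun q => ([], q) := by
  simp only [tgtL, endSt_nil]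
  cases ρ.1.ground.target p <;> simp

theorem tgtL_snoc_of_none {ρ : ExpState α} {l : List (ExpStep α)} {x : ExpStep α} {p : α}
    (h : x.2.1.ground.target p = none) :
    tgtL ρ (l ++ [x]) p = ((endSt ρ l).1.doorFn x.1 p).map fun q => (resL l q, q) := by
  simp [tgtL, h]

theorem tgtL_eq_some {ρ : ExpState α} {l : List (ExpStep α)} {p q : α} {a : List (ExpStep α)} :
    tgtL ρ l p = some (a, q) ↔
      ((endSt ρ l).1.ground.target p = some q ∧ a = resL l q) ∨
      ∃ l₀ x, l = l₀ ++ [x] ∧ x.2.1.ground.target p = none ∧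
        (endSt ρ l₀).1.doorFn x.1 p = some q ∧ a = resL l₀ q := by
  rcases List.eq_nil_or_concat' l with rfl | ⟨l, x, rfl⟩
  · rw [tgtL_nil]
    simp only [Option.map_eq_some_iff, Prod.mk.injEq, endSt_nil, resL_nil]
    constructor
    · rintro ⟨q', h1, rfl, rfl⟩
      exact Or.inl ⟨h1, rfl⟩
    · rintro (⟨h1, rfl⟩ | ⟨l₀, x, h1, -⟩)
      · exact ⟨q, h1, rfl, rfl⟩
      · simp at h1
  · cases h : x.2.1.ground.target p with
    | none =>
      rw [tgtL_snoc_of_none h]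
      simp only [Option.map_eq_some_iff, Prod.mk.injEq, endSt_snoc, h, reduceCtorEq, false_and,
        false_or]
      constructor
      · rintro ⟨q', h1, h2, rfl⟩
        exact ⟨l, x, rfl, h, h1, h2.symm⟩
      · rintro ⟨l₀, x', h1, -, h3, h4⟩
        obtain ⟨rfl, h2⟩ := List.append_inj' h1 rfl
        cases h2
        exact ⟨q, h3, h4.symm, rfl⟩
    | some p' =>
      rw [tgtL_of_some (by simpa using h)]
      simp only [Option.some.injEq, Prod.mk.injEq, endSt_snoc, h]
      constructor
      · rintro ⟨h1, rfl⟩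
        exact Or.inl ⟨rfl, h1.symm⟩
      · rintro (⟨rfl, h2⟩ | ⟨l₀, x', h1, h2, -⟩)
        · exact ⟨h2.symm, rfl⟩
        · obtain ⟨rfl, h3⟩ := List.append_inj' h1 rfl
          cases h3
          rw [h] at h2
          cases h2

theorem doorL_eq_some {ρ : ExpState α} {l : List (ExpStep α)} {o r q : α}
    {a : List (ExpStep α)} : doorL ρ l o r = some (a, q) ↔
      (endSt ρ l).1.doorFn o r = some q ∧ a = resL l q := by
  simp only [doorL, Option.map_eq_some_iff, Prod.mk.injEq]
  constructor
  · rintro ⟨q', h1, h2, rfl⟩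
    exact ⟨h1, h2.symm⟩
  · rintro ⟨h1, h2⟩
    exact ⟨q, h1, h2.symm, rfl⟩

theorem tgtL_prefix {ρ : ExpState α} {l : List (ExpStep α)} {p q : α} {a : List (ExpStep α)}
    (h : tgtL ρ l p = some (a, q)) : a <+: l := by
  rcases tgtL_eq_some.1 h with ⟨-, rfl⟩ | ⟨l₀, x, rfl, -, -, rfl⟩
  · exact resL_prefix _ _
  · exact (resL_prefix _ _).trans (List.prefix_append _ _)

theorem doorL_prefix {ρ : ExpState α} {l : List (ExpStep α)} {o r q : α} {a : List (ExpStep α)}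
    (h : doorL ρ l o r = some (a, q)) : a <+: l := by
  rw [(doorL_eq_some.1 h).2]
  exact resL_prefix _ _

/-- Prefixes of one list are determined by their lengths. This is why positions are transported
between paths of the same shape by giving just a prefix and its length. -/
theorem eq_resL_of_shape {l l' a' : List (ExpStep α)} {q : α} (h : shape l = shape l')
    (ha : a' <+: l') (hlen : (resL l q).length = a'.length) : a' = resL l' q := by
  rw [resL_length_congr h] at hlen
  exact (List.prefix_of_prefix_length_le ha (resL_prefix l' q) hlen.ge).eq_of_length hlen.symm

/-- The target only depends on the shape. -/
theorem tgtL_congr {ρ ρ' : ExpState α} (hρ : ρ.1 = ρ'.1) {l l' a a' : List (ExpStep α)} {p q : α}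
    (h : shape l = shape l') (ht : tgtL ρ l p = some (a, q)) (ha : a' <+: l')
    (hlen : a.length = a'.length) : tgtL ρ' l' p = some (a', q) := by
  rcases tgtL_eq_some.1 ht with ⟨h1, rfl⟩ | ⟨l₀, x, rfl, h1, h2, rfl⟩
  · refine tgtL_eq_some.2 (Or.inl ⟨by rw [← endSt_congr hρ h, h1], eq_resL_of_shape h ha hlen⟩)
  · have hl' : l' ≠ [] := by rintro rfl; simp [shape] at h
    obtain ⟨l₁, x', rfl⟩ := (List.eq_nil_or_concat' l').resolve_left hl'
    rw [shape_append, shape_append] at h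
    obtain ⟨h3, h4⟩ := List.append_inj' h rfl
    simp only [shape_cons, shape_nil, List.cons.injEq, Prod.mk.injEq, and_true] at h4
    have ha' : a' <+: l₁ := by
      refine List.prefix_of_prefix_length_le ha (List.prefix_append _ _) ?_
      rw [← hlen, ← length_eq_of_shape h3]
      exact (resL_prefix _ _).length_le
    exact tgtL_eq_some.2 (Or.inr ⟨l₁, x', rfl, by rw [← h4.2, h1],
      by rw [← endSt_congr hρ h3, ← h4.1, h2], eq_resL_of_shape h3 ha' hlen⟩)

theorem doorL_congr {ρ ρ' : ExpState α} (hρ : ρ.1 = ρ'.1) {l l' a a' : List (ExpStep α)}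
    {o r q : α} (h : shape l = shape l') (ht : doorL ρ l o r = some (a, q)) (ha : a' <+: l')
    (hlen : a.length = a'.length) : doorL ρ' l' o r = some (a', q) := by
  obtain ⟨h1, rfl⟩ := doorL_eq_some.1 ht
  exact doorL_eq_some.2 ⟨by rw [← endSt_congr hρ h, h1], eq_resL_of_shape h ha hlen⟩

end ExpState

end

/-! ### The partial expansions described by levels and cores. -/

section

namespace PortName

variable {α : Type u}

/-- The path of copies in which a port is. -/
def lvl : {R : CircPS α} → PortName R → List (ExpStep α)
  | _, base _ => []
  | R, copy o e₁ n => (o.1, ⟨R.box o, e₁⟩) :: n.lvl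

/-- The port of the content of a box of which a port is a copy. -/
def core : {R : CircPS α} → PortName R → α
  | _, base p => p
  | _, copy _ _ n => n.core

@[simp] theorem lvl_base {R : CircPS α} (p : α) : (base p : PortName R).lvl = [] := rfl

@[simp] theorem core_base {R : CircPS α} (p : α) : (base p : PortName R).core = p := rfl

@[simp] theorem lvl_copy {R : CircPS α} (o : {o // o ∈ R.boxes0}) (e₁ : PseudoExp (R.box o))
    (n : PortName (R.box o)) : (copy o e₁ n).lvl = (o.1, ⟨R.box o, e₁⟩) :: n.lvl := rfl

@[simp] theorem core_copy {R : CircPS α} (o : {o // o ∈ R.boxes0}) (e₁ : PseudoExp (R.box o))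
    (n : PortName (R.box o)) : (copy o e₁ n).core = n.core := rfl

/-- Each step of a path records both the box and the pseudo-experiment, so nothing is lost when a
name is replaced by its position. -/
theorem ext_lvl_core {R : CircPS α} {n n' : PortName R} (h : n.lvl = n'.lvl)
    (h' : n.core = n'.core) : n = n' := by
  induction n with
  | base p =>
    cases n' with
    | base p' => simpa using h'
    | copy => simp at h
  | copy o e₁ n ih =>
    cases n' with
    | base => simp at h
    | copy o' e' n' =>
      simp only [lvl_copy, List.cons.injEq, Prod.mk.injEq] at h
      obtain ⟨⟨h1, h2⟩, h3⟩ := h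
      obtain rfl := Subtype.ext h1
      simp only [Sigma.mk.injEq, heq_eq_eq, true_and] at h2
      subst h2
      rw [ih h3 h']

/-- The path and the port of the content of a box of which a port is a copy. -/
def pos {R : CircPS α} (n : PortName R) : List (ExpStep α) × α := (n.lvl, n.core)

theorem pos_injective {R : CircPS α} : Function.Injective (pos : PortName R → _) :=
  fun _ _ h => ext_lvl_core (congrArg Prod.fst h) (congrArg Prod.snd h)

theorem asBase_eq {R : CircPS α} (n : PortName R) :
    n.asBase = if n.lvl = [] then some n.core else none := by
  cases n <;> simp [asBase]

theorem isCirc_iff {R : CircPS α} (n : PortName R) :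
    n.IsCirc ↔ n.lvl = [] ∧ n.core ∈ R.circConclusions := by
  cases n <;> simp [IsCirc]

theorem lvl_glue {R : CircPS α} (o : {o // o ∈ R.boxes0}) (e₁ : PseudoExp (R.box o))
    (n : PortName (R.box o)) : (glue o e₁ n).lvl =
      if n.lvl = [] ∧ n.core ∈ (R.box o).circConclusions then []
      else (o.1, ⟨R.box o, e₁⟩) :: n.lvl := by
  cases n with
  | base q =>
    simp only [glue, lvl_base, core_base, true_and]
    split_ifs <;> rfl
  | copy => simp [glue]

theorem core_glue {R : CircPS α} (o : {o // o ∈ R.boxes0}) (e₁ : PseudoExp (R.box o))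
    (n : PortName (R.box o)) : (glue o e₁ n).core = n.core := by
  cases n with
  | base q =>
    simp only [glue]
    split_ifs <;> rfl
  | copy => rfl

theorem exists_of_isLevel {i : ℕ} {ρ : ExpState α} {l : List (ExpStep α)}
    (h : ExpState.IsLevel i ρ l) (p : α) : ∃ n : PortName ρ.1, n.lvl = l ∧ n.core = p := by
  induction l generalizing ρ with
  | nil => exact ⟨base p, rfl, rfl⟩
  | cons x l ih =>
    obtain ⟨h1, h2⟩ := h
    obtain ⟨o, -, e₁, -, rfl⟩ := ExpState.mem_children.1 h1
    obtain ⟨n, hn, hp⟩ := ih h2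
    exact ⟨copy o e₁ n, by simp [hn], hp⟩

end PortName

open PortName ExpState

variable {α : Type u}

theorem taylor_eq (i : ℕ) (R : CircPS α) (e : PseudoExp R) :
    taylor i R e = expand i R e fun o e₁ => taylor i (R.box o) e₁ := by
  cases R; rw [taylor]; rfl

theorem taylor_copy_mem {i : ℕ} {R : CircPS α} {e : PseudoExp R} {o : {o // o ∈ R.boxes0}}
    {e₁ : PseudoExp (R.box o)} {n : PortName (R.box o)} :
    copy o e₁ n ∈ (taylor i R e).ground.ports ↔
      IsCopied i R e (fun o e₁ => taylor i (R.box o) e₁) o e₁ n := by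
  rw [taylor_eq]
  simp only [expand, Finset.mem_union, Finset.mem_image, reduceCtorEq, and_false,
    exists_false, Finset.mem_biUnion, Finset.mem_attach, true_and, false_or,
    Finset.mem_filter, copy.injEq]
  constructor
  · rintro ⟨o', e', h1, n', ⟨h2, h3⟩, rfl, h4⟩
    obtain ⟨h4, h5⟩ := h4
    cases h4; cases h5
    exact h3
  · intro h
    exact ⟨o, e₁, h.2.1, n, ⟨h.2.2.1, h⟩, rfl, HEq.rfl, HEq.rfl⟩

/-- A `∘`-port of a copied content is identified with the port of the same name outside, hence the
exclusion at nonempty levels. At level `[]` the `∘`-ports of `R` itself are genuine ports. -/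
theorem mem_taylor_ports {i : ℕ} {R : CircPS α} {e : PseudoExp R} {n : PortName R} :
    n ∈ (taylor i R e).ground.ports ↔ IsLevel i ⟨R, e⟩ n.lvl ∧
      n.core ∈ (endSt ⟨R, e⟩ n.lvl).1.ground.ports ∧
      (n.lvl = [] ∨ n.core ∉ (endSt ⟨R, e⟩ n.lvl).1.circConclusions) := by
  induction n with
  | base p =>
    rw [taylor_eq]
    simp [expand]
  | @copy R o e₁ n ih =>
    rw [taylor_copy_mem]
    simp only [IsCopied, ih (e := e₁), isCirc_iff, lvl_copy, core_copy, isLevel_cons, endSt_cons,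
      mem_children]
    constructor
    · rintro ⟨h1, h2, ⟨h3, h4, h5⟩, h6⟩
      refine ⟨⟨⟨o, h1, e₁, h2, rfl⟩, h3⟩, h4, Or.inr ?_⟩
      rcases h5 with h5 | h5
      · rw [h5] at h6 ⊢
        exact fun h => h6 ⟨rfl, h⟩
      · exact h5
    · rintro ⟨⟨⟨o', h1, e', h2, h7⟩, h3⟩, h4, h5⟩
      simp only [Prod.mk.injEq] at h7
      obtain ⟨h7, h8⟩ := h7
      obtain rfl := Subtype.ext h7
      simp only [Sigma.mk.injEq, heq_eq_eq, true_and] at h8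
      subst h8
      have h5 := h5.resolve_left (by simp)
      refine ⟨h1, h2, ⟨h3, h4, Or.inr h5⟩, ?_⟩
      rintro ⟨h6, h7⟩
      rw [h6] at h5
      exact h5 h7

theorem taylor_label {i : ℕ} {R : CircPS α} {e : PseudoExp R} {n : PortName R}
    (h : n ∈ (taylor i R e).ground.ports) :
    (taylor i R e).ground.label n = (endSt ⟨R, e⟩ n.lvl).1.ground.label n.core := by
  induction n with
  | base p => rw [taylor_eq]; rfl
  | @copy R o e₁ n ih =>
    have hc := taylor_copy_mem.1 h
    rw [taylor_eq]
    simp only [expand, hc, if_true]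
    exact ih (e := e₁) hc.2.2.1

theorem taylor_typ {i : ℕ} {R : CircPS α} {e : PseudoExp R} {n : PortName R}
    (h : n ∈ (taylor i R e).ground.ports) :
    (taylor i R e).ground.typ n = (endSt ⟨R, e⟩ n.lvl).1.ground.typ n.core := by
  induction n with
  | base p => rw [taylor_eq]; rfl
  | @copy R o e₁ n ih =>
    have hc := taylor_copy_mem.1 h
    rw [taylor_eq]
    simp only [expand, hc, if_true]
    exact ih (e := e₁) hc.2.2.1

theorem taylor_left {i : ℕ} {R : CircPS α} {e : PseudoExp R} {n : PortName R}
    (h : n ∈ (taylor i R e).ground.ports) :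
    n ∈ (taylor i R e).ground.left ↔ n.core ∈ (endSt ⟨R, e⟩ n.lvl).1.ground.left := by
  induction n with
  | base p => rw [taylor_eq]; rfl
  | @copy R o e₁ n ih =>
    have hc := taylor_copy_mem.1 h
    rw [taylor_eq]
    simp only [expand, Set.mem_ofPred_eq, hc, true_and]
    exact ih (e := e₁) hc.2.2.1

theorem mem_ports_of_taylor_target {i : ℕ} {R : CircPS α} (hR : R.IsCircPS) {e : PseudoExp R}
    {n n' : PortName R} (h : (taylor i R e).ground.target n = some n') :
    n ∈ (taylor i R e).ground.ports := by
  cases n with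
  | base p =>
    rw [mem_taylor_ports]
    rw [taylor_eq] at h
    simp only [expand, Option.map_eq_some_iff] at h
    obtain ⟨q, hq, -⟩ := h
    exact ⟨trivial, (hR.isGround.1.wire _ _ hq).1, Or.inl rfl⟩
  | copy o e₁ n =>
    rw [taylor_copy_mem]
    by_contra hc
    rw [taylor_eq] at h
    simp [expand, hc] at h

/-- Induction on the name: one unfolding of `expand` adds one outer step to the path, and `glue`
drops this step under the same condition as `resL`. -/
theorem taylor_target {i : ℕ} {R : CircPS α} {e : PseudoExp R} {n : PortName R}
    (h : n ∈ (taylor i R e).ground.ports) :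
    ((taylor i R e).ground.target n).map pos = tgtL ⟨R, e⟩ n.lvl n.core := by
  induction n with
  | @base R p =>
    rw [taylor_eq]
    simp only [expand, lvl_base, core_base, tgtL_nil]
    cases R.ground.target p <;> rfl
  | @copy R o e₁ n ih =>
    have hc := taylor_copy_mem.1 h
    have ih := ih (e := e₁) hc.2.2.1
    conv_lhs => rw [taylor_eq]
    simp only [expand, hc, if_true]
    cases ht : (taylor i (R.box o) e₁).ground.target n with
    | none =>
      rw [ht] at ih
      simp only [Option.map_none, lvl_copy, core_copy, asBase_eq] at ih ⊢
      -- At the empty level, `n` is a conclusion of the copied content and the door of `o` gives its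
      -- target; at a deeper level, a target that is missing in the inner expansion stays missing.
      by_cases hl : n.lvl = []
      · rw [hl] at ih ⊢
        have ih := Option.map_eq_none_iff.1 (tgtL_nil.symm.trans ih.symm)
        rw [← List.nil_append [_], tgtL_snoc_of_none ih]
        simp only [if_true, Option.bind_some, endSt_nil, CircPS.doorFn_coe]
        cases R.door o n.core <;> rfl
      · obtain ⟨l, x, hl'⟩ := (List.eq_nil_or_concat' _).resolve_left hl
        rw [hl'] at ih ⊢
        simp only [List.append_eq_nil_iff, List.cons_ne_self, and_false, if_false,
          Option.bind_none, Option.map_none]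
        cases hx : x.2.1.ground.target n.core with
        | some p' => rw [tgtL_of_some (by simpa using hx)] at ih; cases ih
        | none =>
          rw [← List.cons_append, tgtL_snoc_of_none hx]
          rw [tgtL_snoc_of_none hx] at ih
          exact (Option.map_eq_none_iff.2 (Option.map_eq_none_iff.1 ih.symm)).symm
    | some n' =>
      rw [ht] at ih
      simp only [Option.map_some, lvl_copy, core_copy] at ih ⊢
      have ih' : tgtL ⟨R.box o, e₁⟩ n.lvl n.core = some (n'.lvl, n'.core) := ih.symm
      symm
      rw [pos, lvl_glue, core_glue]
      rcases tgtL_eq_some.1 ih' with ⟨h1, h2⟩ | ⟨l₀, x, h1, h2, h3, h4⟩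
      · refine tgtL_eq_some.2 (Or.inl ⟨h1, ?_⟩)
        rw [resL_cons, ← h2]
      · refine tgtL_eq_some.2 (Or.inr ⟨(o.1, ⟨R.box o, e₁⟩) :: l₀, x, by rw [h1]; rfl, h2, h3, ?_⟩)
        rw [resL_cons, ← h4]

theorem taylor_target_eq_some {i : ℕ} {R : CircPS α} (hR : R.IsCircPS) {e : PseudoExp R}
    {n n' : PortName R} : (taylor i R e).ground.target n = some n' ↔
      n ∈ (taylor i R e).ground.ports ∧ tgtL ⟨R, e⟩ n.lvl n.core = some (n'.lvl, n'.core) := by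
  constructor
  · intro h
    have hn := mem_ports_of_taylor_target hR h
    exact ⟨hn, by rw [← taylor_target hn, h]; rfl⟩
  · rintro ⟨hn, h⟩
    rw [← taylor_target hn] at h
    obtain ⟨m, h1, h2⟩ := Option.map_eq_some_iff.1 h
    rw [h1, pos_injective (h2 : pos m = pos n')]

theorem bang_not_circ {A : CircPS α} {o : α} (h : o ∈ A.ground.portsOf .bang) :
    o ∉ A.circConclusions := by
  intro hc
  have h1 := (Finset.mem_filter.1 h).2
  have h2 := (Finset.mem_filter.1 hc).2
  rw [h1] at h2
  cases h2

theorem taylor_boxes0_copy {i : ℕ} {R : CircPS α} {e : PseudoExp R} {o : {o // o ∈ R.boxes0}}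
    {e₁ : PseudoExp (R.box o)} {n : PortName (R.box o)} :
    copy o e₁ n ∈ (taylor i R e).boxes0 ↔ n ∈ (taylor i (R.box o) e₁).boxes0 ∧
      IsCopied i R e (fun o e₁ => taylor i (R.box o) e₁) o e₁ n := by
  rw [taylor_eq i R]
  simp only [expand, Finset.mem_union, Finset.mem_image, reduceCtorEq, and_false,
    exists_false, Finset.mem_biUnion, Finset.mem_attach, true_and, false_or,
    Finset.mem_filter, copy.injEq]
  constructor
  · rintro ⟨o', e', h1, n', h2, rfl, h4⟩
    obtain ⟨h4, h5⟩ := h4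
    cases h4; cases h5
    exact h2
  · intro h
    exact ⟨o, e₁, h.2.2.1, n, h, rfl, HEq.rfl, HEq.rfl⟩

theorem mem_taylor_boxes0 {i : ℕ} {R : CircPS α} (hR : R.IsCircPS) {e : PseudoExp R}
    {n : PortName R} : n ∈ (taylor i R e).boxes0 ↔ n ∈ (taylor i R e).ground.ports ∧
      n.core ∈ (endSt ⟨R, e⟩ n.lvl).1.boxes0 ∧
      ((endSt ⟨R, e⟩ n.lvl).1.content n.core).depth < i := by
  induction n with
  | @base R p =>
    rw [mem_taylor_ports, taylor_eq]
    simp only [expand, Finset.mem_union, Finset.mem_image, Finset.mem_filter, Finset.mem_attach,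
      true_and, base.injEq, Finset.mem_biUnion, reduceCtorEq, and_false, exists_false, or_false,
      lvl_base, core_base, isLevel_nil, endSt_nil, true_or, and_true]
    constructor
    · rintro ⟨o, h1, rfl⟩
      have ho : o.1 ∈ R.ground.portsOf .bang := hR.boxes0_eq ▸ o.2
      exact ⟨(Finset.mem_filter.1 ho).1, o.2, by rwa [R.content_coe]⟩
    · rintro ⟨-, h1, h2⟩
      exact ⟨⟨p, h1⟩, by rwa [← R.content_coe], rfl⟩
  | @copy R o e₁ n ih =>
    rw [taylor_boxes0_copy, taylor_copy_mem, ih (hR.box o)]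
    constructor
    · rintro ⟨⟨h1, h2⟩, h3⟩
      exact ⟨h3, h2⟩
    · rintro ⟨h1, h2⟩
      exact ⟨⟨h1.2.2.1, h2⟩, h1⟩

theorem taylor_box {i : ℕ} {R : CircPS α} (hR : R.IsCircPS) {e : PseudoExp R}
    {n : PortName R} (h : n ∈ (taylor i R e).boxes0) :
    (taylor i R e).box n = some ((endSt ⟨R, e⟩ n.lvl).1.content n.core) := by
  induction n with
  | @base R p =>
    obtain ⟨h1, h2, h3⟩ := (mem_taylor_boxes0 hR).1 h
    simp only [lvl_base, core_base, endSt_nil] at h2 h3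
    rw [taylor_eq]
    rw [R.content_of_mem h2] at h3
    simp [expand, h2, h3, R.content_of_mem h2]
  | @copy R o e₁ n ih =>
    rw [taylor_boxes0_copy] at h
    rw [taylor_eq]
    simp only [expand, h.2, if_true]
    exact ih (hR.box o) h.1

theorem taylor_door {i : ℕ} {R : CircPS α} (hR : R.IsCircPS) {e : PseudoExp R}
    {n : PortName R} (h : n ∈ (taylor i R e).boxes0) (r : α) :
    ((taylor i R e).door n r).map pos = doorL ⟨R, e⟩ n.lvl n.core r := by
  induction n with
  | @base R p =>
    obtain ⟨h1, h2, h3⟩ := (mem_taylor_boxes0 hR).1 h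
    simp only [lvl_base, core_base, endSt_nil] at h2 h3
    rw [taylor_eq]
    rw [R.content_of_mem h2] at h3
    simp only [expand, h2, h3, dif_pos, if_true, doorL, lvl_base, core_base, endSt_nil,
      R.doorFn_of_mem h2, Option.map_map]
    rfl
  | @copy R o e₁ n ih =>
    rw [taylor_boxes0_copy] at h
    have ih := ih (hR.box o) h.1
    conv_lhs => rw [taylor_eq]
    simp only [expand, h.2, if_true, lvl_copy, core_copy]
    simp only [doorL, endSt_cons] at ih ⊢
    cases hd : (taylor i (R.box o) e₁).door n r with
    | none =>
      rw [hd, Option.map_none, eq_comm, Option.map_eq_none_iff] at ih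
      simp [ih]
    | some n' =>
      rw [hd, Option.map_some, eq_comm, Option.map_eq_some_iff] at ih
      obtain ⟨q, h1, h2⟩ := ih
      rw [h1, Option.map_some, Option.map_some, Option.map_some, resL_cons]
      simp only [pos, Prod.mk.injEq] at h2
      rw [pos, lvl_glue, core_glue, h2.1, h2.2]

theorem taylor_door_eq_some {i : ℕ} {R : CircPS α} (hR : R.IsCircPS) {e : PseudoExp R}
    {n n' : PortName R} (h : n ∈ (taylor i R e).boxes0) (r : α) :
    (taylor i R e).door n r = some n' ↔
      doorL ⟨R, e⟩ n.lvl n.core r = some (n'.lvl, n'.core) := by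
  rw [← taylor_door hR h, Option.map_eq_some_iff]
  constructor
  · exact fun h => ⟨n', h, rfl⟩
  · rintro ⟨m, h1, h2⟩
    rw [h1, pos_injective (h2 : pos m = pos n')]

end

/-! ### Where doors and targets lead, and what each level contributes to an arity. -/

section

namespace ExpState

variable {α : Type u}

theorem resL_eq_self {ρ : ExpState α} {l : List (ExpStep α)} {q : α}
    (h : l = [] ∨ q ∉ (endSt ρ l).1.circConclusions) : resL l q = l := by
  rcases List.eq_nil_or_concat' l with rfl | ⟨l, x, rfl⟩
  · rfl
  · rw [endSt_snoc] at h
    rw [resL_snoc, if_neg (h.resolve_left (by simp))]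

theorem target_not_circ {A : CircPS α} (h : A.IsCircPS) {p q : α}
    (hp : A.ground.target p = some q) : q ∉ A.circConclusions := fun hq =>
  (h.isGround.2 p q hp).2 (Finset.mem_filter.1 hq).2

theorem target_not_bang {A : CircPS α} (h : A.IsCircPS) {p q : α}
    (hp : A.ground.target p = some q) : q ∉ A.ground.portsOf .bang := fun hq =>
  (h.isGround.2 p q hp).1 (Finset.mem_filter.1 hq).2

/-- No `∘`-port of a ground-structure has a premise, so a target inside the content is never
relocated outwards. -/
theorem tgtL_cases {i : ℕ} {ρ : ExpState α} (hρ : ρ.1.IsCircPS) {l : List (ExpStep α)}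
    (hl : IsLevel i ρ l) {p q : α} {a : List (ExpStep α)} (h : tgtL ρ l p = some (a, q)) :
    (a = l ∧ (endSt ρ l).1.ground.target p = some q) ∨
      ∃ l₀ x, l = l₀ ++ [x] ∧ x.2.1.ground.target p = none ∧
        (endSt ρ l₀).1.doorFn x.1 p = some q ∧ a = resL l₀ q := by
  rcases tgtL_eq_some.1 h with ⟨h1, rfl⟩ | h
  · exact Or.inl ⟨resL_eq_self (Or.inr (target_not_circ (hl.isCircPS hρ) h1)), h1⟩
  · exact Or.inr h

/-- The ports that may be in the image of a function `b(o)` without being main doors. -/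
def IsAux (A : CircPS α) (q : α) : Prop :=
  q ∈ A.ground.portsOf .whynot ∨ q ∈ A.ground.portsOf .circ

theorem IsAux.not_bang {A : CircPS α} {q : α} (h : IsAux A q) : q ∉ A.ground.portsOf .bang := by
  intro hb
  have hb := (Finset.mem_filter.1 hb).2
  rcases h with h | h <;> simp [(Finset.mem_filter.1 h).2] at hb

theorem IsAux.mem_ports {A : CircPS α} {q : α} (h : IsAux A q) : q ∈ A.ground.ports := by
  rcases h with h | h <;> exact (Finset.mem_filter.1 h).1

theorem IsLevel.child_box {i : ℕ} {ρ : ExpState α} {l : List (ExpStep α)} {x : ExpStep α}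
    (hl : IsLevel i ρ (l ++ [x])) : x.1 ∈ (endSt ρ l).1.boxes0 ∧
      x.2.1 = (endSt ρ l).1.content x.1 :=
  ⟨child_mem (isLevel_snoc.1 hl).2, child_content (isLevel_snoc.1 hl).2⟩

theorem door_circ_parent {i : ℕ} {ρ : ExpState α} (hρ : ρ.1.IsCircPS) {l : List (ExpStep α)}
    {x : ExpStep α} (hl : IsLevel i ρ (l ++ [x])) {q : α} (hq : q ∈ x.2.1.circConclusions) :
    (endSt ρ l).1.doorFn x.1 q = some q := by
  have h := (hl.of_prefix (List.prefix_append _ _)).isCircPS hρ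
  rw [hl.child_box.2] at hq
  exact h.doorFn_circ hl.child_box.1 hq

theorem circ_parent {i : ℕ} {ρ : ExpState α} (hρ : ρ.1.IsCircPS) {l : List (ExpStep α)}
    {x : ExpStep α} (hl : IsLevel i ρ (l ++ [x])) {q : α} (hq : q ∈ x.2.1.circConclusions) :
    IsAux (endSt ρ l).1 q := by
  have h := (hl.of_prefix (List.prefix_append _ _)).isCircPS hρ
  have hd := h.isDoor hl.child_box.1
  have hq' := door_circ_parent hρ hl hq
  rw [hl.child_box.2] at hq
  rcases hd.cod _ _ hq' with rfl | h1 | h1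
  · exact absurd (h.boxes0_eq ▸ hl.child_box.1) (hd.circ_not_bang _ hq _ hq')
  · exact Or.inl h1
  · exact Or.inr h1

/-- A door never sends a `∘`-port to a `!`-port (`circ_not_bang`), so each relocation outwards
yields a `?`- or `∘`-port again. The second half says that the relocation stops at a true port of
the expansion. -/
theorem resL_aux {i : ℕ} {ρ : ExpState α} (hρ : ρ.1.IsCircPS) {l : List (ExpStep α)}
    (hl : IsLevel i ρ l) {q : α} (hq : IsAux (endSt ρ l).1 q) :
    IsAux (endSt ρ (resL l q)).1 q ∧
      (resL l q = [] ∨ q ∉ (endSt ρ (resL l q)).1.circConclusions) := by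
  induction l using List.reverseRecOn with
  | nil => exact ⟨hq, Or.inl rfl⟩
  | append_singleton l x ih =>
    rw [resL_snoc]
    split_ifs with hc
    · exact ih (hl.of_prefix (List.prefix_append _ _)) (circ_parent hρ hl hc)
    · refine ⟨hq, Or.inr ?_⟩
      rwa [endSt_snoc]

/-- At each relocation the inner arity is a summand of the outer one. -/
theorem arity_le_resL {i : ℕ} {ρ : ExpState α} (hρ : ρ.1.IsCircPS) {l : List (ExpStep α)}
    (hl : IsLevel i ρ l) (q : α) :
    (endSt ρ l).1.arity q ≤ (endSt ρ (resL l q)).1.arity q := by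
  induction l using List.reverseRecOn with
  | nil => exact le_rfl
  | append_singleton l x ih =>
    rw [resL_snoc]
    have hl' := hl.of_prefix (List.prefix_append _ _)
    split_ifs with hc
    · refine le_trans ?_ (ih hl')
      rw [endSt_snoc]
      rw [hl.child_box.2] at hc ⊢
      exact (Nat.le_add_left _ _).trans
        (CircPS.arity_le_of_circ (hl'.isCircPS hρ) hl.child_box.1 hc)
    · exact le_rfl

/-- `(l, q)` is the position of a port. -/
def IsPort (i : ℕ) (ρ : ExpState α) (l : List (ExpStep α)) (q : α) : Prop :=
  IsLevel i ρ l ∧ q ∈ (endSt ρ l).1.ground.ports ∧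
    (l = [] ∨ q ∉ (endSt ρ l).1.circConclusions)

theorem door_result {i : ℕ} {ρ : ExpState α} (hρ : ρ.1.IsCircPS) {l : List (ExpStep α)}
    (hl : IsLevel i ρ l) {o r q : α} (h : (endSt ρ l).1.doorFn o r = some q) :
    (q = o ∧ resL l q = l ∧ q ∈ (endSt ρ l).1.ground.portsOf .bang) ∨
      IsAux (endSt ρ l).1 q ∧ IsAux (endSt ρ (resL l q)).1 q := by
  have hl' := hl.isCircPS hρ
  have ho := CircPS.mem_boxes0_of_doorFn h
  have haux : IsAux (endSt ρ l).1 q →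
      IsAux (endSt ρ l).1 q ∧ IsAux (endSt ρ (resL l q)).1 q :=
    fun ha => ⟨ha, (resL_aux hρ hl ha).1⟩
  rcases (hl'.isDoor ho).cod _ _ h with rfl | h1 | h1
  · rw [hl'.boxes0_eq] at ho
    exact Or.inl ⟨rfl, resL_eq_self (Or.inr (bang_not_circ ho)), ho⟩
  · exact Or.inr (haux (Or.inl h1))
  · exact Or.inr (haux (Or.inr h1))

theorem door_result_port {i : ℕ} {ρ : ExpState α} (hρ : ρ.1.IsCircPS) {l : List (ExpStep α)}
    (hl : IsLevel i ρ l) {o r q : α} (h : (endSt ρ l).1.doorFn o r = some q) :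
    IsPort i ρ (resL l q) q ∧ (q ∈ (endSt ρ (resL l q)).1.ground.portsOf .bang ∨
      IsAux (endSt ρ (resL l q)).1 q) := by
  rcases door_result hρ hl h with ⟨-, h2, h3⟩ | ⟨h1, h2⟩
  · rw [h2]
    exact ⟨⟨hl, (Finset.mem_filter.1 h3).1, Or.inr (bang_not_circ h3)⟩, Or.inl h3⟩
  · exact ⟨⟨hl.of_prefix (resL_prefix _ _), h2.mem_ports, (resL_aux hρ hl h1).2⟩, Or.inr h2⟩

/-- The target of a port at another level is an exponential port. -/
theorem tgtL_cross {i : ℕ} {ρ : ExpState α} (hρ : ρ.1.IsCircPS) {l : List (ExpStep α)}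
    (hl : IsLevel i ρ l) {p q : α} {a : List (ExpStep α)} (h : tgtL ρ l p = some (a, q))
    (hal : a ≠ l) : IsPort i ρ a q ∧ (q ∈ (endSt ρ a).1.ground.portsOf .bang ∨
      IsAux (endSt ρ a).1 q) := by
  rcases tgtL_cases hρ hl h with ⟨h1, -⟩ | ⟨l₀, x, rfl, -, h2, rfl⟩
  · exact absurd h1 hal
  · exact door_result_port hρ (hl.of_prefix (List.prefix_append _ _)) h2

theorem doorL_port {i : ℕ} {ρ : ExpState α} (hρ : ρ.1.IsCircPS) {l : List (ExpStep α)}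
    (hl : IsLevel i ρ l) {o r q : α} {a : List (ExpStep α)} (h : doorL ρ l o r = some (a, q)) :
    IsPort i ρ a q ∧ (q ∈ (endSt ρ a).1.ground.portsOf .bang ∨ IsAux (endSt ρ a).1 q) := by
  obtain ⟨h1, rfl⟩ := doorL_eq_some.1 h
  exact door_result_port hρ hl h1

theorem tgtL_port {i : ℕ} {ρ : ExpState α} (hρ : ρ.1.IsCircPS) {l : List (ExpStep α)}
    (hl : IsLevel i ρ l) {p q : α} {a : List (ExpStep α)} (h : tgtL ρ l p = some (a, q)) :
    IsPort i ρ a q := by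
  by_cases hal : a = l
  · rcases tgtL_cases hρ hl h with ⟨rfl, h1⟩ | ⟨l₀, x, h0, -, -, h2⟩
    · have h3 := hl.isCircPS hρ
      exact ⟨hl, (h3.isGround.1.wire _ _ h1).2.2.1, Or.inr (target_not_circ h3 h1)⟩
    · have := (resL_prefix l₀ q).length_le
      rw [← h2, hal, h0] at this
      simp at this
  · exact (tgtL_cross hρ hl h hal).1

/-- A `!`-port of a ground-structure has no premises. It can only be reached from a copy of the
content of its own box, through the main door. -/
theorem tgtL_bang {i : ℕ} {ρ : ExpState α} (hρ : ρ.1.IsCircPS) {l : List (ExpStep α)}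
    (hl : IsLevel i ρ l) {p q : α} {a : List (ExpStep α)} (h : tgtL ρ l p = some (a, q))
    (hq : q ∈ (endSt ρ a).1.ground.portsOf .bang) : ∃ x, l = a ++ [x] ∧ x.1 = q := by
  rcases tgtL_cases hρ hl h with ⟨rfl, h1⟩ | ⟨l₀, x, rfl, -, h2, rfl⟩
  · exact absurd hq (target_not_bang (hl.isCircPS hρ) h1)
  · rcases door_result hρ (hl.of_prefix (List.prefix_append _ _)) h2 with ⟨h3, h4, -⟩ | ⟨-, h4⟩
    · exact ⟨x, by rw [h4], h3.symm⟩
    · exact absurd hq h4.not_bang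

theorem doorL_bang {i : ℕ} {ρ : ExpState α} (hρ : ρ.1.IsCircPS) {l : List (ExpStep α)}
    (hl : IsLevel i ρ l) {o r q : α} {a : List (ExpStep α)} (h : doorL ρ l o r = some (a, q))
    (hq : q ∈ (endSt ρ a).1.ground.portsOf .bang) : a = l ∧ o = q := by
  obtain ⟨h1, rfl⟩ := doorL_eq_some.1 h
  rcases door_result hρ hl h1 with ⟨h3, h4, -⟩ | ⟨-, h4⟩
  · exact ⟨h4, h3.symm⟩
  · exact absurd hq h4.not_bang

theorem exists_doorL_main {i : ℕ} {ρ : ExpState α} (hρ : ρ.1.IsCircPS) {l : List (ExpStep α)}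
    (hl : IsLevel i ρ l) {o : α} (ho : o ∈ (endSt ρ l).1.boxes0) :
    ∃ r, doorL ρ l o r = some (l, o) := by
  have h := hl.isCircPS hρ
  obtain ⟨r, hr⟩ := (h.isDoor ho).main
  rw [h.boxes0_eq] at ho
  exact ⟨r, doorL_eq_some.2 ⟨hr, (resL_eq_self (Or.inr (bang_not_circ ho))).symm⟩⟩

/-- The contribution of the copy at level `l` to the arity of the port at position `n`. -/
noncomputable def contrib (i : ℕ) (ρ : ExpState α) (l : List (ExpStep α))
    (n : List (ExpStep α) × α) : ℕ :=
  ((endSt ρ l).1.ground.ports.filter fun p =>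
    (l = [] ∨ p ∉ (endSt ρ l).1.circConclusions) ∧ tgtL ρ l p = some n).card +
  ∑ o ∈ (endSt ρ l).1.boxes0.filter (fun o => ((endSt ρ l).1.content o).depth < i),
    ((endSt ρ l).1.content o).boxArity (doorL ρ l o) n

/-- This is the invariance under shapes that `baseDigit_sum_levels` requires of arities; the prefix
and length conditions match the two levels of the target. -/
theorem contrib_congr {i : ℕ} {ρ ρ' : ExpState α} (hρ : ρ.1 = ρ'.1)
    {l l' a a' : List (ExpStep α)} (h : shape l = shape l') (ha : a <+: l) (ha' : a' <+: l')
    (hlen : a.length = a'.length) (q : α) :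
    contrib i ρ l (a, q) = contrib i ρ' l' (a', q) := by
  have h1 : l = [] ↔ l' = [] := by
    rw [← List.length_eq_zero_iff, length_eq_of_shape h, List.length_eq_zero_iff]
  have h2 : ∀ p, tgtL ρ l p = some (a, q) ↔ tgtL ρ' l' p = some (a', q) := fun p =>
    ⟨fun ht => tgtL_congr hρ h ht ha' hlen, fun ht => tgtL_congr hρ.symm h.symm ht ha hlen.symm⟩
  have h3 : ∀ o p, doorL ρ l o p = some (a, q) ↔ doorL ρ' l' o p = some (a', q) := fun o p =>
    ⟨fun ht => doorL_congr hρ h ht ha' hlen,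
      fun ht => doorL_congr hρ.symm h.symm ht ha hlen.symm⟩
  unfold contrib CircPS.boxArity
  simp only [endSt_congr hρ h, h1, h2, h3]
  congr!

theorem boxArity_doorL {ρ : ExpState α} {l a : List (ExpStep α)} (A : CircPS α) (o q : α) :
    A.boxArity (doorL ρ l o) (a, q) =
      if a = resL l q then A.boxArity ((endSt ρ l).1.doorFn o) q else 0 := by
  unfold CircPS.boxArity
  simp only [doorL_eq_some]
  split_ifs with h <;> simp [h]

/-- What one copy sends to a port is already counted, once, in the arity of that port in the
unexpanded content. So the cosize of `R` bounds every digit of an arity, and expansion only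
multiplies contributions by numbers of copies. -/
theorem contrib_le {i : ℕ} {ρ : ExpState α} (hρ : ρ.1.IsCircPS) {l : List (ExpStep α)}
    (hl : IsLevel i ρ l) (a : List (ExpStep α)) (q : α) :
    contrib i ρ l (a, q) ≤ (endSt ρ a).1.arity q := by
  have hc := hl.isCircPS hρ
  have hsum : ∑ o ∈ (endSt ρ l).1.boxes0.filter (fun o => ((endSt ρ l).1.content o).depth < i),
      ((endSt ρ l).1.content o).boxArity (doorL ρ l o) (a, q) ≤
      if a = resL l q then
        ∑ o ∈ (endSt ρ l).1.boxes0, ((endSt ρ l).1.content o).boxArity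
          ((endSt ρ l).1.doorFn o) q else 0 := by
    simp only [boxArity_doorL]
    split_ifs with h
    · exact Finset.sum_le_sum_of_subset (Finset.filter_subset _ _)
    · simp
  -- When no wire inside the copy can end at `(a, q)`, the counted ports are plain conclusions of
  -- the content, sent to `q` by the door function of the parent.
  have hplain : ∀ {l₀ x}, l = l₀ ++ [x] →
      (∀ p, (endSt ρ l).1.ground.target p = some q → a ≠ l) →
      ((endSt ρ l).1.ground.ports.filter fun p =>
        (l = [] ∨ p ∉ (endSt ρ l).1.circConclusions) ∧ tgtL ρ l p = some (a, q)).card ≤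
      if a = resL l₀ q then (((endSt ρ l₀).1.content x.1).plainConclusions.filter fun p =>
        (endSt ρ l₀).1.doorFn x.1 p = some q).card else 0 := by
    rintro l₀ x rfl hne
    have hx := hl.child_box.2
    by_cases ha : a = resL l₀ q
    · rw [if_pos ha, ← hx]
      refine Finset.card_le_card fun p hp => ?_
      obtain ⟨h1, h2, h3⟩ := Finset.mem_filter.1 hp
      rcases tgtL_cases hρ hl h3 with ⟨h4, h5⟩ | ⟨l₁, x', h4, h5, h6, -⟩
      · exact absurd h4 (hne p h5)
      · obtain ⟨rfl, h7⟩ := List.append_inj' h4 rfl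
        cases h7
        rw [endSt_snoc] at h1 h2
        exact Finset.mem_filter.2 ⟨Finset.mem_sdiff.2 ⟨Finset.mem_filter.2 ⟨h1, h5⟩,
          h2.resolve_left (by simp)⟩, h6⟩
    · rw [if_neg ha, Nat.le_zero, Finset.card_eq_zero, Finset.filter_eq_empty_iff]
      rintro p - ⟨-, h3⟩
      rcases tgtL_cases hρ hl h3 with ⟨h4, h5⟩ | ⟨l₁, x', h4, h5, h6, h8⟩
      · exact absurd h4 (hne p h5)
      · obtain ⟨rfl, h7⟩ := List.append_inj' h4 rfl
        exact ha h8
  -- If `q` is a `∘`-port of the content, plain conclusions of the content and boxes inside it can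
  -- both reach the relocated `q`; `arity_le_of_circ` bounds their sum.
  by_cases hq : ∃ l₀ x, l = l₀ ++ [x] ∧ q ∈ x.2.1.circConclusions
  · obtain ⟨l₀, x, rfl, hq⟩ := hq
    have h1 := hplain rfl (fun p hp => absurd (by simpa using hq) (target_not_circ hc hp))
    have hres : resL (l₀ ++ [x]) q = resL l₀ q := by rw [resL_snoc, if_pos hq]
    rw [hres] at hsum
    by_cases ha : a = resL l₀ q
    · rw [if_pos ha] at h1 hsum
      have hl₀ := hl.of_prefix (List.prefix_append _ _)
      have h2 := CircPS.arity_le_of_circ (hl₀.isCircPS hρ) hl.child_box.1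
        (hl.child_box.2 ▸ hq)
      have h3 := arity_le_resL hρ hl₀ q
      have h4 := (endSt ρ (l₀ ++ [x])).1.arity_eq_boxArity q
      rw [← ha] at h3
      rw [← hl.child_box.2] at h1 h2
      rw [endSt_snoc] at h4
      unfold contrib
      simp only [endSt_snoc] at h1 hsum ⊢
      omega
    · rw [if_neg ha] at h1 hsum
      unfold contrib
      omega
  · have hres : resL l q = l := by
      rcases List.eq_nil_or_concat' l with rfl | ⟨l₀, x, rfl⟩
      · rfl
      · rw [resL_snoc, if_neg fun h => hq ⟨l₀, x, rfl, h⟩]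
    rw [hres] at hsum
    -- If `q` is not a `∘`-port of the content, the two sources exclude each other: with `a = l`
    -- only inner wires and inner boxes count, and otherwise only conclusions that leave the copy.
    by_cases ha : a = l
    · subst ha
      rw [if_pos rfl] at hsum
      have h1 : ((endSt ρ a).1.ground.ports.filter fun p =>
          (a = [] ∨ p ∉ (endSt ρ a).1.circConclusions) ∧ tgtL ρ a p = some (a, q)).card ≤
          (endSt ρ a).1.ground.arity q := by
        refine Finset.card_le_card fun p hp => ?_
        obtain ⟨h1, h2, h3⟩ := Finset.mem_filter.1 hp
        rcases tgtL_cases hρ hl h3 with ⟨-, h5⟩ | ⟨l₁, x', h4, h5, h6, h7⟩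
        · exact Finset.mem_filter.2 ⟨Finset.mem_filter.2 ⟨h1, by simp [h5]⟩, h5⟩
        · have := (resL_prefix l₁ q).length_le
          rw [← h7, h4] at this
          simp at this
      rw [CircPS.arity_eq_boxArity]
      unfold contrib
      omega
    · rw [if_neg ha] at hsum
      rcases List.eq_nil_or_concat' l with rfl | ⟨l₀, x, rfl⟩
      · have h1 : ((endSt ρ []).1.ground.ports.filter fun p =>
          (([] : List (ExpStep α)) = [] ∨ p ∉ (endSt ρ []).1.circConclusions) ∧
            tgtL ρ [] p = some (a, q)).card = 0 := by
          rw [Finset.card_eq_zero, Finset.filter_eq_empty_iff]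
          rintro p - ⟨-, h3⟩
          have := tgtL_prefix h3
          exact ha (List.prefix_nil.1 this)
        unfold contrib
        omega
      · have h1 := hplain rfl (fun p _ => ha)
        unfold contrib
        split_ifs at h1 with h2
        · have hl₀ := hl.of_prefix (List.prefix_append _ _)
          have h3 := arity_le_resL hρ hl₀ q
          have h4 := (endSt ρ l₀).1.arity_eq_boxArity q
          have h5 := Finset.single_le_sum (f := fun o =>
            ((endSt ρ l₀).1.content o).boxArity ((endSt ρ l₀).1.doorFn o) q)
            (fun _ _ => Nat.zero_le _) hl.child_box.1
          simp only [CircPS.boxArity] at h4 h5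
          rw [← h2] at h3
          omega
        · omega

theorem exists_of_contrib_ne_zero {i : ℕ} {ρ : ExpState α} {l : List (ExpStep α)}
    {n : List (ExpStep α) × α} (h : contrib i ρ l n ≠ 0) :
    (∃ p ∈ (endSt ρ l).1.ground.ports, (l = [] ∨ p ∉ (endSt ρ l).1.circConclusions) ∧
      tgtL ρ l p = some n) ∨
    ∃ o ∈ (endSt ρ l).1.boxes0, ((endSt ρ l).1.content o).depth < i ∧
      ∃ r, doorL ρ l o r = some n := by
  by_contra! hc
  apply h
  have h1 : ((endSt ρ l).1.ground.ports.filter fun p =>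
      (l = [] ∨ p ∉ (endSt ρ l).1.circConclusions) ∧ tgtL ρ l p = some n).card = 0 := by
    rw [Finset.card_eq_zero, Finset.filter_eq_empty_iff]
    rintro p hp ⟨h1, h2⟩
    exact hc.1 p hp h1 h2
  rw [contrib, h1, zero_add]
  refine Finset.sum_eq_zero fun o ho => ?_
  obtain ⟨h2, h3⟩ := Finset.mem_filter.1 ho
  by_contra h4
  obtain ⟨r, hr⟩ := CircPS.exists_of_boxArity_ne_zero h4
  exact hc.2 o h2 h3 r hr

theorem contrib_ne_zero_of_tgtL {i : ℕ} {ρ : ExpState α} {l : List (ExpStep α)}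
    {n : List (ExpStep α) × α} {p : α} (hp : IsPort i ρ l p) (h : tgtL ρ l p = some n) :
    contrib i ρ l n ≠ 0 := by
  have := Finset.card_pos.2 ⟨p, (Finset.mem_filter (p := fun p =>
    (l = [] ∨ p ∉ (endSt ρ l).1.circConclusions) ∧ tgtL ρ l p = some n)).2
      ⟨hp.2.1, hp.2.2, h⟩⟩
  unfold contrib
  omega

theorem contrib_ne_zero_of_doorL {i : ℕ} {ρ : ExpState α} (hρ : ρ.1.IsCircPS)
    {l : List (ExpStep α)} (hl : IsLevel i ρ l) {n : List (ExpStep α) × α} {o r : α}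
    (hd : ((endSt ρ l).1.content o).depth < i) (h : doorL ρ l o r = some n) :
    contrib i ρ l n ≠ 0 := by
  obtain ⟨a, q⟩ := n
  obtain ⟨h1, h2⟩ := doorL_eq_some.1 h
  have hc := hl.isCircPS hρ
  have ho := CircPS.mem_boxes0_of_doorFn h1
  have h3 := CircPS.boxArity_pos (hc.content o) (((hc.isDoor ho).dom r).1 (by simp [h1])) h
  have h4 := Finset.single_le_sum (f := fun o =>
    ((endSt ρ l).1.content o).boxArity (doorL ρ l o) (a, q)) (fun _ _ => Nat.zero_le _)
    ((Finset.mem_filter (p := fun o => ((endSt ρ l).1.content o).depth < i)).2 ⟨ho, hd⟩)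
  unfold contrib
  omega

theorem prefix_of_contrib_ne_zero {i : ℕ} {ρ : ExpState α} {l a : List (ExpStep α)} {q : α}
    (h : contrib i ρ l (a, q) ≠ 0) : a <+: l := by
  rcases exists_of_contrib_ne_zero h with ⟨p, -, -, hp⟩ | ⟨o, -, -, r, hr⟩
  · exact tgtL_prefix hp
  · exact doorL_prefix hr

end ExpState

end

/-! ### Base `k` digits, `k`-injectivity and the counting principle. -/

section

open PortName ExpState

section Digits

theorem baseDigit_succ (k n j : ℕ) : baseDigit k n (j + 1) = baseDigit k (n / k) j := by
  rw [baseDigit, baseDigit, pow_succ', Nat.div_div_eq_div_mul]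

/-- Division by `k` removes digit `0` and shifts the other ones, whence the induction on `j` with
`d` generalized. -/
theorem baseDigit_sum_range {k : ℕ} (d : ℕ → ℕ) (hd : ∀ j, d j < k) (M j : ℕ) :
    baseDigit k (∑ m ∈ Finset.range M, d m * k ^ m) j = if j < M then d j else 0 := by
  have hk : 0 < k := (Nat.zero_le _).trans_lt (hd 0)
  induction j generalizing d M with
  | zero =>
    cases M with
    | zero => simp [baseDigit]
    | succ M =>
      rw [Finset.sum_range_succ']
      simp only [pow_succ, ← mul_assoc, ← Finset.sum_mul]
      simp [baseDigit, Nat.mod_eq_of_lt (hd 0)]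
  | succ j ih =>
    rw [baseDigit_succ]
    cases M with
    | zero => simp [baseDigit]
    | succ M =>
      rw [Finset.sum_range_succ']
      simp only [pow_succ, ← mul_assoc, ← Finset.sum_mul]
      rw [pow_zero, mul_one, Nat.add_comm, Nat.add_mul_div_right _ _ hk,
        Nat.div_eq_of_lt (hd 0), zero_add, ih (fun m => d (m + 1)) fun m => hd _]
      simp

theorem baseDigit_sum {k : ℕ} (d : ℕ → ℕ) (hd : ∀ j, d j < k) (J : Finset ℕ) (j : ℕ) :
    baseDigit k (∑ m ∈ J, d m * k ^ m) j = if j ∈ J then d j else 0 := by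
  have hk : 0 < k := (Nat.zero_le _).trans_lt (hd 0)
  obtain ⟨M, hM⟩ : ∃ M, J ⊆ Finset.range M :=
    ⟨J.sup id + 1, fun m hm => Finset.mem_range.2 (Nat.lt_succ_of_le (Finset.le_sup (f := id) hm))⟩
  have h1 : ∑ m ∈ J, d m * k ^ m =
      ∑ m ∈ Finset.range M, (if m ∈ J then d m else 0) * k ^ m := by
    simp only [ite_mul, zero_mul]
    rw [← Finset.sum_filter, Finset.filter_mem_eq_inter, Finset.inter_eq_right.2 hM]
  rw [h1, baseDigit_sum_range _ fun m => by split_ifs; exacts [hd m, hk]]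
  by_cases hj : j ∈ J
  · simp [hj, Finset.mem_range.1 (hM hj)]
  · simp [hj]

theorem baseDigit_finsupp {k n : ℕ} (m : ℕ →₀ ℕ) (hm : ∀ j, m j < k)
    (h : n = m.sum fun j d => d * k ^ j) (j : ℕ) : baseDigit k n j = m j := by
  rw [h, Finsupp.sum, baseDigit_sum _ hm]
  split_ifs with hj
  · rfl
  · exact (Finsupp.notMem_support_iff.1 hj).symm

end Digits

variable {α : Type u}

/-- Premises and kept boxes that reach `n` are sorted by level; inside one level a port is the same
thing as its core. -/
theorem taylor_arity {i : ℕ} {R : CircPS α} (hR : R.IsCircPS) (e : PseudoExp R)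
    (n : PortName R) :
    (taylor i R e).arity n = ∑ l ∈ levels i ⟨R, e⟩, contrib i ⟨R, e⟩ l n.pos := by
  rw [DiffPS.arity_eq_boxArity]
  simp only [contrib, Finset.sum_add_distrib]
  congr 1
  · rw [Ground.arity, Finset.card_eq_sum_card_fiberwise (f := lvl) (t := levels i ⟨R, e⟩)]
    · refine Finset.sum_congr rfl fun l hl => ?_
      refine Finset.card_bij (fun w _ => w.core) ?_ ?_ ?_
      · intro w hw
        obtain ⟨hw', rfl⟩ := Finset.mem_filter.1 hw
        obtain ⟨hw1, hw2⟩ := (taylor_target_eq_some hR).1 (Finset.mem_filter.1 hw').2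
        exact Finset.mem_filter.2 ⟨(mem_taylor_ports.1 hw1).2.1, (mem_taylor_ports.1 hw1).2.2, hw2⟩
      · intro w hw w' hw' h
        exact ext_lvl_core ((Finset.mem_filter.1 hw).2.trans (Finset.mem_filter.1 hw').2.symm) h
      · intro p hp
        obtain ⟨h1, h2, h3⟩ := Finset.mem_filter.1 hp
        obtain ⟨w, rfl, rfl⟩ := exists_of_isLevel (mem_levels.1 hl) p
        have hw := mem_taylor_ports.2 ⟨mem_levels.1 hl, h1, h2⟩
        have ht := (taylor_target_eq_some hR).2 ⟨hw, h3⟩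
        exact ⟨w, Finset.mem_filter.2 ⟨Finset.mem_filter.2
          ⟨Finset.mem_filter.2 ⟨hw, by simp [ht]⟩, ht⟩, rfl⟩, rfl⟩
    · intro w hw
      exact mem_levels.2 (mem_taylor_ports.1
        (Finset.mem_filter.1 (Finset.mem_filter.1 hw).1).1).1
  · rw [← Finset.sum_fiberwise_of_maps_to (g := lvl) (t := levels i ⟨R, e⟩)]
    · refine Finset.sum_congr rfl fun l hl => ?_
      refine Finset.sum_bij (fun b _ => b.core) ?_ ?_ ?_ ?_
      · intro b hb
        obtain ⟨hb', rfl⟩ := Finset.mem_filter.1 hb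
        exact Finset.mem_filter.2 ((mem_taylor_boxes0 hR).1 hb').2
      · intro b hb b' hb' h
        exact ext_lvl_core ((Finset.mem_filter.1 hb).2.trans (Finset.mem_filter.1 hb').2.symm) h
      · intro o ho
        obtain ⟨h1, h2⟩ := Finset.mem_filter.1 ho
        obtain ⟨b, rfl, rfl⟩ := exists_of_isLevel (mem_levels.1 hl) o
        have h3 := h1
        rw [((mem_levels.1 hl).isCircPS hR).boxes0_eq] at h3
        exact ⟨b, Finset.mem_filter.2 ⟨(mem_taylor_boxes0 hR).2 ⟨mem_taylor_ports.2
          ⟨mem_levels.1 hl, (Finset.mem_filter.1 h3).1, Or.inr (bang_not_circ h3)⟩, h1, h2⟩,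
          rfl⟩, rfl⟩
      · intro b hb
        obtain ⟨hb', rfl⟩ := Finset.mem_filter.1 hb
        rw [taylor_box hR hb']
        exact CircPS.boxArity_congr _ fun p => taylor_door_eq_some hR hb' p
    · intro b hb
      exact mem_levels.2 (mem_taylor_ports.1 ((mem_taylor_boxes0 hR).1 hb).1).1

namespace PseudoExp

theorem mem_numCopies {R : CircPS α} {e : PseudoExp R} {l : List α} {m : ℕ} :
    m ∈ numCopies R e l ↔ ∃ o : {o // o ∈ R.boxes0}, (l = [o.1] ∧ m = (e.copies o).card) ∨
      ∃ l' ∈ (R.box o).boxes, l = o.1 :: l' ∧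
        ∃ e₁ ∈ e.copies o, m ∈ numCopies (R.box o) e₁ l' := by
  cases R; rw [numCopies]; rfl

theorem KInjective.pow {k : ℕ} {R : CircPS α} {e : PseudoExp R} (h : KInjective k R e)
    {l : List α} (hl : l ∈ R.boxes) {m : ℕ} (hm : m ∈ numCopies R e l) : ∃ j > 0, m = k ^ j := by
  cases R; rw [KInjective] at h; exact h.1 l hl m hm

theorem KInjective.copies_eq {k : ℕ} {R : CircPS α} {e : PseudoExp R} (h : KInjective k R e)
    {o : {o // o ∈ R.boxes0}} {l : List α} (hl : l ∈ (R.box o).boxes) {e₁ e₂ : PseudoExp (R.box o)}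
    (h₁ : e₁ ∈ e.copies o) (h₂ : e₂ ∈ e.copies o) {m : ℕ}
    (hm₁ : m ∈ numCopies (R.box o) e₁ l) (hm₂ : m ∈ numCopies (R.box o) e₂ l) : e₁ = e₂ := by
  cases R; rw [KInjective] at h; exact h.2.1 o l hl e₁ h₁ e₂ h₂ ⟨m, hm₁, hm₂⟩

theorem KInjective.box_eq {k : ℕ} {R : CircPS α} {e : PseudoExp R} (h : KInjective k R e)
    {l₁ l₂ : List α} (hl₁ : l₁ ∈ R.boxes) (hl₂ : l₂ ∈ R.boxes) {m : ℕ}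
    (hm₁ : m ∈ numCopies R e l₁) (hm₂ : m ∈ numCopies R e l₂) : l₁ = l₂ := by
  cases R; rw [KInjective] at h; exact h.2.2.1 l₁ hl₁ l₂ hl₂ ⟨m, hm₁, hm₂⟩

theorem KInjective.copies {k : ℕ} {R : CircPS α} {e : PseudoExp R} (h : KInjective k R e)
    {o : {o // o ∈ R.boxes0}} {e₁ : PseudoExp (R.box o)} (h₁ : e₁ ∈ e.copies o) :
    KInjective k (R.box o) e₁ := by
  cases R; rw [KInjective] at h; exact h.2.2.2 o e₁ h₁

end PseudoExp

namespace ExpState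

open PseudoExp

/-- The number of copies of the box `o`. -/
noncomputable def ncop (ρ : ExpState α) (o : α) : ℕ :=
  if h : o ∈ ρ.1.boxes0 then (ρ.2.copies ⟨o, h⟩).card else 0

/-- The names of the boxes along a path, followed by `o`, form the address by which `numCopies`
refers to the box. -/
theorem ncop_mem {i : ℕ} {ρ : ExpState α} {l : List (ExpStep α)} (hl : IsLevel i ρ l) {o : α}
    (ho : o ∈ (endSt ρ l).1.boxes0) : l.map Prod.fst ++ [o] ∈ ρ.1.boxes ∧
      ncop (endSt ρ l) o ∈ numCopies ρ.1 ρ.2 (l.map Prod.fst ++ [o]) := by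
  induction l generalizing ρ with
  | nil =>
    refine ⟨(CircPS.mem_boxes _ _).2 ⟨o, ho, Or.inl rfl⟩,
      mem_numCopies.2 ⟨⟨o, ho⟩, Or.inl ⟨rfl, ?_⟩⟩⟩
    rw [endSt_nil] at ho ⊢
    rw [ncop, dif_pos ho]
  | cons x l ih =>
    obtain ⟨h1, h2⟩ := hl
    have h3 := ih h2 ho
    obtain ⟨o', -, e₁, he₁, rfl⟩ := mem_children.1 h1
    refine ⟨(CircPS.mem_boxes _ _).2 ⟨o'.1, o'.2, Or.inr ⟨_, ?_, rfl⟩⟩,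
      mem_numCopies.2 ⟨o', Or.inr ⟨_, h3.1, rfl, e₁, he₁, h3.2⟩⟩⟩
    rw [ρ.1.content_coe o']
    exact h3.1

theorem exists_of_mem_numCopies {ρ : ExpState α} {b : List α} {m : ℕ}
    (h : m ∈ numCopies ρ.1 ρ.2 b) : ∃ l o, IsLevel 0 ρ l ∧ o ∈ (endSt ρ l).1.boxes0 ∧
      m = ncop (endSt ρ l) o := by
  induction b generalizing ρ with
  | nil =>
    obtain ⟨o, h | ⟨l', -, h, -⟩⟩ := mem_numCopies.1 h
    · simp at h
    · simp at h
  | cons a b ih =>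
    obtain ⟨o, ⟨-, h⟩ | ⟨l', -, h2, e₁, he₁, h4⟩⟩ := mem_numCopies.1 h
    · exact ⟨[], o.1, trivial, o.2, by rw [h, endSt_nil, ncop, dif_pos o.2]⟩
    · obtain ⟨rfl, rfl⟩ := List.cons.inj h2
      obtain ⟨l, o', h5, h6, h7⟩ := ih (ρ := ⟨ρ.1.box o, e₁⟩) h4
      exact ⟨(o.1, ⟨ρ.1.box o, e₁⟩) :: l, o',
        ⟨mem_children.2 ⟨o, Nat.zero_le _, e₁, he₁, rfl⟩, h5⟩, h6, h7⟩

/-- `k`-injectivity of the pseudo-experiment of a copy. -/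
def KInj (k : ℕ) (ρ : ExpState α) : Prop := KInjective k ρ.1 ρ.2

theorem KInj.child {k i : ℕ} {ρ : ExpState α} (h : KInj k ρ) {x : ExpStep α}
    (hx : x ∈ children i ρ) : KInj k x.2 := by
  obtain ⟨o, -, e₁, he₁, rfl⟩ := mem_children.1 hx
  exact KInjective.copies h he₁

theorem KInj.endSt {k i : ℕ} {ρ : ExpState α} (h : KInj k ρ) {l : List (ExpStep α)}
    (hl : IsLevel i ρ l) : KInj k (endSt ρ l) := by
  induction l generalizing ρ with
  | nil => exact h
  | cons x l ih => exact ih (h.child hl.1) hl.2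

theorem KInj.ncop_eq {k : ℕ} {ρ : ExpState α} (h : KInj k ρ) {i : ℕ} {l : List (ExpStep α)}
    (hl : IsLevel i ρ l) {o : α} (ho : o ∈ (ExpState.endSt ρ l).1.boxes0) :
    ∃ j > 0, ncop (ExpState.endSt ρ l) o = k ^ j :=
  KInjective.pow h (ncop_mem hl ho).1 (ncop_mem hl ho).2

/-- Different addresses have disjoint sets of numbers of copies, so equal numbers force equal
addresses. The copies chosen along the two paths then agree one after the other from the outside,
because two copies of a box share no number for any box inside. -/
theorem KInj.ncop_inj {k : ℕ} {ρ : ExpState α} (h : KInj k ρ) {i i' : ℕ}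
    {l l' : List (ExpStep α)} (hl : IsLevel i ρ l) (hl' : IsLevel i' ρ l') {o o' : α}
    (ho : o ∈ (ExpState.endSt ρ l).1.boxes0) (ho' : o' ∈ (ExpState.endSt ρ l').1.boxes0)
    (heq : ncop (ExpState.endSt ρ l) o = ncop (ExpState.endSt ρ l') o') : l = l' ∧ o = o' := by
  have h1 := ncop_mem hl ho
  have h2 := ncop_mem hl' ho'
  have h3 := KInjective.box_eq h h1.1 h2.1 h1.2 (heq ▸ h2.2)
  obtain ⟨h4, h5⟩ := List.append_inj' h3 rfl
  simp only [List.cons.injEq, and_true] at h5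
  subst h5
  refine ⟨?_, rfl⟩
  clear h1 h2 h3
  induction l generalizing ρ l' with
  | nil => exact (List.map_eq_nil_iff.1 h4.symm).symm
  | cons x l ih =>
    cases l' with
    | nil => simp at h4
    | cons x' l' =>
      simp only [List.map_cons, List.cons.injEq] at h4
      have h1 := ncop_mem hl.2 ho
      have h2 := ncop_mem hl'.2 ho'
      have hk := h.child hl.1
      obtain ⟨b, -, e₁, he₁, rfl⟩ := mem_children.1 hl.1
      obtain ⟨b', -, e₂, he₂, rfl⟩ := mem_children.1 hl'.1
      obtain rfl := Subtype.ext h4.1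
      simp only [endSt_cons] at heq ho ho'
      rw [heq, h4.2] at h1
      rw [← h4.2] at h1 h2
      have h3 := KInjective.copies_eq h h1.1 he₁ he₂ h1.2 h2.2
      subst h3
      rw [ih hk hl.2 hl'.2 ho h4.2 ho' heq]

theorem card_children {i : ℕ} {ρ : ExpState α} {o : α} (ho : o ∈ ρ.1.boxes0)
    (hd : i ≤ (ρ.1.content o).depth) :
    ((children i ρ).filter fun x => x.1 = o).card = ncop ρ o := by
  rw [ncop, dif_pos ho]
  symm
  rw [ρ.1.content_of_mem ho] at hd
  refine Finset.card_bij (fun e₁ _ => (o, ⟨ρ.1.box ⟨o, ho⟩, e₁⟩)) ?_ ?_ ?_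
  · intro e₁ he₁
    exact Finset.mem_filter.2 ⟨mem_children.2 ⟨⟨o, ho⟩, hd, e₁, he₁, rfl⟩, rfl⟩
  · intro e₁ _ e₂ _ h
    simpa using h
  · intro x hx
    obtain ⟨h1, rfl⟩ := Finset.mem_filter.1 hx
    obtain ⟨o', -, e₁, he₁, rfl⟩ := mem_children.1 h1
    exact ⟨e₁, he₁, rfl⟩

/-- The number of copies is a power of `k`, hence nonzero: no box disappears in the expansion. -/
theorem KInj.exists_child {k : ℕ} (hk : 1 < k) {ρ : ExpState α} (h : KInj k ρ) {i : ℕ} {o : α}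
    (ho : o ∈ ρ.1.boxes0) (hd : i ≤ (ρ.1.content o).depth) :
    ∃ x ∈ children i ρ, x.1 = o := by
  obtain ⟨j, -, hj⟩ := h.ncop_eq (i := 0) (l := []) trivial ho
  have h1 : 0 < ((children i ρ).filter fun x => x.1 = o).card := by
    rw [card_children ho hd]
    rw [endSt_nil] at hj
    rw [hj]
    positivity
  obtain ⟨x, hx⟩ := Finset.card_pos.1 h1
  exact ⟨x, (Finset.mem_filter.1 hx).1, (Finset.mem_filter.1 hx).2⟩

/-- Every path can be copied starting from another pseudo-experiment. -/
theorem KInj.exists_shape {k : ℕ} (hk : 1 < k) {ρ ρ' : ExpState α} (h : KInj k ρ')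
    (hρ : ρ.1 = ρ'.1) {i : ℕ} {l : List (ExpStep α)} (hl : IsLevel i ρ l) :
    ∃ l', IsLevel i ρ' l' ∧ shape l' = shape l := by
  induction l generalizing ρ ρ' with
  | nil => exact ⟨[], trivial, rfl⟩
  | cons x l ih =>
    have h1 := child_mem hl.1
    have h2 := child_content hl.1
    have h3 := child_depth hl.1
    rw [h2] at h3
    rw [hρ] at h1 h2 h3
    obtain ⟨x', hx', hxx'⟩ := h.exists_child hk h1 h3
    have h4 : x.2.1 = x'.2.1 := by rw [h2, child_content hx', hxx']
    obtain ⟨l', hl', hs⟩ := ih (h.child hx') h4 hl.2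
    exact ⟨x' :: l', ⟨hx', hl'⟩, by simp [hs, hxx', h4]⟩

/-- The boxes of a copy that are replaced by copies of their contents. -/
noncomputable def expanded (i : ℕ) (ρ : ExpState α) : Finset α :=
  ρ.1.boxes0.filter fun o => i ≤ (ρ.1.content o).depth

theorem mem_expanded {i : ℕ} {ρ : ExpState α} {o : α} :
    o ∈ expanded i ρ ↔ o ∈ ρ.1.boxes0 ∧ i ≤ (ρ.1.content o).depth := Finset.mem_filter

theorem child_expanded {i : ℕ} {ρ : ExpState α} {x : ExpStep α} (h : x ∈ children i ρ) :
    x.1 ∈ expanded i ρ :=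
  mem_expanded.2 ⟨child_mem h, child_content h ▸ child_depth h⟩

/-- An extension of `t` other than `t` is uniquely a parent level extending `t` followed by a last
step; the last steps are then sorted by their box. -/
theorem sum_levels {i : ℕ} {ρ : ExpState α} {t : List (ExpStep α)} (ht : IsLevel i ρ t)
    (F : List (ExpStep α) → ℕ) (hF : ∀ l, IsLevel i ρ l → F l ≠ 0 → t <+: l) :
    ∑ l ∈ levels i ρ, F l = F t + ∑ y ∈ ((levels i ρ).filter fun l => t <+: l).sigma
      (fun l => expanded i (endSt ρ l)),
      ∑ x ∈ (children i (endSt ρ y.1)).filter (fun x => x.1 = y.2), F (y.1 ++ [x]) := by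
  rw [Finset.sum_sigma]
  have h1 : ∀ l ∈ (levels i ρ).filter fun l => t <+: l,
      ∑ o ∈ expanded i (endSt ρ l),
        ∑ x ∈ (children i (endSt ρ l)).filter (fun x => x.1 = o), F (l ++ [x]) =
      ∑ x ∈ children i (endSt ρ l), F (l ++ [x]) := fun l _ =>
    Finset.sum_fiberwise_of_maps_to (fun x hx => child_expanded hx) _
  rw [Finset.sum_congr rfl h1, Finset.sum_sigma',
    ← Finset.add_sum_erase _ _ (mem_levels.2 ht)]
  congr 1
  rw [← Finset.sum_subset (s₁ := ((levels i ρ).erase t).filter fun l => t <+: l)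
    (Finset.filter_subset _ _)]
  · symm
    refine Finset.sum_bij (fun y _ => y.1 ++ [y.2]) ?_ ?_ ?_ ?_
    · rintro ⟨l, x⟩ hy
      simp only [Finset.mem_sigma, Finset.mem_filter, mem_levels] at hy
      simp only [Finset.mem_filter, Finset.mem_erase, mem_levels, isLevel_snoc]
      refine ⟨⟨?_, hy.1.1, hy.2⟩, hy.1.2.trans (List.prefix_append _ _)⟩
      rintro rfl
      have := hy.1.2.length_le
      simp at this
    · rintro ⟨l, x⟩ - ⟨l', x'⟩ - h
      obtain ⟨h2, h3⟩ := List.append_inj' h rfl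
      cases h3
      cases h2
      rfl
    · intro l hl
      simp only [Finset.mem_filter, Finset.mem_erase, mem_levels] at hl
      obtain ⟨⟨h2, h3⟩, u, rfl⟩ := hl
      rcases List.eq_nil_or_concat' u with rfl | ⟨u, x, rfl⟩
      · simp at h2
      · rw [← List.append_assoc] at h3 ⊢
        refine ⟨⟨t ++ u, x⟩, ?_, rfl⟩
        simp only [Finset.mem_sigma, Finset.mem_filter, mem_levels]
        exact ⟨⟨(isLevel_snoc.1 h3).1, List.prefix_append _ _⟩, (isLevel_snoc.1 h3).2⟩
    · intro y _
      rfl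
  · intro l hl hl'
    by_contra hne
    simp only [Finset.mem_erase, mem_levels] at hl
    exact hl' (Finset.mem_filter.2 ⟨Finset.mem_erase.2 ⟨hl.1, mem_levels.2 hl.2⟩,
      hF l hl.2 hne⟩)

/-- The digits of a sum, indexed by the levels, of numbers that only depend on the shapes of the
levels. -/
theorem baseDigit_sum_levels {k : ℕ} (hk : 1 < k) {ρ : ExpState α} (hinj : KInj k ρ) {i : ℕ}
    {t : List (ExpStep α)} (ht : IsLevel i ρ t) (F : List (ExpStep α) → ℕ)
    (hF : ∀ l, IsLevel i ρ l → F l ≠ 0 → t <+: l)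
    (hshape : ∀ l l', IsLevel i ρ l → IsLevel i ρ l' → t <+: l → t <+: l' →
      shape l = shape l' → F l = F l')
    (hlt : ∀ l, IsLevel i ρ l → F l < k) :
    baseDigit k (∑ l ∈ levels i ρ, F l) 0 = F t ∧
    (∀ l x j, IsLevel i ρ (l ++ [x]) → t <+: l → ncop (endSt ρ l) x.1 = k ^ j →
      baseDigit k (∑ l ∈ levels i ρ, F l) j = F (l ++ [x])) ∧
    ∀ j, j ≠ 0 → baseDigit k (∑ l ∈ levels i ρ, F l) j ≠ 0 → ∃ l x, IsLevel i ρ (l ++ [x]) ∧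
      t <+: l ∧ ncop (endSt ρ l) x.1 = k ^ j := by
  set E := ((levels i ρ).filter fun l => t <+: l).sigma (fun l => expanded i (endSt ρ l)) with hE
  have hmemE : ∀ {y}, y ∈ E ↔ (IsLevel i ρ y.1 ∧ t <+: y.1) ∧ y.2 ∈ expanded i (endSt ρ y.1) := by
    intro y
    simp [hE, Finset.mem_sigma]
  have hpow : ∀ y ∈ E, ∃ j > 0, ncop (endSt ρ y.1) y.2 = k ^ j := fun y hy =>
    hinj.ncop_eq (hmemE.1 hy).1.1 (mem_expanded.1 (hmemE.1 hy).2).1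
  choose! J hJpos hJ using hpow
  have hchild : ∀ y ∈ E, ∃ g, ∃ x ∈ children i (endSt ρ y.1), x.1 = y.2 ∧
      F (y.1 ++ [x]) = g := fun y hy => by
    obtain ⟨x, hx1, hx2⟩ := (hinj.endSt (hmemE.1 hy).1.1).exists_child hk
      (mem_expanded.1 (hmemE.1 hy).2).1 (mem_expanded.1 (hmemE.1 hy).2).2
    exact ⟨_, x, hx1, hx2, rfl⟩
  choose! G hG using hchild
  have hJinj : ∀ y ∈ E, ∀ y' ∈ E, J y = J y' → y = y' := by
    rintro ⟨l, o⟩ hy ⟨l', o'⟩ hy' h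
    obtain ⟨rfl, rfl⟩ := hinj.ncop_inj (hmemE.1 hy).1.1 (hmemE.1 hy').1.1
      (mem_expanded.1 (hmemE.1 hy).2).1 (mem_expanded.1 (hmemE.1 hy').2).1
      (by rw [hJ _ hy, hJ _ hy', h])
    rfl
  have hFeq : ∀ y ∈ E, ∀ x ∈ children i (endSt ρ y.1), x.1 = y.2 → F (y.1 ++ [x]) = G y := by
    intro y hy x hx hxy
    obtain ⟨x', hx', hxy', hG'⟩ := hG y hy
    rw [← hG']
    refine hshape _ _ (isLevel_snoc.2 ⟨(hmemE.1 hy).1.1, hx⟩)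
      (isLevel_snoc.2 ⟨(hmemE.1 hy).1.1, hx'⟩) ((hmemE.1 hy).1.2.trans (List.prefix_append _ _))
      ((hmemE.1 hy).1.2.trans (List.prefix_append _ _)) ?_
    simp only [shape_append, shape_cons, shape_nil, child_content hx, child_content hx',
      hxy, hxy']
  -- Position `0` is free for `F t` because the exponents `J y` are positive. For `j > 0` the sum
  -- has at most one term, since `J` is injective on `E`.
  set d : ℕ → ℕ := fun j => if j = 0 then F t else
    ∑ y ∈ E.filter (fun y => J y = j), G y with hd
  have hdJ : ∀ y ∈ E, d (J y) = G y := by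
    intro y hy
    have h1 : E.filter (fun y' => J y' = J y) = {y} := by
      ext y'
      simp only [Finset.mem_filter, Finset.mem_singleton]
      exact ⟨fun h => hJinj _ h.1 _ hy h.2, by rintro rfl; exact ⟨hy, rfl⟩⟩
    rw [hd]
    simp only [(hJpos y hy).ne', if_false, h1, Finset.sum_singleton]
  have hd0 : ∀ j, j ≠ 0 → j ∉ E.image J → d j = 0 := by
    intro j hj hj'
    rw [hd]
    simp only [hj, if_false]
    rw [Finset.filter_false_of_mem, Finset.sum_empty]
    rintro y hy rfl
    exact hj' (Finset.mem_image_of_mem _ hy)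
  have hdlt : ∀ j, d j < k := by
    intro j
    by_cases hj : j = 0
    · rw [hd]
      simp only [hj, if_true]
      exact hlt t ht
    · by_cases hj' : j ∈ E.image J
      · obtain ⟨y, hy, rfl⟩ := Finset.mem_image.1 hj'
        obtain ⟨x, hx, hxy, hG'⟩ := hG y hy
        rw [hdJ y hy, ← hG']
        exact hlt _ (isLevel_snoc.2 ⟨(hmemE.1 hy).1.1, hx⟩)
      · rw [hd0 j hj hj']
        omega
  have hsum : ∑ l ∈ levels i ρ, F l = ∑ j ∈ insert 0 (E.image J), d j * k ^ j := by
    rw [Finset.sum_insert, sum_levels ht F hF]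
    · congr 1
      · simp [hd]
      · rw [Finset.sum_image (fun y hy y' hy' h => hJinj y hy _ hy' h)]
        refine Finset.sum_congr rfl fun y hy => ?_
        rw [Finset.sum_congr rfl (fun x hx => hFeq y hy x (Finset.mem_filter.1 hx).1
          (Finset.mem_filter.1 hx).2), Finset.sum_const,
          card_children (mem_expanded.1 (hmemE.1 hy).2).1 (mem_expanded.1 (hmemE.1 hy).2).2,
          hJ y hy, hdJ y hy, smul_eq_mul, mul_comm]
    · intro h
      obtain ⟨y, hy, h0⟩ := Finset.mem_image.1 h
      exact (hJpos y hy).ne' h0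
  have hdigit := baseDigit_sum d hdlt (insert 0 (E.image J))
  rw [← hsum] at hdigit
  refine ⟨?_, ?_, ?_⟩
  · rw [hdigit]
    simp [hd]
  · intro l x j hl htl hj
    obtain ⟨hl, hx⟩ := isLevel_snoc.1 hl
    have hy : (⟨l, x.1⟩ : Σ _ : List (ExpStep α), α) ∈ E :=
      hmemE.2 ⟨⟨hl, htl⟩, child_expanded hx⟩
    have hjJ : j = J ⟨l, x.1⟩ := by
      have := hJ _ hy
      simp only at this
      rw [hj] at this
      exact Nat.pow_right_injective hk this
    rw [hdigit, hjJ, if_pos (Finset.mem_insert_of_mem (Finset.mem_image_of_mem _ hy)), hdJ _ hy]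
    exact (hFeq _ hy x hx rfl).symm
  · intro j hj h
    rw [hdigit] at h
    have hj' : j ∈ insert 0 (E.image J) := by
      by_contra hc
      simp [hc] at h
    obtain ⟨y, hy, rfl⟩ := Finset.mem_image.1 ((Finset.mem_insert.1 hj').resolve_left hj)
    obtain ⟨x, hx, hxy, -⟩ := hG y hy
    refine ⟨y.1, x, isLevel_snoc.2 ⟨(hmemE.1 hy).1.1, hx⟩, (hmemE.1 hy).1.2, ?_⟩
    rw [hxy, hJ y hy]

end ExpState

end

/-! ### The sets `M_i(e)` and the critical ports. -/

section

open PortName ExpState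

variable {α : Type u}

namespace PseudoExp

/-- Induction on `i` with the counting principle: the digit of `#M_i(e)` at the exponent of a box is
the number of boxes with contents of depth at least `i` inside its content. It is nonzero exactly
when this content has depth at least `i + 1`. -/
theorem setM_eq {k : ℕ} (hk : 1 < k) {R : CircPS α} (hR : R.boxes.card < k) {e : PseudoExp R}
    (he : KInj k ⟨R, e⟩) (i : ℕ) : setM k e i =
      {j | ∃ l x, IsLevel i ⟨R, e⟩ (l ++ [x]) ∧ ncop (endSt ⟨R, e⟩ l) x.1 = k ^ j} := by
  induction i with
  | zero =>
    ext j
    constructor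
    · rintro ⟨b, -, hb⟩
      obtain ⟨l, o, h1, h2, h3⟩ := exists_of_mem_numCopies (ρ := ⟨R, e⟩) hb
      obtain ⟨x, hx, rfl⟩ := (he.endSt h1).exists_child hk h2 (Nat.zero_le _)
      exact ⟨l, x, isLevel_snoc.2 ⟨h1, hx⟩, h3.symm⟩
    · rintro ⟨l, x, hl, hj⟩
      obtain ⟨h1, h2⟩ := isLevel_snoc.1 hl
      have h3 := ncop_mem h1 (child_mem h2)
      exact ⟨_, h3.1, hj ▸ h3.2⟩
  | succ i ih =>
    set ρ : ExpState α := ⟨R, e⟩ with hρ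
    -- By `ncop_inj`, each pair of a level and an expanded box has its own exponent, so counting
    -- exponents is counting such pairs.
    set F : List (ExpStep α) → ℕ := fun l => (expanded i (endSt ρ l)).card with hF
    have hcard : (setM k e i).ncard = ∑ l ∈ levels i ρ, F l := by
      rw [ih]
      have h1 : {j | ∃ l x, IsLevel i ρ (l ++ [x]) ∧ ncop (endSt ρ l) x.1 = k ^ j} =
          (((levels i ρ).sigma fun l => expanded i (endSt ρ l)).image
            fun y => Nat.log k (ncop (endSt ρ y.1) y.2) : Finset ℕ) := by
        ext j
        simp only [Finset.coe_image, Set.mem_image, Finset.mem_coe, Finset.mem_sigma, mem_levels,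
          Set.mem_ofPred_eq]
        constructor
        · rintro ⟨l, x, hl, hj⟩
          obtain ⟨h1, h2⟩ := isLevel_snoc.1 hl
          exact ⟨⟨l, x.1⟩, ⟨h1, child_expanded h2⟩, by rw [hj, Nat.log_pow hk]⟩
        · rintro ⟨⟨l, o⟩, ⟨h1, h2⟩, rfl⟩
          obtain ⟨h2, h3⟩ := mem_expanded.1 h2
          obtain ⟨x, hx, rfl⟩ := (he.endSt h1).exists_child hk h2 h3
          obtain ⟨j, -, hj⟩ := he.ncop_eq h1 h2
          exact ⟨l, x, isLevel_snoc.2 ⟨h1, hx⟩, by rw [hj, Nat.log_pow hk]⟩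
      rw [h1, Set.ncard_coe_finset, Finset.card_image_of_injOn, Finset.card_sigma]
      rintro ⟨l, o⟩ hy ⟨l', o'⟩ hy' h
      simp only [Finset.mem_coe, Finset.mem_sigma, mem_levels, mem_expanded] at hy hy'
      obtain ⟨j, -, hj⟩ := he.ncop_eq hy.1 hy.2.1
      obtain ⟨j', -, hj'⟩ := he.ncop_eq hy'.1 hy'.2.1
      simp only [hj, hj', Nat.log_pow hk] at h
      obtain ⟨rfl, rfl⟩ := he.ncop_inj hy.1 hy'.1 hy.2.1 hy'.2.1 (by rw [hj, hj', h])
      rfl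
    obtain ⟨-, hb, hc⟩ := baseDigit_sum_levels hk he (isLevel_nil i ρ) F
      (fun _ _ _ => List.nil_prefix)
      (fun l l' _ _ _ _ hs => by simp only [hF, expanded, endSt_congr rfl hs])
      -- Boxes of one copy have distinct addresses in `R`, so there are fewer than `k` of them.
      (fun l hl => by
        refine lt_of_le_of_lt ?_ hR
        refine Finset.card_le_card_of_injOn (fun o => l.map Prod.fst ++ [o]) ?_ ?_
        · intro o ho
          exact (ncop_mem hl (mem_expanded.1 ho).1).1
        · intro o _ o' _ h
          simpa using h)
    rw [← hcard] at hb hc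
    ext j
    constructor
    · rintro ⟨h1, h2⟩
      obtain ⟨l, x, hl, -, hj⟩ := hc j h1.ne' h2
      rw [hb l x j hl List.nil_prefix hj] at h2
      obtain ⟨o, ho⟩ := Finset.card_ne_zero.1 h2
      rw [endSt_snoc, mem_expanded] at ho
      refine ⟨l, x, hl.of_depth ?_, hj⟩
      rw [endSt_snoc]
      exact (Nat.succ_le_succ ho.2).trans (CircPS.depth_content_lt _ ho.1)
    · rintro ⟨l, x, hl, hj⟩
      have hl' := hl.mono (Nat.le_succ i)
      have h0 := isLevel_snoc.1 hl'
      obtain ⟨j', h1, h2⟩ := he.ncop_eq h0.1 (child_mem h0.2)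
      rw [hj] at h2
      have h3 := Nat.pow_right_injective hk h2
      refine ⟨h3 ▸ h1, ?_⟩
      rw [hb l x j hl' List.nil_prefix hj]
      have h4 := hl.depth_end (by simp)
      rw [endSt_snoc] at h4
      obtain ⟨o, ho, hd⟩ := CircPS.exists_content_depth _ h4
      refine Finset.card_ne_zero.2 ⟨o, ?_⟩
      rw [endSt_snoc, mem_expanded]
      exact ⟨ho, hd⟩

end PseudoExp

namespace Ground

theorem mem_exponential {N : Type u} {G : Ground N} {p : N} : p ∈ G.exponential ↔
    p ∈ G.ports ∧ (G.label p = some .bang ∨ G.label p = some .whynot ∨ G.label p = some .circ) := by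
  simp only [exponential, portsOf, Finset.mem_union, Finset.mem_filter]
  tauto

end Ground

theorem mem_taylor_exponential {i : ℕ} {R : CircPS α} {e : PseudoExp R} {n : PortName R}
    (hp : IsPort i ⟨R, e⟩ n.lvl n.core)
    (h : n.core ∈ (endSt ⟨R, e⟩ n.lvl).1.ground.portsOf .bang ∨
      IsAux (endSt ⟨R, e⟩ n.lvl).1 n.core) : n ∈ (taylor i R e).ground.exponential := by
  have hp := mem_taylor_ports.2 hp
  rw [Ground.mem_exponential, taylor_label hp]
  refine ⟨hp, ?_⟩
  rcases h with h | h | h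
  · exact Or.inl (Finset.mem_filter.1 h).2
  · exact Or.inr (Or.inl (Finset.mem_filter.1 h).2)
  · exact Or.inr (Or.inr (Finset.mem_filter.1 h).2)

theorem exponential_of_contrib {i i' : ℕ} {R : CircPS α} (hR : R.IsCircPS) {e : PseudoExp R}
    {n : PortName R} {l : List (ExpStep α)} (hl : IsLevel i ⟨R, e⟩ l)
    (h : contrib i' ⟨R, e⟩ l n.pos ≠ 0) (hn : n.lvl ≠ l) :
    IsPort i ⟨R, e⟩ n.lvl n.core ∧
    (n.core ∈ (endSt ⟨R, e⟩ n.lvl).1.ground.portsOf .bang ∨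
      IsAux (endSt ⟨R, e⟩ n.lvl).1 n.core) := by
  rcases exists_of_contrib_ne_zero h with ⟨p, -, -, hp⟩ | ⟨o, -, -, r, hr⟩
  · exact tgtL_cross (ρ := ⟨R, e⟩) hR hl hp hn
  · exact doorL_port (ρ := ⟨R, e⟩) hR hl hr

/-- The critical ports are the doors of the boxes of depth `i + 1`. -/
theorem mem_criticalPorts {k : ℕ} (hk : 1 < k) {R : CircPS α} (hR : R.IsCircPS)
    (hb : R.boxes.card < k) (hc : R.cosize < k) {e : PseudoExp R}
    (he : PseudoExp.KInjective k R e) {i : ℕ} {n : PortName R} :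
    n ∈ (taylor i R e).criticalPorts k (PseudoExp.setN k e i) ↔
      ∃ l x, IsLevel i ⟨R, e⟩ (l ++ [x]) ∧ x.2.1.depth = i ∧ n.lvl <+: l ∧
        contrib i ⟨R, e⟩ (l ++ [x]) n.pos ≠ 0 := by
  set ρ : ExpState α := ⟨R, e⟩ with hρ
  have he' : KInj k ρ := he
  -- The root `t` of the counting principle is the level of `n`: contributions come only from levels
  -- that extend it.
  have hdigit : n ∈ (taylor i R e).ground.ports → _ := fun hn =>
    baseDigit_sum_levels hk he' (mem_taylor_ports.1 hn).1
      (fun l => contrib i ρ l n.pos) (fun l _ h => prefix_of_contrib_ne_zero h)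
      (fun l l' _ _ h1 h2 hs => contrib_congr rfl hs h1 h2 rfl _)
      (fun l hl => by
        have hp := mem_taylor_ports.1 hn
        exact (contrib_le hR hl _ _).trans_lt
          (((CircPS.arity_le_cosize _ hp.2.1).trans hp.1.cosize_le).trans_lt hc))
  rw [DiffPS.criticalPorts, Set.mem_ofPred_eq]
  simp only [taylor_arity hR, PseudoExp.setN, PseudoExp.setM_eq hk hb he']
  constructor
  · rintro ⟨hn, j, ⟨⟨l₁, x₁, h1, h2⟩, hnot⟩, hj⟩
    obtain ⟨-, hb, hc⟩ := hdigit (Ground.mem_exponential.1 hn).1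
    have hj0 : j ≠ 0 := by
      obtain ⟨j', h3, h4⟩ := he'.ncop_eq (isLevel_snoc.1 h1).1 (child_mem (isLevel_snoc.1 h1).2)
      rw [h2] at h4
      rw [Nat.pow_right_injective hk h4]
      exact h3.ne'
    obtain ⟨l, x, hl, hp, hx⟩ := hc j hj0 hj
    rw [hb l x j hl hp hx] at hj
    refine ⟨l, x, hl, ?_, hp, hj⟩
    have h3 := child_depth (isLevel_snoc.1 hl).2
    refine le_antisymm ?_ h3
    -- A content of depth greater than `i` would put `j` into `M_{i+1}(e)`.
    by_contra hlt
    exact hnot ⟨l, x, hl.of_depth (by rw [endSt_snoc]; omega), hx⟩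
  · rintro ⟨l, x, hl, hx, hp, h⟩
    have hne : n.lvl ≠ l ++ [x] := by
      intro h'
      have := hp.length_le
      rw [h'] at this
      simp at this
    have hn := mem_taylor_exponential (exponential_of_contrib hR hl h hne).1
      (exponential_of_contrib hR hl h hne).2
    obtain ⟨-, hb, hc⟩ := hdigit (Ground.mem_exponential.1 hn).1
    obtain ⟨j, -, hj⟩ := he'.ncop_eq (isLevel_snoc.1 hl).1 (child_mem (isLevel_snoc.1 hl).2)
    refine ⟨hn, j, ⟨⟨l, x, hl, hj⟩, ?_⟩, ?_⟩
    · rintro ⟨l', x', hl', hj'⟩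
      obtain ⟨hl1, hx1⟩ := isLevel_snoc.1 hl
      obtain ⟨hl2, hx2⟩ := isLevel_snoc.1 hl'
      obtain ⟨rfl, h1⟩ := he'.ncop_inj hl1 hl2 (child_mem hx1) (child_mem hx2) (by rw [hj, hj'])
      have h2 := child_depth hx2
      rw [child_content hx2, ← h1, ← child_content hx1, hx] at h2
      omega
    · rw [hb l x j hl hp hj]
      exact h

/-- A position of a critical port. -/
def IsCritical (i : ℕ) (ρ : ExpState α) (n : List (ExpStep α) × α) : Prop :=
  ∃ l x, IsLevel i ρ (l ++ [x]) ∧ x.2.1.depth = i ∧ n.1 <+: l ∧ contrib i ρ (l ++ [x]) n ≠ 0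

namespace IsCritical

variable {i : ℕ} {ρ : ExpState α}

/-- A proper prefix of `l` is a prefix of `l` without its last step, and this last step is the
witness `x`. -/
theorem of_contrib {l : List (ExpStep α)} {n : List (ExpStep α) × α} (hl : IsLevel i ρ l)
    (hd : (endSt ρ l).1.depth = i) (hn : n.1 ≠ l) (h : contrib i ρ l n ≠ 0) :
    IsCritical i ρ n := by
  have hp := prefix_of_contrib_ne_zero (a := n.1) (q := n.2) h
  have hl0 : l ≠ [] := by
    rintro rfl
    exact hn (List.prefix_nil.1 hp)
  obtain ⟨l, x, rfl⟩ := (List.eq_nil_or_concat' l).resolve_left hl0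
  refine ⟨l, x, hl, by simpa using hd, ?_, h⟩
  rcases List.prefix_concat_iff.1 (by simpa using hp) with h1 | h1
  · exact absurd h1 (by simpa using hn)
  · exact h1

/-- The part of the witnessing path above `a` is copied above `a'`, which is possible because every
box has a copy. -/
theorem shape {k : ℕ} (hk : 1 < k) (he : KInj k ρ) {a a' : List (ExpStep α)} {q : α}
    (h : IsCritical i ρ (a, q)) (ha' : IsLevel i ρ a')
    (hs : ExpState.shape a = ExpState.shape a') : IsCritical i ρ (a', q) := by
  obtain ⟨l, x, hl, hx, ⟨u, rfl⟩, hc⟩ := h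
  rw [List.append_assoc, isLevel_append] at hl
  obtain ⟨u', hu', hsu⟩ := (he.endSt ha').exists_shape hk (endSt_congr rfl hs) hl.2
  have hu0 : u' ≠ [] := by
    rintro rfl
    simp at hsu
  obtain ⟨u', x', rfl⟩ := (List.eq_nil_or_concat' u').resolve_left hu0
  have hx' : x'.2.1 = x.2.1 := by
    rw [shape_append, shape_append] at hsu
    have := (List.append_inj' hsu rfl).2
    simp only [shape_cons, shape_nil, List.cons.injEq, Prod.mk.injEq, and_true] at this
    exact this.2
  refine ⟨a' ++ u', x', ?_, hx' ▸ hx, List.prefix_append _ _, ?_⟩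
  · rw [List.append_assoc, isLevel_append]
    exact ⟨ha', hu'⟩
  · rw [contrib_congr (ρ := ρ) (ρ' := ρ) (l' := a ++ u ++ [x]) (a' := a) rfl]
    · exact hc
    · simp only [List.append_assoc, shape_append a, shape_append a', hs, hsu]
    · rw [List.append_assoc]; exact List.prefix_append _ _
    · rw [List.append_assoc]; exact List.prefix_append _ _
    · exact (length_eq_of_shape hs).symm

/-- The copy around a content of depth `i` has depth at least `i + 1`, and depths grow outwards.
Hence critical ports survive in the next expansion. -/
theorem isLevel_succ {a : List (ExpStep α)} {q : α} (h : IsCritical i ρ (a, q)) :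
    IsLevel (i + 1) ρ a := by
  obtain ⟨l, x, hl, hx, hp, hc⟩ := h
  obtain ⟨h1, h2⟩ := isLevel_snoc.1 hl
  refine (h1.of_depth ?_).of_prefix hp
  have := CircPS.depth_content_lt _ (child_mem h2)
  rw [← child_content h2, hx] at this
  exact this

theorem aux (hρ : ρ.1.IsCircPS) {a : List (ExpStep α)} {q : α} (h : IsCritical i ρ (a, q)) :
    IsPort (i + 1) ρ a q ∧
      (q ∈ (endSt ρ a).1.ground.portsOf .bang ∨ IsAux (endSt ρ a).1 q) := by
  have h0 := h.isLevel_succ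
  obtain ⟨l, x, hl, hx, hp, hc⟩ := h
  have hne : a ≠ l ++ [x] := by
    intro h'
    have := hp.length_le
    simp only [h'] at this
    simp at this
  rcases exists_of_contrib_ne_zero hc with ⟨p, -, -, hp⟩ | ⟨o, -, -, r, hr⟩
  · have := tgtL_cross hρ hl hp hne
    exact ⟨⟨h0, this.1.2⟩, this.2⟩
  · have := doorL_port hρ hl hr
    exact ⟨⟨h0, this.1.2⟩, this.2⟩

/-- The doors of the boxes with a content of depth `i` are critical. -/
theorem of_doorL {k : ℕ} (hk : 1 < k) (he : KInj k ρ) (hρ : ρ.1.IsCircPS)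
    {l : List (ExpStep α)} (hl : IsLevel i ρ l) {o r : α} {n : List (ExpStep α) × α}
    (hd : ((endSt ρ l).1.content o).depth = i) (h : doorL ρ l o r = some n) :
    IsCritical i ρ n := by
  obtain ⟨a, q⟩ := n
  obtain ⟨h1, rfl⟩ := doorL_eq_some.1 h
  have hc := hl.isCircPS hρ
  have ho := CircPS.mem_boxes0_of_doorFn h1
  obtain ⟨x, hx, rfl⟩ := (he.endSt hl).exists_child hk ho hd.ge
  have hlx : IsLevel i ρ (l ++ [x]) := isLevel_snoc.2 ⟨hl, hx⟩
  have hxc := child_content hx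
  refine ⟨l, x, hlx, by rw [hxc, hd], resL_prefix _ _, ?_⟩
  have hr := ((hc.isDoor ho).dom r).1 (by simp [h1])
  rw [← hxc] at hr
  -- A plain conclusion becomes a wire of the copy. A `∘`-conclusion does not, but it is a door of
  -- some box inside the content; the content of that box has depth less than `i`, so the box is
  -- kept and contributes.
  rcases CircPS.mem_plain_or_circ hr with hr | hr
  · have h3 := Finset.mem_filter.1 (CircPS.mem_conclusions_of_plain hr)
    refine contrib_ne_zero_of_tgtL (p := r) ⟨hlx, ?_, Or.inr ?_⟩ ?_
    · rw [endSt_snoc]; exact h3.1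
    · rw [endSt_snoc]; exact CircPS.not_circ_of_plain hr
    · rw [tgtL_snoc_of_none h3.2, h1]; rfl
  · have h3 := door_circ_parent hρ hlx hr
    rw [h1] at h3
    cases h3
    have h4 := hlx.isCircPS hρ
    rw [endSt_snoc] at h4
    obtain ⟨o', p, hp⟩ := h4.exists_door_circ hr
    refine contrib_ne_zero_of_doorL (o := o') (r := p) hρ hlx ?_ ?_
    · rw [endSt_snoc]
      have := CircPS.depth_content_lt _ (CircPS.mem_boxes0_of_doorFn hp)
      rw [hxc, hd] at this
      rwa [hxc]
    · refine doorL_eq_some.2 ⟨by rw [endSt_snoc]; exact hp, ?_⟩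
      rw [resL_snoc, if_pos hr]

/-- The boxes that are kept are not critical ports. -/
theorem not_kept (hρ : ρ.1.IsCircPS) {a : List (ExpStep α)} {q : α} (ha : IsLevel i ρ a)
    (hq : q ∈ (endSt ρ a).1.boxes0) (hd : ((endSt ρ a).1.content q).depth < i) :
    ¬ IsCritical i ρ (a, q) := by
  rintro ⟨l, x, hl, hx, hp, hc⟩
  have hb := hq
  rw [(ha.isCircPS hρ).boxes0_eq] at hb
  -- A `!`-port is reached only from a copy of the content of its own box, which would then have
  -- depth exactly `i`, or from that box kept at the same level, which is not strictly inside.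
  rcases exists_of_contrib_ne_zero hc with ⟨p, -, -, h⟩ | ⟨o, ho, hdo, r, hr⟩
  · obtain ⟨y, h1, rfl⟩ := tgtL_bang hρ hl h hb
    obtain ⟨rfl, h2⟩ := List.append_inj' h1 rfl
    cases h2
    rw [← child_content (isLevel_snoc.1 hl).2, hx] at hd
    exact lt_irrefl _ hd
  · obtain ⟨rfl, -⟩ := doorL_bang hρ hl hr hb
    have := hp.length_le
    simp at this

end IsCritical

end

/-! ### Ground-structures: existence of conclusions and renaming of ports. -/

section

namespace Ground

variable {N : Type u} {G : Ground N}

theorem mem_portsOf {l : PortLabel} {p : N} :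
    p ∈ G.portsOf l ↔ p ∈ G.ports ∧ G.label p = some l := Finset.mem_filter

theorem mem_premises {w p : N} : w ∈ G.premises p ↔ w ∈ G.ports ∧ G.target w = some p := by
  simp only [premises, wires, Finset.mem_filter]
  constructor
  · rintro ⟨⟨h1, -⟩, h2⟩
    exact ⟨h1, h2⟩
  · rintro ⟨h1, h2⟩
    exact ⟨⟨h1, by simp [h2]⟩, h2⟩

theorem mem_conclusions {p : N} : p ∈ G.conclusions ↔ p ∈ G.ports ∧ G.target p = none :=
  Finset.mem_filter

theorem mem_multiplicative {p : N} : p ∈ G.multiplicative ↔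
    p ∈ G.ports ∧ (G.label p = some .tensor ∨ G.label p = some .par) := by
  simp only [multiplicative, Finset.mem_union, mem_portsOf]
  tauto

namespace IsDifferential

theorem exists_left_right (h : G.IsDifferential) {p : N} (hp : p ∈ G.multiplicative) :
    (∃ w ∈ G.premises p, w ∈ G.left) ∧ ∃ w ∈ G.premises p, w ∉ G.left := by
  have h1 := h.mult_left p hp
  have h2 := h.mult_arity p hp
  rw [arity, ← Finset.card_filter_add_card_filter_not (p := (· ∈ G.left)), h1] at h2
  obtain ⟨w, hw⟩ := Finset.card_pos.1 (h1 ▸ Nat.one_pos)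
  obtain ⟨w', hw'⟩ := Finset.card_pos.1 (show 0 < _ from (show
    ((G.premises p).filter fun a => ¬ a ∈ G.left).card = 1 by omega) ▸ Nat.one_pos)
  exact ⟨⟨w, (Finset.mem_filter.1 hw).1, (Finset.mem_filter.1 hw).2⟩,
    w', (Finset.mem_filter.1 hw').1, (Finset.mem_filter.1 hw').2⟩

/-- The types of the targets are larger. -/
theorem target_typ (h : G.IsDifferential) {w p : N} (hw : G.target w = some p) :
    ∃ C D, G.typ w = some C ∧ G.typ p = some D ∧ sizeOf C < sizeOf D := by
  obtain ⟨h1, -, h2, h3, h4⟩ := h.wire w p hw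
  have hwp : w ∈ G.premises p := mem_premises.2 ⟨h1, hw⟩
  obtain ⟨l, hl⟩ := Option.ne_none_iff_exists'.1 ((h.label_dom p).2 h2)
  have hport : p ∈ G.portsOf l := mem_portsOf.2 ⟨h2, hl⟩
  have hwn : ∀ {l'}, l = l' → p ∈ G.portsOf .whynot ∪ G.portsOf .circ →
      ∃ C D, G.typ w = some C ∧ G.typ p = some D ∧ sizeOf C < sizeOf D := by
    intro _ _ hp
    obtain ⟨C, hC, hC'⟩ := h.typ_whynot p hp
    exact ⟨C, _, hC' w hwp, hC, by simp⟩
  cases l with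
  | one => exact absurd hl h3
  | bot => exact absurd hl h4
  | bang =>
    obtain ⟨C, hC, hC'⟩ := h.typ_bang p hport
    exact ⟨C, _, hC' w hwp, hC, by simp⟩
  | whynot => exact hwn rfl (Finset.mem_union_left _ hport)
  | circ => exact hwn rfl (Finset.mem_union_right _ hport)
  | tensor =>
    obtain ⟨⟨w₁, h5, h6⟩, w₂, h7, h8⟩ :=
      h.exists_left_right (p := p) (Finset.mem_union_left _ hport)
    by_cases hwl : w ∈ G.left
    · obtain ⟨C₁, C₂, h9, h10, h11⟩ := h.typ_tensor p hport w hwp w₂ h7 hwl h8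
      exact ⟨C₁, _, h9, h11, by simp; omega⟩
    · obtain ⟨C₁, C₂, h9, h10, h11⟩ := h.typ_tensor p hport w₁ h5 w hwp h6 hwl
      exact ⟨C₂, _, h10, h11, by simp only [MTy.tensor.sizeOf_spec]; omega⟩
  | par =>
    obtain ⟨⟨w₁, h5, h6⟩, w₂, h7, h8⟩ :=
      h.exists_left_right (p := p) (Finset.mem_union_right _ hport)
    by_cases hwl : w ∈ G.left
    · obtain ⟨C₁, C₂, h9, h10, h11⟩ := h.typ_par p hport w hwp w₂ h7 hwl h8
      exact ⟨C₁, _, h9, h11, by simp; omega⟩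
    · obtain ⟨C₁, C₂, h9, h10, h11⟩ := h.typ_par p hport w₁ h5 w hwp h6 hwl
      exact ⟨C₂, _, h10, h11, by simp only [MTy.par.sizeOf_spec]; omega⟩

/-- A port whose type has maximal size cannot be a wire, since types grow strictly along targets. -/
theorem conclusions_nonempty (h : G.IsDifferential) (hne : G.ports.Nonempty) :
    G.conclusions.Nonempty := by
  obtain ⟨p, hp, hmax⟩ := Finset.exists_max_image G.ports
    (fun p => ((G.typ p).elim 0 sizeOf : ℕ)) hne
  refine ⟨p, mem_conclusions.2 ⟨hp, ?_⟩⟩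
  by_contra hc
  obtain ⟨q, hq⟩ := Option.ne_none_iff_exists'.1 hc
  obtain ⟨C, D, h1, h2, h3⟩ := h.target_typ hq
  have := hmax q (h.wire p q hq).2.2.1
  simp only [h1, h2, Option.elim_some] at this
  omega

end IsDifferential

/-- The ground-structure obtained by renaming the ports. -/
def rename (f : Equiv.Perm N) (G : Ground N) : Ground N where
  ports := G.ports.map f.toEmbedding
  label p := G.label (f.symm p)
  target p := (G.target (f.symm p)).map f
  left := {p | f.symm p ∈ G.left}
  typ p := G.typ (f.symm p)

section Rename

variable (f : Equiv.Perm N)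

theorem mem_rename_ports {p : N} : p ∈ (G.rename f).ports ↔ f.symm p ∈ G.ports := by
  simp only [rename, Finset.mem_map_equiv]

theorem rename_target {p q : N} :
    (G.rename f).target p = some q ↔ G.target (f.symm p) = some (f.symm q) := by
  simp only [rename, Option.map_eq_some_iff]
  constructor
  · rintro ⟨q', h1, rfl⟩
    simpa using h1
  · intro h
    exact ⟨_, h, by simp⟩

theorem mem_rename_portsOf {p : N} {l : PortLabel} :
    p ∈ (G.rename f).portsOf l ↔ f.symm p ∈ G.portsOf l := by
  rw [mem_portsOf, mem_portsOf, mem_rename_ports]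
  rfl

theorem mem_rename_multiplicative {p : N} :
    p ∈ (G.rename f).multiplicative ↔ f.symm p ∈ G.multiplicative := by
  simp only [multiplicative, Finset.mem_union, mem_rename_portsOf]

theorem mem_rename_premises {w p : N} :
    w ∈ (G.rename f).premises p ↔ f.symm w ∈ G.premises (f.symm p) := by
  rw [mem_premises, mem_premises, mem_rename_ports, rename_target]

theorem rename_premises (p : N) :
    (G.rename f).premises p = (G.premises (f.symm p)).map f.toEmbedding := by
  ext w
  rw [mem_rename_premises, Finset.mem_map_equiv]

theorem rename_arity (p : N) : (G.rename f).arity p = G.arity (f.symm p) := by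
  rw [arity, rename_premises, Finset.card_map]
  rfl

theorem mem_rename_conclusions {p : N} :
    p ∈ (G.rename f).conclusions ↔ f.symm p ∈ G.conclusions := by
  rw [mem_conclusions, mem_conclusions, mem_rename_ports]
  simp [rename]

theorem IsDifferential.rename (h : G.IsDifferential) : (G.rename f).IsDifferential where
  label_dom p := by rw [mem_rename_ports]; exact h.label_dom _
  typ_dom p := by rw [mem_rename_ports]; exact h.typ_dom _
  wire w p hw := by
    rw [mem_rename_ports, mem_rename_ports]
    exact h.wire _ _ ((rename_target f).1 hw)
  mult_arity p hp := by
    rw [rename_arity]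
    exact h.mult_arity _ ((mem_rename_multiplicative f).1 hp)
  left_wire w hw := by
    obtain ⟨p, h1, h2⟩ := h.left_wire _ hw
    exact ⟨f p, by rwa [mem_rename_multiplicative, f.symm_apply_apply],
      by rwa [rename_target, f.symm_apply_apply]⟩
  mult_left p hp := by
    rw [rename_premises, Finset.filter_map, Finset.card_map]
    convert h.mult_left _ ((mem_rename_multiplicative f).1 hp) using 2
    refine Finset.filter_congr fun w _ => ?_
    simp [Ground.rename]
  typ_one p hp := h.typ_one _ ((mem_rename_portsOf f).1 hp)
  typ_bot p hp := h.typ_bot _ ((mem_rename_portsOf f).1 hp)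
  typ_tensor p hp w₁ h₁ w₂ h₂ := h.typ_tensor _ ((mem_rename_portsOf f).1 hp) _
    ((mem_rename_premises f).1 h₁) _ ((mem_rename_premises f).1 h₂)
  typ_par p hp w₁ h₁ w₂ h₂ := h.typ_par _ ((mem_rename_portsOf f).1 hp) _
    ((mem_rename_premises f).1 h₁) _ ((mem_rename_premises f).1 h₂)
  typ_bang p hp := by
    obtain ⟨C, h1, h2⟩ := h.typ_bang _ ((mem_rename_portsOf f).1 hp)
    exact ⟨C, h1, fun w hw => h2 _ ((mem_rename_premises f).1 hw)⟩
  typ_whynot p hp := by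
    rw [Finset.mem_union, mem_rename_portsOf, mem_rename_portsOf, ← Finset.mem_union] at hp
    obtain ⟨C, h1, h2⟩ := h.typ_whynot _ hp
    exact ⟨C, h1, fun w hw => h2 _ ((mem_rename_premises f).1 hw)⟩

end Rename

end Ground

/-! ### Renaming, components and equivalence of differential `∘`-PS's. -/

namespace DiffPS

variable {N : Type u} {α : Type v}

/-- The differential `∘`-PS obtained by renaming the ports at depth `0`. -/
def rename (f : Equiv.Perm N) (T : DiffPS N α) : DiffPS N α where
  ground := T.ground.rename f
  boxes0 := T.boxes0.map f.toEmbedding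
  box p := T.box (f.symm p)
  door p r := (T.door (f.symm p) r).map f

section Rename

variable {T : DiffPS N α} (f : Equiv.Perm N)

theorem mem_rename_boxes0 {p : N} : p ∈ (T.rename f).boxes0 ↔ f.symm p ∈ T.boxes0 := by
  simp only [rename, Finset.mem_map_equiv]

theorem rename_door {p q : N} {r : α} :
    (T.rename f).door p r = some q ↔ T.door (f.symm p) r = some (f.symm q) := by
  simp only [rename, Option.map_eq_some_iff]
  constructor
  · rintro ⟨q', h1, rfl⟩
    simpa using h1
  · intro h
    exact ⟨_, h, by simp⟩

theorem IsDiffPS.rename (h : T.IsDiffPS) : (T.rename f).IsDiffPS where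
  isDifferential := h.isDifferential.rename f
  boxes0_bang o ho := by
    have := h.boxes0_bang _ ((mem_rename_boxes0 f).1 ho)
    refine ⟨(Ground.mem_rename_portsOf f).2 this.1, ?_⟩
    rw [← this.2]
    exact Ground.rename_arity f o
  box_dom o := by rw [mem_rename_boxes0]; exact h.box_dom _
  door_dom o ho p := by
    rw [mem_rename_boxes0] at ho
    simp [DiffPS.rename, h.door_dom _ ho p]
  isCircPS o A hA := h.isCircPS _ A hA
  isDoor o A hA := by
    have hd := h.isDoor _ A hA
    refine ⟨?_, ?_, ?_, ?_, ?_, ?_, ?_⟩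
    · intro p
      rw [← hd.dom p]
      simp [DiffPS.rename]
    · intro p q hq
      have := hd.cod _ _ ((rename_door f).1 hq)
      rw [f.symm.injective.eq_iff] at this
      exact this.imp_right (Or.imp (Ground.mem_rename_portsOf f).2 (Ground.mem_rename_portsOf f).2)
    · intro p hp p' hp' heq
      exact hd.inj p hp p' hp' (Option.map_injective f.injective heq)
    · obtain ⟨p, hp⟩ := hd.main
      exact ⟨p, (rename_door f).2 hp⟩
    · intro p hp q hq
      have := hd.circ_not_bang p hp _ ((rename_door f).1 hq)
      rwa [← Ground.mem_rename_portsOf f] at this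
    · intro p hp q hq
      exact hd.typ_circ p hp _ ((rename_door f).1 hq)
    · intro p hp q hq
      exact hd.typ_plain p hp _ ((rename_door f).1 hq)

theorem rename_arity (p : N) : (T.rename f).arity p = T.arity (f.symm p) := by
  rw [arity_eq_boxArity, arity_eq_boxArity]
  congr 1
  · exact Ground.rename_arity f p
  · simp only [rename, Finset.sum_map, Equiv.coe_toEmbedding, Equiv.symm_apply_apply]
    refine Finset.sum_congr rfl fun o _ => ?_
    cases T.box o with
    | none => rfl
    | some A =>
      refine CircPS.boxArity_congr A fun r => ?_
      have := rename_door (T := T) f (p := f o) (q := p) (r := r)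
      simpa only [rename, Equiv.symm_apply_apply] using this

theorem rename_cosize : (T.rename f).cosize = T.cosize := by
  rw [cosize, cosize]
  congr 1
  · change Finset.sup (T.ground.ports.map f.toEmbedding) _ = _
    rw [Finset.sup_map]
    refine Finset.sup_congr rfl fun p _ => ?_
    simp [rename_arity]
  · change Finset.sup (T.boxes0.map f.toEmbedding) _ = _
    rw [Finset.sup_map]
    refine Finset.sup_congr rfl fun p _ => ?_
    simp [rename]

/-- An isomorphism can be composed with a renaming. -/
theorem Equivalent.rename {T₀ : DiffPS N α} (h : T₀.Equivalent T)
    (hf : ∀ p ∈ T₀.conclusions, f p = p) : T₀.Equivalent (T.rename f) := by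
  obtain ⟨g, hg, hc⟩ := h
  refine ⟨f ∘ g, ⟨⟨?_, ?_, ?_, ?_, ?_⟩, ?_, ?_⟩, fun p hp => by simp [hc p hp, hf p hp]⟩
  · have h1 : Set.BijOn f T.ground.ports (T.rename f).ground.ports := by
      have := f.injective.injOn (s := T.ground.ports) |>.bijOn_image
      convert this using 1
      simp [DiffPS.rename, Ground.rename]
    exact h1.comp hg.ground.bij
  · intro p hp
    simpa [DiffPS.rename, Ground.rename] using hg.ground.label p hp
  · intro p hp
    have := hg.ground.target p hp
    simp only [DiffPS.rename, Ground.rename, Function.comp_apply, Equiv.symm_apply_apply, this,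
      Option.map_map]
  · intro p hp
    have := hg.ground.left p hp
    simp only [DiffPS.rename, Ground.rename, Function.comp_apply, Set.mem_ofPred_eq,
      Equiv.symm_apply_apply, this]
  · intro p hp
    simpa [DiffPS.rename, Ground.rename] using hg.ground.typ p hp
  · rw [Set.image_comp, hg.boxes0]
    simp [DiffPS.rename]
  · intro o ho A A' hA hA'
    simp only [DiffPS.rename, Function.comp_apply, Equiv.symm_apply_apply] at hA'
    obtain ⟨g', h1, h2⟩ := hg.box o ho A A' hA hA'
    refine ⟨g', h1, fun q hq => ?_⟩
    simp only [DiffPS.rename, Function.comp_apply, Equiv.symm_apply_apply, h2 q hq,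
      Option.map_map]

end Rename

theorem Coh.symm {S : DiffPS N α} {p q : N} (h : S.Coh p q) : S.Coh q p := by
  obtain ⟨h1, h2, h3⟩ := h
  refine ⟨h2, h1, ?_⟩
  rcases h3 with h3 | h3 | ⟨o, ho, h3, h4⟩
  · exact Or.inr (Or.inl h3)
  · exact Or.inl h3
  · exact Or.inr (Or.inr ⟨o, ho, h4, h3⟩)

namespace SubstructureAt

variable {Q : Set N} {T T' S : DiffPS N α}

theorem target_eq_some (h : SubstructureAt Q T S) {w p : N} : T.ground.target w = some p ↔
    w ∈ T.ground.ports ∧ w ∉ Q ∧ p ∈ T.ground.ports ∧ S.ground.target w = some p := by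
  constructor
  · intro hw
    have h1 := (h.isDiffPS.isDifferential.wire w p hw)
    have h2 : w ∈ T.ground.wires := Finset.mem_filter.2 ⟨h1.1, by simp [hw]⟩
    have h3 := h.target w h2
    exact ⟨h1.1, ((h.wires w).1 h2).2.2.1, h1.2.2.1, h3 ▸ hw⟩
  · rintro ⟨h1, h2, h3, h4⟩
    have h5 := (h.wires w).2 ⟨Finset.mem_filter.2 ⟨h.ports h1, by simp [h4]⟩, h1, h2, p, h3, h4⟩
    rw [h.target w h5, h4]

theorem box_eq_some (h : SubstructureAt Q T S) {o : N} {A : CircPS α} :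
    T.box o = some A ↔ o ∈ T.boxes0 ∧ S.box o = some A := by
  constructor
  · intro ho
    have h1 := (h.isDiffPS.box_dom o).1 (by simp [ho])
    exact ⟨h1, h.box o h1 ▸ ho⟩
  · rintro ⟨h1, h2⟩
    rw [h.box o h1, h2]

theorem door_eq_some (h : SubstructureAt Q T S) {o q : N} {r : α} :
    T.door o r = some q ↔ o ∈ T.boxes0 ∧ S.door o r = some q := by
  constructor
  · intro ho
    have h1 : o ∈ T.boxes0 := by
      by_contra hc
      rw [h.isDiffPS.door_dom o hc] at ho
      cases ho
    exact ⟨h1, h.door o h1 ▸ ho⟩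
  · rintro ⟨h1, h2⟩
    rw [h.door o h1, h2]

/-- A substructure is determined by its ports. -/
theorem eq_of_ports (h : SubstructureAt Q T S) (h' : SubstructureAt Q T' S)
    (hp : T.ground.ports = T'.ground.ports) : T = T' := by
  have hlabel : T.ground.label = T'.ground.label := by
    funext p
    by_cases hpT : p ∈ T.ground.ports
    · rw [h.label p hpT, h'.label p (hp ▸ hpT)]
    · rw [not_not.1 (mt (h.isDiffPS.isDifferential.label_dom p).1 hpT),
        not_not.1 (mt (h'.isDiffPS.isDifferential.label_dom p).1 (hp ▸ hpT))]
  have htyp : T.ground.typ = T'.ground.typ := by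
    funext p
    by_cases hpT : p ∈ T.ground.ports
    · rw [h.typ p hpT, h'.typ p (hp ▸ hpT)]
    · rw [not_not.1 (mt (h.isDiffPS.isDifferential.typ_dom p).1 hpT),
        not_not.1 (mt (h'.isDiffPS.isDifferential.typ_dom p).1 (hp ▸ hpT))]
  have htarget : T.ground.target = T'.ground.target := by
    funext w
    ext p
    rw [h.target_eq_some, h'.target_eq_some, hp]
  have hmult : T.ground.multiplicative = T'.ground.multiplicative := by
    ext p
    rw [Ground.mem_multiplicative, Ground.mem_multiplicative, hp, hlabel]
  have hleft : T.ground.left = T'.ground.left := by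
    ext w
    rw [h.left, h'.left, hmult]
  have hboxes : T.boxes0 = T'.boxes0 := by
    ext o
    rw [h.boxes0, h'.boxes0, hp]
  have hbox : T.box = T'.box := by
    funext o
    ext A
    rw [h.box_eq_some, h'.box_eq_some, hboxes]
  have hdoor : T.door = T'.door := by
    funext o r
    ext q
    rw [h.door_eq_some, h'.door_eq_some, hboxes]
  obtain ⟨⟨_, _, _, _, _⟩, _, _, _⟩ := T
  obtain ⟨⟨_, _, _, _, _⟩, _, _, _⟩ := T'
  simp_all

end SubstructureAt

/-- The steps between the ports of `T` that do not leave a port of `Q`. -/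
def Adj (S T : DiffPS N α) (Q : Set N) (a b : N) : Prop :=
  a ∈ T.ground.ports ∧ a ∉ Q ∧ b ∈ T.ground.ports ∧ S.Coh a b

/-- As paths may leave a port of `Q` only at their start, connectedness amounts to reachability from
each port outside `Q`, by steps that leave only such ports. -/
theorem connectedSubstructureAt_iff {S T : DiffPS N α} {Q : Set N}
    (hne : ∃ x ∈ T.ground.ports, x ∉ Q) : ConnectedSubstructureAt Q T S ↔
      SubstructureAt Q T S ∧ ∀ x ∈ T.ground.ports, x ∉ Q → ∀ p ∈ T.ground.ports,
        Relation.ReflTransGen (Adj S T Q) x p := by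
  refine and_congr_right fun _ => ⟨?_, ?_⟩
  · intro h x hx hxQ p hp
    obtain ⟨n, s, h0, hn, hs, hstep⟩ := h x hx p hp
    have hall : ∀ j ≤ n, Relation.ReflTransGen (Adj S T Q) x (s j) := by
      intro j
      induction j with
      | zero => exact fun _ => h0 ▸ .refl
      | succ j ih =>
        intro hj
        refine (ih (by omega)).tail ⟨hs j (by omega), ?_, hs _ hj, (hstep j (by omega)).1⟩
        intro hQ
        have := (hstep j (by omega)).2 hQ
        subst this
        exact hxQ (h0 ▸ hQ)
    exact hn ▸ hall n le_rfl
  · intro h p hp p' hp'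
    set Path : N → N → Prop := fun p p' => ∃ (n : ℕ) (s : ℕ → N),
      s 0 = p ∧ s n = p' ∧ (∀ j ≤ n, s j ∈ T.ground.ports) ∧
        ∀ j < n, S.Coh (s j) (s (j + 1)) ∧ (s j ∈ Q → j = 0) with hPath
    have hsnoc : ∀ {a b}, Path p a → Relation.ReflTransGen (Adj S T Q) a b → Path p b := by
      intro a b ha hab
      induction hab with
      | refl => exact ha
      | @tail b c _ hbc ih =>
        obtain ⟨n, s, h0, hn, hs, hstep⟩ := ih
        obtain ⟨h1, h2, h3, h4⟩ := hbc
        refine ⟨n + 1, fun j => if j ≤ n then s j else c, by simp [h0], by simp, ?_, ?_⟩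
        · intro j hj
          simp only
          split_ifs with h5
          exacts [hs j h5, h3]
        · intro j hj
          rcases Nat.lt_succ_iff_lt_or_eq.1 hj with h5 | rfl
          · simpa [h5.le, Nat.succ_le_of_lt h5] using hstep j h5
          · simp only [le_refl, if_true, hn]
            rw [if_neg (by omega)]
            exact ⟨h4, fun h => absurd h h2⟩
    have hrefl : Path p p := ⟨0, fun _ => p, rfl, rfl, fun _ _ => hp, by simp⟩
    -- For a start in `Q`, the last step of a path that reaches it from outside `Q` is reversed and
    -- used as first step.
    by_cases hpQ : p ∈ Q
    · obtain ⟨x, hx, hxQ⟩ := hne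
      rcases (h x hx hxQ p hp).cases_tail with rfl | ⟨a, -, ha⟩
      · exact absurd hpQ hxQ
      · refine hsnoc (a := a) ⟨1, fun j => if j = 0 then p else a, by simp, by simp, ?_, ?_⟩
          (h a ha.1 ha.2.1 p' hp')
        · intro j _
          simp only
          split_ifs
          exacts [hp, ha.1]
        · intro j hj
          obtain rfl : j = 0 := by omega
          simpa using ha.2.2.2.symm
    · exact hsnoc hrefl (h p hp hpQ p' hp')

section Components

variable {S T T' : DiffPS N α} {Q Q₀ : Set N} {k : ℕ}

theorem mem_components : T ∈ S.components Q Q₀ k ↔ SubstructureAt Q T S ∧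
    (∀ x ∈ T.ground.ports, x ∉ Q → ∀ p ∈ T.ground.ports,
      Relation.ReflTransGen (Adj S T Q) x p) ∧
    T.cosize < k ∧ ↑T.conclusions ⊆ Q ∪ Q₀ ∧ (∃ p ∈ T.ground.ports, p ∉ Q) ∧
    ∀ p ∈ T.ground.ports, p ∉ Q → ∀ q, S.Coh p q → q ∈ T.ground.ports := by
  rw [components, Set.mem_ofPred_eq]
  constructor
  · rintro ⟨h1, h2, h3, h4, h5⟩
    rw [connectedSubstructureAt_iff h4] at h1
    refine ⟨h1.1, h1.2, h2, h3, h4, fun p hp hpQ q hq => ?_⟩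
    by_contra hc
    exact hpQ (h5 p hp q hq.2.1 hq hc)
  · rintro ⟨h0, h1, h2, h3, h4, h5⟩
    refine ⟨(connectedSubstructureAt_iff h4).2 ⟨h0, h1⟩, h2, h3, h4, fun p hp q _ hq hqT => ?_⟩
    by_contra hc
    exact hqT (h5 p hp hc q hq)

theorem components.sub (h : T ∈ S.components Q Q₀ k) : SubstructureAt Q T S :=
  (mem_components.1 h).1

theorem components.closed (h : T ∈ S.components Q Q₀ k) {p q : N} (hp : p ∈ T.ground.ports)
    (hpQ : p ∉ Q) (hq : S.Coh p q) : q ∈ T.ground.ports :=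
  (mem_components.1 h).2.2.2.2.2 p hp hpQ q hq

theorem components.exists_not_mem (h : T ∈ S.components Q Q₀ k) :
    ∃ p ∈ T.ground.ports, p ∉ Q := (mem_components.1 h).2.2.2.2.1

theorem components.exists_adj (h : T ∈ S.components Q Q₀ k) {c : N} (hc : c ∈ T.ground.ports)
    (hcQ : c ∈ Q) : ∃ x ∈ T.ground.ports, x ∉ Q ∧ S.Coh x c := by
  obtain ⟨-, h1, -, -, ⟨x, hx, hxQ⟩, -⟩ := mem_components.1 h
  rcases (h1 x hx hxQ c hc).cases_tail with rfl | ⟨a, -, ha⟩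
  · exact absurd hcQ hxQ
  · exact ⟨a, ha.1, ha.2.1, ha.2.2.2⟩

/-- Reachability in `T'` from `x` never leaves `T`, because `T` contains everything linked to its
ports outside `Q`. -/
theorem components.ports_subset (h : T ∈ S.components Q Q₀ k) (h' : T' ∈ S.components Q Q₀ k)
    {x : N} (hx : x ∈ T.ground.ports) (hx' : x ∈ T'.ground.ports) (hxQ : x ∉ Q) :
    T'.ground.ports ⊆ T.ground.ports := by
  intro p hp
  have h1 := (mem_components.1 h').2.1 x hx' hxQ p hp
  induction h1 with
  | refl => exact hx
  | tail _ hab ih => exact components.closed h (ih hab.1) hab.2.1 hab.2.2.2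

/-- Two components that share a port outside `Q` are equal. -/
theorem components.eq_of_mem (h : T ∈ S.components Q Q₀ k) (h' : T' ∈ S.components Q Q₀ k)
    {x : N} (hx : x ∈ T.ground.ports) (hx' : x ∈ T'.ground.ports) (hxQ : x ∉ Q) : T = T' :=
  (components.sub h).eq_of_ports (components.sub h')
    ((components.ports_subset h' h hx' hx hxQ).antisymm
      (components.ports_subset h h' hx hx' hxQ))

theorem components_finite : (S.components Q Q₀ k).Finite := by
  refine Set.Finite.of_finite_image (f := fun T => T.ground.ports)
    (S.ground.ports.powerset.finite_toSet.subset ?_) ?_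
  · rintro _ ⟨T, hT, rfl⟩
    exact Finset.mem_coe.2 (Finset.mem_powerset.2 (components.sub hT).ports)
  · intro T hT T' hT' h
    exact (components.sub hT).eq_of_ports (components.sub hT') h

/-- Ports of `Q` are never wires of a substructure relative to `Q`. -/
theorem components.conclusion_of_mem (h : T ∈ S.components Q Q₀ k) {c : N}
    (hc : c ∈ T.ground.ports) (hcQ : c ∈ Q) : c ∈ T.conclusions := by
  refine Ground.mem_conclusions.2 ⟨hc, ?_⟩
  by_contra hne
  obtain ⟨p, hp⟩ := Option.ne_none_iff_exists'.1 hne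
  exact ((components.sub h).target_eq_some.1 hp).2.1 hcQ

theorem components.conclusions_nonempty (h : T ∈ S.components Q Q₀ k) :
    ∃ c, c ∈ T.conclusions := by
  obtain ⟨p, hp, -⟩ := components.exists_not_mem h
  exact (components.sub h).isDiffPS.isDifferential.conclusions_nonempty ⟨p, hp⟩

end Components

/-- `c` has a premise or is the door of a box. -/
def HasInput (T : DiffPS N α) (c : N) : Prop :=
  (∃ w, T.ground.target w = some c) ∨ ∃ o r, T.door o r = some c

namespace Equivalent

variable {T T' : DiffPS N α}

theorem conclusions_eq (h : T.Equivalent T') : T'.conclusions = T.conclusions := by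
  obtain ⟨f, hf, hc⟩ := h
  ext p
  constructor
  · intro hp
    obtain ⟨hp1, hp2⟩ := Ground.mem_conclusions.1 hp
    obtain ⟨q, hq, rfl⟩ := hf.ground.bij.surjOn hp1
    rw [hf.ground.target q hq, Option.map_eq_none_iff] at hp2
    have hq' : q ∈ T.conclusions := Ground.mem_conclusions.2 ⟨hq, hp2⟩
    rwa [hc q hq']
  · intro hp
    obtain ⟨hp1, hp2⟩ := Ground.mem_conclusions.1 hp
    have h1 := hf.ground.bij.mapsTo hp1
    have h2 := hf.ground.target p hp1
    rw [hc p hp] at h1 h2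
    rw [hp2] at h2
    exact Ground.mem_conclusions.2 ⟨h1, h2⟩

/-- Wires and boxes are carried along the isomorphism, which fixes `c`. For a box, the isomorphism
between the contents also moves the conclusion through which `c` is reached. -/
theorem hasInput_iff (h : T.Equivalent T') (hT : T.IsDiffPS) (hT' : T'.IsDiffPS) {c : N}
    (hcT : c ∈ T.conclusions) : T'.HasInput c ↔ T.HasInput c := by
  obtain ⟨f, hf, hc⟩ := h
  have hfc := hc c hcT
  have hcp := (Ground.mem_conclusions.1 hcT).1
  have hbox : ∀ o, f o ∈ T'.boxes0 → o ∈ T.boxes0 → ∃ A A' g, T.box o = some A ∧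
      T'.box (f o) = some A' ∧ A.IsIso A' g ∧
        ∀ q ∈ A.conclusions, T'.door (f o) (g q) = (T.door o q).map f := by
    intro o ho' ho
    obtain ⟨A, hA⟩ := Option.ne_none_iff_exists'.1 ((hT.box_dom o).2 ho)
    obtain ⟨A', hA'⟩ := Option.ne_none_iff_exists'.1 ((hT'.box_dom (f o)).2 ho')
    obtain ⟨g, hg, hg'⟩ := hf.box o ho A A' hA hA'
    exact ⟨A, A', g, hA, hA', hg, hg'⟩
  have hground : ∀ {A A' : CircPS α} {g}, A.IsIso A' g → A.ground.IsIso A'.ground g := by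
    intro A A' g hg
    cases A
    rw [CircPS.IsIso] at hg
    exact hg.1
  constructor
  · rintro (⟨w, hw⟩ | ⟨o, r, hr⟩)
    · have h1 := hT'.isDifferential.wire w c hw
      obtain ⟨w, hw', rfl⟩ := hf.ground.bij.surjOn h1.1
      rw [hf.ground.target w hw'] at hw
      obtain ⟨c', h2, h3⟩ := Option.map_eq_some_iff.1 hw
      have h4 := (hT.isDifferential.wire w c' h2).2.2.1
      have := hf.ground.bij.injOn h4 hcp (h3.trans hfc.symm)
      subst this
      exact Or.inl ⟨w, h2⟩
    · have ho : o ∈ T'.boxes0 := by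
        by_contra ho
        rw [hT'.door_dom o ho] at hr
        cases hr
      have ho' := ho
      rw [← Finset.mem_coe, ← hf.boxes0] at ho'
      obtain ⟨o, ho', rfl⟩ := ho'
      obtain ⟨A, A', g, hA, hA', hg, hg'⟩ := hbox o ho ho'
      have hr' := ((hT'.isDoor _ A' hA').dom r).1 (by simp [hr])
      obtain ⟨hr1, hr2⟩ := Ground.mem_conclusions.1 hr'
      obtain ⟨r, hr3, rfl⟩ := (hground hg).bij.surjOn hr1
      rw [(hground hg).target r hr3, Option.map_eq_none_iff] at hr2
      rw [hg' r (Ground.mem_conclusions.2 ⟨hr3, hr2⟩)] at hr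
      obtain ⟨c', h2, h3⟩ := Option.map_eq_some_iff.1 hr
      have h4 : c' ∈ T.ground.ports := by
        rcases (hT.isDoor _ A hA).cod _ _ h2 with rfl | h5 | h5
        · exact (Ground.mem_portsOf.1 (hT.boxes0_bang _ ho').1).1
        · exact (Ground.mem_portsOf.1 h5).1
        · exact (Ground.mem_portsOf.1 h5).1
      have := hf.ground.bij.injOn h4 hcp (h3.trans hfc.symm)
      subst this
      exact Or.inr ⟨o, r, h2⟩
  · rintro (⟨w, hw⟩ | ⟨o, r, hr⟩)
    · have h1 := hT.isDifferential.wire w c hw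
      refine Or.inl ⟨f w, ?_⟩
      rw [hf.ground.target w h1.1, hw, Option.map_some, hfc]
    · have ho : o ∈ T.boxes0 := by
        by_contra ho
        rw [hT.door_dom o ho] at hr
        cases hr
      have ho' : f o ∈ T'.boxes0 := by
        rw [← Finset.mem_coe, ← hf.boxes0]
        exact ⟨o, ho, rfl⟩
      obtain ⟨A, A', g, hA, hA', hg, hg'⟩ := hbox o ho' ho
      have hr' := ((hT.isDoor _ A hA).dom r).1 (by simp [hr])
      refine Or.inr ⟨f o, g r, ?_⟩
      rw [hg' r hr', hr, Option.map_some, hfc]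

theorem mem_boxes0_iff (h : T.Equivalent T') (hT : T.IsDiffPS) {o : N}
    (ho : o ∈ T.conclusions) : o ∈ T'.boxes0 ↔ o ∈ T.boxes0 := by
  obtain ⟨f, hf, hc⟩ := h
  have hfo := hc o ho
  rw [← Finset.mem_coe, ← hf.boxes0]
  constructor
  · rintro ⟨o', h1, h2⟩
    have h3 := (Ground.mem_portsOf.1 (hT.boxes0_bang o' h1).1).1
    have := hf.ground.bij.injOn h3 (Ground.mem_conclusions.1 ho).1 (h2.trans hfo.symm)
    rwa [← this]
  · intro h1
    exact ⟨o, h1, hfo⟩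

end Equivalent

theorem le_arity_of_premises {T : DiffPS N α} {q : N} {P : Finset N}
    (hP : ∀ w ∈ P, w ∈ T.ground.ports ∧ T.ground.target w = some q) : P.card ≤ T.arity q := by
  have h1 : P.card ≤ T.ground.arity q := Finset.card_le_card fun w hw =>
    Ground.mem_premises.2 (hP w hw)
  rw [arity_eq_boxArity]
  omega

/-- Each box with `q` among its doors adds at least one to the arity, because `∘`-ports have
positive arity. -/
theorem le_arity_of_boxes {T : DiffPS N α} (hT : T.IsDiffPS) {q : N} {P : Finset N}
    (hP : ∀ o ∈ P, o ∈ T.boxes0 ∧ ∃ r, T.door o r = some q) : P.card ≤ T.arity q := by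
  have h1 : P.card ≤ ∑ o ∈ P, (T.box o).elim 0 fun A => A.boxArity (T.door o) q := by
    rw [Finset.card_eq_sum_ones]
    refine Finset.sum_le_sum fun o ho => ?_
    obtain ⟨h1, r, hr⟩ := hP o ho
    obtain ⟨A, hA⟩ := Option.ne_none_iff_exists'.1 ((hT.box_dom o).2 h1)
    rw [hA]
    exact CircPS.boxArity_pos (hT.isCircPS o A hA) (((hT.isDoor o A hA).dom r).1 (by simp [hr])) hr
  have h2 := Finset.sum_le_sum_of_subset (f := fun o => (T.box o).elim 0
    fun A => A.boxArity (T.door o) q) (fun o ho => (hP o ho).1 : P ⊆ T.boxes0)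
  rw [arity_eq_boxArity]
  omega

theorem arity_lt_of_cosize {T : DiffPS N α} {k : ℕ} (h : T.cosize < k) {q : N}
    (hq : q ∈ T.ground.ports) : T.arity q < k :=
  lt_of_le_of_lt ((Finset.le_sup (f := T.arity) hq).trans (le_max_left _ _)) h

end DiffPS

end

/-! ### Transport of ports and links between levels of the same shape. -/

section

open PortName ExpState

section Moves

variable {α : Type u} {i : ℕ} {R : CircPS α} {e : PseudoExp R}

theorem IsPort.move {ρ : ExpState α} {l l' : List (ExpStep α)} {p : α} (h : IsPort i ρ l p)
    (hl : IsLevel i ρ l') (hs : shape l = shape l') : IsPort i ρ l' p := by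
  obtain ⟨-, h2, h3⟩ := h
  rw [endSt_congr rfl hs] at h2 h3
  refine ⟨hl, h2, h3.imp_left ?_⟩
  rintro rfl
  exact List.length_eq_zero_iff.1 (length_eq_of_shape hs).symm

theorem ports_move {n n' : PortName R} (h : n ∈ (taylor i R e).ground.ports)
    (hl : IsLevel i ⟨R, e⟩ n'.lvl) (hc : n.core = n'.core) (hs : shape n.lvl = shape n'.lvl) :
    n' ∈ (taylor i R e).ground.ports :=
  mem_taylor_ports.2 (hc ▸ IsPort.move (mem_taylor_ports.1 h) hl hs)

theorem label_move {n n' : PortName R} (h : n ∈ (taylor i R e).ground.ports)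
    (hl : IsLevel i ⟨R, e⟩ n'.lvl) (hc : n.core = n'.core) (hs : shape n.lvl = shape n'.lvl) :
    (taylor i R e).ground.label n' = (taylor i R e).ground.label n := by
  rw [taylor_label h, taylor_label (ports_move h hl hc hs), hc, endSt_congr rfl hs]

theorem typ_move {n n' : PortName R} (h : n ∈ (taylor i R e).ground.ports)
    (hl : IsLevel i ⟨R, e⟩ n'.lvl) (hc : n.core = n'.core) (hs : shape n.lvl = shape n'.lvl) :
    (taylor i R e).ground.typ n' = (taylor i R e).ground.typ n := by
  rw [taylor_typ h, taylor_typ (ports_move h hl hc hs), hc, endSt_congr rfl hs]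

theorem left_move {n n' : PortName R} (h : n ∈ (taylor i R e).ground.ports)
    (hl : IsLevel i ⟨R, e⟩ n'.lvl) (hc : n.core = n'.core) (hs : shape n.lvl = shape n'.lvl) :
    n' ∈ (taylor i R e).ground.left ↔ n ∈ (taylor i R e).ground.left := by
  rw [taylor_left h, taylor_left (ports_move h hl hc hs), hc, endSt_congr rfl hs]

theorem target_move (hR : R.IsCircPS) {w w' n n' : PortName R}
    (h : (taylor i R e).ground.target w = some n) (hl : IsLevel i ⟨R, e⟩ w'.lvl)
    (hc : w.core = w'.core) (hs : shape w.lvl = shape w'.lvl) (hn : n.core = n'.core)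
    (hp : n'.lvl <+: w'.lvl) (hlen : n.lvl.length = n'.lvl.length) :
    (taylor i R e).ground.target w' = some n' := by
  obtain ⟨h1, h2⟩ := (taylor_target_eq_some hR).1 h
  refine (taylor_target_eq_some hR).2 ⟨ports_move h1 hl hc hs, ?_⟩
  rw [← hc, ← hn]
  exact tgtL_congr rfl hs h2 hp hlen

theorem exists_take {l l' a : List (ExpStep α)} (ha : a <+: l) (hs : shape l = shape l') :
    ∃ a', a' <+: l' ∧ a.length = a'.length := by
  refine ⟨l'.take a.length, List.take_prefix _ _, ?_⟩
  have := ha.length_le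
  rw [length_eq_of_shape hs] at this
  simp [this]

theorem target_move_exists (hR : R.IsCircPS) {w w' n : PortName R}
    (h : (taylor i R e).ground.target w = some n) (hl : IsLevel i ⟨R, e⟩ w'.lvl)
    (hc : w.core = w'.core) (hs : shape w.lvl = shape w'.lvl) :
    ∃ n', (taylor i R e).ground.target w' = some n' := by
  obtain ⟨h1, h2⟩ := (taylor_target_eq_some hR).1 h
  obtain ⟨a, ha, hlen⟩ := exists_take (tgtL_prefix h2) hs
  obtain ⟨n', rfl, hn'⟩ := exists_of_isLevel (hl.of_prefix ha) n.core
  exact ⟨n', target_move hR h hl hc hs hn'.symm ha hlen⟩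

theorem boxes0_move (hR : R.IsCircPS) {b b' : PortName R}
    (h : b ∈ (taylor i R e).boxes0) (hl : IsLevel i ⟨R, e⟩ b'.lvl)
    (hc : b.core = b'.core) (hs : shape b.lvl = shape b'.lvl) : b' ∈ (taylor i R e).boxes0 := by
  obtain ⟨h1, h2⟩ := (mem_taylor_boxes0 hR).1 h
  refine (mem_taylor_boxes0 hR).2 ⟨ports_move h1 hl hc hs, ?_⟩
  rwa [hc, endSt_congr rfl hs] at h2

theorem box_move (hR : R.IsCircPS) {b b' : PortName R}
    (h : b ∈ (taylor i R e).boxes0) (hl : IsLevel i ⟨R, e⟩ b'.lvl)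
    (hc : b.core = b'.core) (hs : shape b.lvl = shape b'.lvl) :
    (taylor i R e).box b' = (taylor i R e).box b := by
  rw [taylor_box hR h, taylor_box hR (boxes0_move hR h hl hc hs), hc, endSt_congr rfl hs]

theorem door_move (hR : R.IsCircPS) {b b' n n' : PortName R} {r : α}
    (hb : b ∈ (taylor i R e).boxes0)
    (h : (taylor i R e).door b r = some n) (hl : IsLevel i ⟨R, e⟩ b'.lvl)
    (hc : b.core = b'.core) (hs : shape b.lvl = shape b'.lvl) (hn : n.core = n'.core)
    (hp : n'.lvl <+: b'.lvl) (hlen : n.lvl.length = n'.lvl.length) :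
    (taylor i R e).door b' r = some n' := by
  rw [taylor_door_eq_some hR hb] at h
  rw [taylor_door_eq_some hR (boxes0_move hR hb hl hc hs), ← hc, ← hn]
  exact doorL_congr rfl hs h hp hlen

theorem door_move_exists (hR : R.IsCircPS) {b b' n : PortName R} {r : α}
    (hb : b ∈ (taylor i R e).boxes0)
    (h : (taylor i R e).door b r = some n) (hl : IsLevel i ⟨R, e⟩ b'.lvl)
    (hc : b.core = b'.core) (hs : shape b.lvl = shape b'.lvl) :
    ∃ n', (taylor i R e).door b' r = some n' := by
  have h2 := (taylor_door_eq_some hR hb r).1 h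
  obtain ⟨a, ha, hlen⟩ := exists_take (doorL_prefix h2) hs
  obtain ⟨n', rfl, hn'⟩ := exists_of_isLevel (hl.of_prefix ha) n.core
  exact ⟨n', door_move hR hb h hl hc hs hn'.symm ha hlen⟩

theorem taylor_target_prefix (hR : R.IsCircPS) {w n : PortName R}
    (h : (taylor i R e).ground.target w = some n) : n.lvl <+: w.lvl :=
  tgtL_prefix ((taylor_target_eq_some hR).1 h).2

theorem taylor_door_boxes0 (hR : R.IsCircPS) {b n : PortName R} {r : α}
    (hb : b ∈ (taylor i R e).boxes0) (h : (taylor i R e).door b r = some n) : n.lvl <+: b.lvl :=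
  doorL_prefix ((taylor_door_eq_some hR hb r).1 h)

theorem isLevel_of_mem {n : PortName R} (h : n ∈ (taylor i R e).ground.ports) :
    IsLevel i ⟨R, e⟩ n.lvl := (mem_taylor_ports.1 h).1

theorem taylor_boxes0_ports (hR : R.IsCircPS) {n : PortName R}
    (h : n ∈ (taylor i R e).boxes0) : n ∈ (taylor i R e).ground.ports :=
  ((mem_taylor_boxes0 hR).1 h).1

theorem taylor_target_mem (hR : R.IsCircPS) {w n : PortName R}
    (h : (taylor i R e).ground.target w = some n) : n ∈ (taylor i R e).ground.ports := by
  obtain ⟨h1, h2⟩ := (taylor_target_eq_some hR).1 h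
  exact mem_taylor_ports.2 (tgtL_port (ρ := ⟨R, e⟩) hR (isLevel_of_mem h1) h2)

theorem taylor_door_mem (hR : R.IsCircPS) {b n : PortName R} {r : α}
    (hb : b ∈ (taylor i R e).boxes0) (h : (taylor i R e).door b r = some n) :
    n ∈ (taylor i R e).ground.ports :=
  mem_taylor_ports.2 (doorL_port (ρ := ⟨R, e⟩) hR (isLevel_of_mem (taylor_boxes0_ports hR hb))
    ((taylor_door_eq_some hR hb r).1 h)).1

theorem taylor_exists_main (hR : R.IsCircPS) {b : PortName R}
    (hb : b ∈ (taylor i R e).boxes0) : ∃ r, (taylor i R e).door b r = some b := by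
  obtain ⟨h1, h2, -⟩ := (mem_taylor_boxes0 hR).1 hb
  obtain ⟨r, hr⟩ := exists_doorL_main (ρ := ⟨R, e⟩) hR (isLevel_of_mem h1) h2
  exact ⟨r, (taylor_door_eq_some hR hb r).2 hr⟩

theorem coh_of_target (hR : R.IsCircPS) {w n : PortName R}
    (h : (taylor i R e).ground.target w = some n) : (taylor i R e).Coh w n :=
  ⟨mem_ports_of_taylor_target hR h, taylor_target_mem hR h, Or.inl h⟩

theorem coh_of_doors (hR : R.IsCircPS) {b n n' : PortName R} {r r' : α}
    (hb : b ∈ (taylor i R e).boxes0) (h : (taylor i R e).door b r = some n)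
    (h' : (taylor i R e).door b r' = some n') : (taylor i R e).Coh n n' :=
  ⟨taylor_door_mem hR hb h, taylor_door_mem hR hb h', Or.inr (Or.inr ⟨b, hb, ⟨r, h⟩, r', h'⟩)⟩

theorem coh_box (hR : R.IsCircPS) {b n : PortName R} {r : α}
    (hb : b ∈ (taylor i R e).boxes0) (h : (taylor i R e).door b r = some n) :
    (taylor i R e).Coh n b := by
  obtain ⟨r', hr'⟩ := taylor_exists_main hR hb
  exact coh_of_doors hR hb h hr'

end Moves

/-- The hypotheses under which the components of the partial expansions are studied: `Q` is the
set of the critical ports. -/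
structure CriticalSetting {α : Type u} (k i : ℕ) (R : CircPS α) (e : PseudoExp R)
    (Q : Set (PortName R)) : Prop where
  one_lt : 1 < k
  isCircPS : R.IsCircPS
  cosize_lt : R.cosize < k
  inj : KInj k ⟨R, e⟩
  mem_iff : ∀ n, n ∈ Q ↔ IsCritical i ⟨R, e⟩ n.pos

/-! ### The level of a component and the number of components at a level. -/

namespace CriticalSetting

variable {α : Type u} {k i : ℕ} {R : CircPS α} {e : PseudoExp R} {Q Q₀ : Set (PortName R)}

theorem move (h : CriticalSetting k i R e Q) {n n' : PortName R} (hn : n ∈ Q)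
    (hl : IsLevel i ⟨R, e⟩ n'.lvl) (hc : n.core = n'.core) (hs : shape n.lvl = shape n'.lvl) :
    n' ∈ Q := by
  rw [h.mem_iff] at hn ⊢
  have := hn.shape h.one_lt h.inj hl hs
  rwa [hc] at this

theorem box_not_mem (h : CriticalSetting k i R e Q) {b : PortName R}
    (hb : b ∈ (taylor i R e).boxes0) : b ∉ Q := by
  rw [h.mem_iff]
  obtain ⟨h1, h2, h3⟩ := (mem_taylor_boxes0 h.isCircPS).1 hb
  exact IsCritical.not_kept (ρ := ⟨R, e⟩) h.isCircPS (isLevel_of_mem h1) h2 h3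

/-- There are at least `k` copies of a port that is in a copy of a box. -/
theorem exists_copies (h : CriticalSetting k i R e Q) {a u : List (ExpStep α)}
    (hl : IsLevel i ⟨R, e⟩ (a ++ u)) (hu : u ≠ []) (p : α) :
    ∃ P : Finset (PortName R), k ≤ P.card ∧ ∀ w ∈ P, p = w.core ∧ IsLevel i ⟨R, e⟩ w.lvl ∧
      a <+: w.lvl ∧ shape (a ++ u) = shape w.lvl := by
  obtain ⟨x, u, rfl⟩ := List.exists_cons_of_ne_nil hu
  obtain ⟨ha, hx, hu'⟩ := (isLevel_append _ _ _ _).1 hl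
  -- Varying only the first step after `a` gives `k ^ j ≥ k` copies, as `j > 0`; the rest of the
  -- path is reproduced in each of them.
  set C := (children i (endSt ⟨R, e⟩ a)).filter fun y => y.1 = x.1 with hC
  have hex : ∀ y ∈ C, ∃ w : PortName R, w.core = p ∧ IsLevel i ⟨R, e⟩ w.lvl ∧
      (a ++ [y]) <+: w.lvl ∧ shape (a ++ x :: u) = shape w.lvl := by
    intro y hy
    obtain ⟨hy1, hy2⟩ := Finset.mem_filter.1 hy
    have hyx : x.2.1 = y.2.1 := by rw [child_content hx, child_content hy1, hy2]
    obtain ⟨u', hu1, hu2⟩ := ((h.inj.endSt ha).child hy1).exists_shape h.one_lt hyx hu'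
    have hl' : IsLevel i ⟨R, e⟩ (a ++ y :: u') := (isLevel_append _ _ _ _).2 ⟨ha, hy1, hu1⟩
    obtain ⟨w, hw1, hw2⟩ := exists_of_isLevel hl' p
    refine ⟨w, hw2, hw1 ▸ hl', ⟨u', by simp [hw1]⟩, ?_⟩
    simp [hw1, hu2, hyx, hy2]
  have : Nonempty (PortName R) := ⟨base p⟩
  choose! g hg1 hg2 hg3 hg4 using hex
  refine ⟨C.image g, ?_, ?_⟩
  · rw [Finset.card_image_of_injOn, card_children (child_mem hx)
      (child_content hx ▸ child_depth hx)]
    · obtain ⟨j, hj, hj'⟩ := h.inj.ncop_eq ha (child_mem hx)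
      rw [hj']
      exact Nat.le_self_pow hj.ne' k
    · intro y hy y' hy' heq
      have h1 := hg3 y hy
      have h2 := hg3 y' hy'
      rw [heq] at h1
      have h3 := (List.prefix_of_prefix_length_le h1 h2 (by simp)).eq_of_length (by simp)
      simpa using h3
  · intro w hw
    obtain ⟨y, hy, rfl⟩ := Finset.mem_image.1 hw
    exact ⟨(hg1 y hy).symm, hg2 y hy, (List.prefix_append _ _).trans (hg3 y hy), hg4 y hy⟩

variable {T T' : DiffPS (PortName R) α}

/-- If `w` were strictly inside, at least `k` ports of the same shape would have target `x`. They
are noncritical like `w`, and they belong to `T` because `x` is noncritical; so `x` would have arity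
at least `k` in `T`, against the bound on the cosize. -/
theorem level_of_target (h : CriticalSetting k i R e Q)
    (hT : T ∈ (taylor i R e).components Q Q₀ k) {w x : PortName R} (hx : x ∈ T.ground.ports)
    (hxQ : x ∉ Q) (hwQ : w ∉ Q) (hw : (taylor i R e).ground.target w = some x) :
    w.lvl = x.lvl := by
  by_contra hne
  have hR := h.isCircPS
  obtain ⟨u, hu⟩ := taylor_target_prefix hR hw
  have hwp := mem_ports_of_taylor_target hR hw
  have hl := isLevel_of_mem hwp
  rw [← hu] at hl
  obtain ⟨P, hP, hPw⟩ := h.exists_copies hl (by rintro rfl; simp at hu; exact hne hu.symm) w.core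
  refine absurd (DiffPS.arity_lt_of_cosize (DiffPS.mem_components.1 hT).2.2.1 hx)
    (not_lt.2 (hP.trans (DiffPS.le_arity_of_premises fun w' hw' => ?_)))
  obtain ⟨h1, h2, h3, h4⟩ := hPw w' hw'
  rw [hu] at h4
  have ht := target_move hR hw h2 h1 h4 rfl h3 rfl
  have hw'T := DiffPS.components.closed hT hx hxQ (coh_of_target hR ht).symm
  exact ⟨hw'T, (DiffPS.components.sub hT).target_eq_some.2 ⟨hw'T,
    fun hc => hwQ (h.move hc (isLevel_of_mem hwp) h1.symm h4.symm), hx, ht⟩⟩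

/-- Same argument with boxes instead of premises: at least `k` kept boxes would have `x` among their
doors. -/
theorem level_of_door (h : CriticalSetting k i R e Q)
    (hT : T ∈ (taylor i R e).components Q Q₀ k) {b x : PortName R} {r : α}
    (hx : x ∈ T.ground.ports) (hxQ : x ∉ Q) (hb : b ∈ (taylor i R e).boxes0)
    (hr : (taylor i R e).door b r = some x) : b.lvl = x.lvl := by
  by_contra hne
  have hR := h.isCircPS
  obtain ⟨u, hu⟩ := taylor_door_boxes0 hR hb hr
  have hl := isLevel_of_mem (taylor_boxes0_ports hR hb)
  rw [← hu] at hl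
  obtain ⟨P, hP, hPw⟩ := h.exists_copies hl (by rintro rfl; simp at hu; exact hne hu.symm) b.core
  have hsub := DiffPS.components.sub hT
  refine absurd (DiffPS.arity_lt_of_cosize (DiffPS.mem_components.1 hT).2.2.1 hx)
    (not_lt.2 (hP.trans (DiffPS.le_arity_of_boxes hsub.isDiffPS fun b' hb' => ?_)))
  obtain ⟨h1, h2, h3, h4⟩ := hPw b' hb'
  rw [hu] at h4
  have hb0 := boxes0_move hR hb h2 h1 h4
  have ht := door_move hR hb hr h2 h1 h4 rfl h3 rfl
  have hb'T := DiffPS.components.closed hT hx hxQ (coh_box hR hb0 ht)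
  have hb1 := (hsub.boxes0 b').2 ⟨hb0, hb'T⟩
  exact ⟨hb1, r, hsub.door_eq_some.2 ⟨hb1, ht⟩⟩

/-- The ports of `T` outside `Q` are at level `s`. -/
def HasLevel (Q : Set (PortName R)) (T : DiffPS (PortName R) α) (s : List (ExpStep α)) : Prop :=
  ∀ x ∈ T.ground.ports, x ∉ Q → x.lvl = s

theorem level_of_coh (h : CriticalSetting k i R e Q)
    (hT : T ∈ (taylor i R e).components Q Q₀ k) {x y : PortName R} (hx : x ∈ T.ground.ports)
    (hxQ : x ∉ Q) (hy : y ∈ T.ground.ports) (hyQ : y ∉ Q) (hxy : (taylor i R e).Coh x y) :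
    x.lvl = y.lvl := by
  obtain ⟨-, -, h1 | h1 | ⟨b, hb, ⟨r, hr⟩, r', hr'⟩⟩ := hxy
  · exact h.level_of_target hT hy hyQ hxQ h1
  · exact (h.level_of_target hT hx hxQ hyQ h1).symm
  · exact (h.level_of_door hT hx hxQ hb hr).symm.trans (h.level_of_door hT hy hyQ hb hr')

/-- The noncritical ports of a component are in the same copy. -/
theorem exists_level (h : CriticalSetting k i R e Q)
    (hT : T ∈ (taylor i R e).components Q Q₀ k) :
    ∃ s, IsLevel i ⟨R, e⟩ s ∧ HasLevel Q T s := by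
  obtain ⟨x, hx, hxQ⟩ := DiffPS.components.exists_not_mem hT
  refine ⟨x.lvl, isLevel_of_mem ((DiffPS.components.sub hT).ports hx), fun p hp hpQ => ?_⟩
  have h1 := (DiffPS.mem_components.1 hT).2.1 x hx hxQ p hp
  clear hp
  induction h1 with
  | refl => rfl
  | @tail a b _ hab ih =>
    rw [← ih hab.2.1]
    exact (h.level_of_coh hT hab.1 hab.2.1 hab.2.2.1 hpQ hab.2.2.2).symm

theorem HasLevel.unique (hT : T ∈ (taylor i R e).components Q Q₀ k) {s s' : List (ExpStep α)}
    (hs : HasLevel Q T s) (hs' : HasLevel Q T s') : s = s' := by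
  obtain ⟨x, hx, hxQ⟩ := DiffPS.components.exists_not_mem hT
  exact (hs x hx hxQ).symm.trans (hs' x hx hxQ)

/-- The source of an input can always be taken outside `Q`: wires of `T` avoid `Q`, and kept boxes
are not critical. -/
theorem exists_input (h : CriticalSetting k i R e Q)
    (hT : T ∈ (taylor i R e).components Q Q₀ k) {c : PortName R} (hc : T.HasInput c) :
    ∃ w ∈ T.ground.ports, w ∉ Q ∧ ((taylor i R e).ground.target w = some c ∨
      w ∈ (taylor i R e).boxes0 ∧ ∃ r, (taylor i R e).door w r = some c) := by
  have hsub := DiffPS.components.sub hT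
  rcases hc with ⟨w, hw⟩ | ⟨b, r, hr⟩
  · obtain ⟨h1, h2, -, h3⟩ := hsub.target_eq_some.1 hw
    exact ⟨w, h1, h2, Or.inl h3⟩
  · obtain ⟨h1, h2⟩ := hsub.door_eq_some.1 hr
    obtain ⟨h3, h4⟩ := (hsub.boxes0 b).1 h1
    exact ⟨b, h4, h.box_not_mem h3, Or.inr ⟨h3, r, h2⟩⟩

theorem prefix_of_input (h : CriticalSetting k i R e Q)
    (hT : T ∈ (taylor i R e).components Q Q₀ k) {s : List (ExpStep α)} (hs : HasLevel Q T s)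
    {c : PortName R} (hc : T.HasInput c) : c.lvl <+: s := by
  obtain ⟨w, hw, hwQ, h1 | ⟨h1, r, hr⟩⟩ := h.exists_input hT hc
  · exact hs w hw hwQ ▸ taylor_target_prefix h.isCircPS h1
  · exact hs w hw hwQ ▸ taylor_door_boxes0 h.isCircPS h1 hr

/-- A component in which the critical conclusion `c` has no premise is determined by `c`. -/
theorem eq_of_not_input (h : CriticalSetting k i R e Q)
    (hT : T ∈ (taylor i R e).components Q Q₀ k) (hT' : T' ∈ (taylor i R e).components Q Q₀ k)
    {c : PortName R} (hc : c ∈ T.ground.ports) (hc' : c ∈ T'.ground.ports)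
    (hcQ : c ∉ Q ∨ ¬ T.HasInput c ∧ ¬ T'.HasInput c) : T = T' := by
  by_cases hq : c ∈ Q
  · obtain ⟨hi, hi'⟩ := hcQ.resolve_left (not_not.2 hq)
    -- Without an input, the only link from the noncritical part of the component to `c` is the
    -- target of `c` in the expansion. This target does not depend on the component.
    have key : ∀ {T}, T ∈ (taylor i R e).components Q Q₀ k → c ∈ T.ground.ports →
        ¬ T.HasInput c → ∃ x ∈ T.ground.ports, x ∉ Q ∧
          (taylor i R e).ground.target c = some x := by
      intro T hT hc hi
      have hsub := DiffPS.components.sub hT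
      obtain ⟨x, hx, hxQ, hxc⟩ := DiffPS.components.exists_adj hT hc hq
      refine ⟨x, hx, hxQ, ?_⟩
      obtain ⟨-, -, h1 | h1 | ⟨b, hb, ⟨r, hr⟩, r', hr'⟩⟩ := hxc
      · exact absurd (Or.inl ⟨x, hsub.target_eq_some.2 ⟨hx, hxQ, hc, h1⟩⟩) hi
      · exact h1
      · have h2 := DiffPS.components.closed hT hx hxQ (coh_box h.isCircPS hb hr)
        exact absurd (Or.inr ⟨b, r', hsub.door_eq_some.2
          ⟨(hsub.boxes0 b).2 ⟨hb, h2⟩, hr'⟩⟩) hi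
    obtain ⟨x, hx, hxQ, h1⟩ := key hT hc hi
    obtain ⟨x', hx', -, h2⟩ := key hT' hc' hi'
    rw [h1] at h2
    cases h2
    exact DiffPS.components.eq_of_mem hT hT' hx hx' hxQ
  · exact DiffPS.components.eq_of_mem hT hT' hc hc' hq

/-- There are less than `k` components at a given level above a given port. -/
theorem ncard_level_lt (h : CriticalSetting k i R e Q) {s : List (ExpStep α)}
    (hs : IsLevel i ⟨R, e⟩ s) {c : PortName R} (hc : c ∈ (taylor i R e).ground.ports) :
    {T | T ∈ (taylor i R e).components Q Q₀ k ∧ HasLevel Q T s ∧ T.HasInput c}.ncard < k := by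
  set ρ : ExpState α := ⟨R, e⟩ with hρ
  set B := ((endSt ρ s).1.boxes0.filter fun o => ((endSt ρ s).1.content o).depth < i).filter
    fun o => ∃ r, doorL ρ s o r = some c.pos with hB
  -- `A` gathers the cores at level `s` that reach `c`, as wires or as boxes. Each component counted
  -- owns one of them, and components are disjoint outside `Q`; so the contribution of `s` to the
  -- arity of `c` is an upper bound.
  set A := ((endSt ρ s).1.ground.ports.filter fun p =>
    (s = [] ∨ p ∉ (endSt ρ s).1.circConclusions) ∧ tgtL ρ s p = some c.pos) ∪ B with hA
  have hcard : A.card ≤ contrib i ρ s c.pos := by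
    refine (Finset.card_union_le _ _).trans (Nat.add_le_add_left ?_ _)
    rw [hB, Finset.card_filter]
    refine Finset.sum_le_sum fun o ho => ?_
    split_ifs with hr
    · obtain ⟨r, hr⟩ := hr
      have h1 := (doorL_eq_some (a := c.pos.1) (q := c.pos.2)).1 hr
      have h2 := hs.isCircPS h.isCircPS
      exact CircPS.boxArity_pos (h2.content o)
        (((h2.isDoor (Finset.mem_filter.1 ho).1).dom r).1 (by simp [h1.1])) hr
    · exact Nat.zero_le _
  have hlt : contrib i ρ s c.pos < k := by
    have hp := mem_taylor_ports.1 hc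
    exact (contrib_le h.isCircPS hs _ _).trans_lt
      (((CircPS.arity_le_cosize _ hp.2.1).trans hp.1.cosize_le).trans_lt h.cosize_lt)
  refine lt_of_le_of_lt ?_ (hcard.trans_lt hlt)
  have hex : ∀ T ∈ {T | T ∈ (taylor i R e).components Q Q₀ k ∧ HasLevel Q T s ∧ T.HasInput c},
      ∃ p, p ∈ A ∧ ∃ w ∈ T.ground.ports, w ∉ Q ∧ w.lvl = s ∧ w.core = p := by
    rintro T ⟨hT, hTs, hTc⟩
    obtain ⟨w, hw, hwQ, hw1⟩ := h.exists_input hT hTc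
    have hws := hTs w hw hwQ
    refine ⟨w.core, ?_, w, hw, hwQ, hws, rfl⟩
    rcases hw1 with h1 | ⟨h1, r, hr⟩
    · obtain ⟨h2, h3⟩ := (taylor_target_eq_some h.isCircPS).1 h1
      have h4 := mem_taylor_ports.1 h2
      rw [hws] at h3 h4
      exact Finset.mem_union_left _ (Finset.mem_filter.2 ⟨h4.2.1, h4.2.2, h3⟩)
    · have h3 := (taylor_door_eq_some h.isCircPS h1 r).1 hr
      have h4 := (mem_taylor_boxes0 h.isCircPS).1 h1
      rw [hws] at h3 h4
      exact Finset.mem_union_right _ (Finset.mem_filter.2 ⟨Finset.mem_filter.2 h4.2, r, h3⟩)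
  have : Nonempty α := ⟨c.core⟩
  choose! g hg1 hg2 using hex
  rw [← Set.ncard_coe_finset A]
  refine Set.ncard_le_ncard_of_injOn g hg1 ?_ A.finite_toSet
  intro T hT T' hT' heq
  obtain ⟨w, hw, hwQ, hw1, hw2⟩ := hg2 T hT
  obtain ⟨w', hw', -, hw1', hw2'⟩ := hg2 T' hT'
  have : w = w' := ext_lvl_core (hw1.trans hw1'.symm) (hw2.trans (heq.trans hw2'.symm))
  subst this
  exact DiffPS.components.eq_of_mem hT.1 hT'.1 hw hw' hwQ

end CriticalSetting

end

/-! ### Moving a component by exchanging two copies. -/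

section

open PortName ExpState

namespace DiffPS

variable {N : Type u} {α : Type v}

/-- A criterion for being a substructure, in terms of the graph of the target function. -/
theorem SubstructureAt.of_target {Q : Set N} {T S : DiffPS N α} (isDiffPS : T.IsDiffPS)
    (exponential : Q ⊆ S.ground.exponential) (ports : T.ground.ports ⊆ S.ground.ports)
    (label : ∀ p ∈ T.ground.ports, T.ground.label p = S.ground.label p)
    (target : ∀ w p, T.ground.target w = some p ↔ w ∈ T.ground.ports ∧ w ∉ Q ∧
      p ∈ T.ground.ports ∧ S.ground.target w = some p)
    (left : ∀ w p, S.ground.target w = some p → p ∈ T.ground.multiplicative →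
      w ∈ S.ground.left → w ∈ T.ground.left)
    (left' : ∀ w ∈ T.ground.left, w ∈ S.ground.left)
    (typ : ∀ p ∈ T.ground.ports, T.ground.typ p = S.ground.typ p)
    (boxes0 : ∀ o, o ∈ T.boxes0 ↔ o ∈ S.boxes0 ∧ o ∈ T.ground.ports)
    (box : ∀ o ∈ T.boxes0, T.box o = S.box o)
    (door : ∀ o ∈ T.boxes0, T.door o = S.door o) : SubstructureAt Q T S where
  isDiffPS := isDiffPS
  exponential := exponential
  ports := ports
  wires w := by
    rw [Ground.wires, Finset.mem_filter]
    constructor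
    · rintro ⟨-, h2⟩
      obtain ⟨p, hp⟩ := Option.ne_none_iff_exists'.1 h2
      obtain ⟨h3, h4, h5, h6⟩ := (target w p).1 hp
      exact ⟨Finset.mem_filter.2 ⟨ports h3, by simp [h6]⟩, h3, h4, p, h5, h6⟩
    · rintro ⟨-, h2, h3, p, h4, h5⟩
      exact ⟨h2, by simp [(target w p).2 ⟨h2, h3, h4, h5⟩]⟩
  label := label
  target w hw := by
    obtain ⟨p, hp⟩ := Option.ne_none_iff_exists'.1 (Finset.mem_filter.1 hw).2
    rw [hp, ((target w p).1 hp).2.2.2]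
  left w := by
    constructor
    · intro hw
      obtain ⟨p, hp, h1⟩ := isDiffPS.isDifferential.left_wire w hw
      exact ⟨left' w hw, p, hp, ((target w p).1 h1).2.2.2⟩
    · rintro ⟨h1, p, hp, h2⟩
      exact left w p h2 hp h1
  typ := typ
  boxes0 := boxes0
  box := box
  door := door

theorem SubstructureAt.not_exponential_of_mult {Q : Set N} {T S : DiffPS N α}
    (h : SubstructureAt Q T S) {p : N} (hp : p ∈ T.ground.multiplicative) :
    p ∉ S.ground.exponential := by
  intro hc
  obtain ⟨h1, h2⟩ := Ground.mem_multiplicative.1 hp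
  rw [h.label p h1] at h2
  have h3 := (Ground.mem_exponential.1 hc).2
  rcases h2 with h2 | h2 <;> rw [h2] at h3 <;> simp at h3

end DiffPS

section

variable {α : Type u} {k i : ℕ} {R : CircPS α} {e : PseudoExp R} {Q Q₀ : Set (PortName R)}
  {T : DiffPS (PortName R) α}

/-- A permutation that exchanges the ports of two copies. -/
structure IsSwap (s s' : List (ExpStep α)) (f : Equiv.Perm (PortName R)) : Prop where
  symm_apply : ∀ n, f.symm n = f n
  core : ∀ n, (f n).core = n.core
  lvl : ∀ n, n.lvl = s → (f n).lvl = s'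
  lvl' : ∀ n, n.lvl = s' → (f n).lvl = s
  eq_self : ∀ n, n.lvl ≠ s → n.lvl ≠ s' → f n = n

theorem exists_isSwap {s s' : List (ExpStep α)} (hs : IsLevel i ⟨R, e⟩ s)
    (hs' : IsLevel i ⟨R, e⟩ s') : ∃ f : Equiv.Perm (PortName R), IsSwap s s' f := by
  choose g hg1 hg2 using fun p => exists_of_isLevel hs p
  choose g' hg1' hg2' using fun p => exists_of_isLevel hs' p
  set F : PortName R → PortName R := fun n =>
    if n.lvl = s then g' n.core else if n.lvl = s' then g n.core else n with hF
  have h1 : ∀ n, (F n).core = n.core := by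
    intro n
    simp only [hF]
    split_ifs
    exacts [hg2' _, hg2 _, rfl]
  have h2 : ∀ n, n.lvl = s → (F n).lvl = s' := by
    intro n hn
    simp only [hF, hn, if_true]
    exact hg1' _
  have h3 : ∀ n, n.lvl = s' → (F n).lvl = s := by
    intro n hn
    by_cases h : s' = s
    · rw [h2 n (hn.trans h), h]
    · simp only [hF, hn, if_neg h, if_true]
      exact hg1 _
  have h4 : ∀ n, n.lvl ≠ s → n.lvl ≠ s' → F n = n := by
    intro n hn hn'
    simp only [hF, hn, hn', if_false]
  have h5 : Function.Involutive F := by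
    intro n
    refine ext_lvl_core ?_ (by rw [h1, h1])
    by_cases hn : n.lvl = s
    · rw [h3 _ (h2 n hn), hn]
    · by_cases hn' : n.lvl = s'
      · rw [h2 _ (h3 n hn'), hn']
      · rw [h4 n hn hn', h4 n hn hn']
  refine ⟨h5.toPerm F, fun n => ?_, h1, h2, h3, h4⟩
  rw [h5.toPerm_symm]

namespace CriticalSetting

/-- A component that has no conclusion in its copy or in the copies inside can be moved to another
copy with the same shape. -/
theorem rename_mem (h : CriticalSetting k i R e Q)
    (hT : T ∈ (taylor i R e).components Q Q₀ k) {s s' t : List (ExpStep α)}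
    {f : Equiv.Perm (PortName R)} (hf : IsSwap s s' f) (hs : HasLevel Q T s)
    (hs0 : IsLevel i ⟨R, e⟩ s) (hs' : IsLevel i ⟨R, e⟩ s')
    (hss : shape s = shape s') (hne : s ≠ s')
    (hc : ∀ c ∈ T.conclusions, c.lvl <+: t) (hts : t <+: s) (hts' : t <+: s') :
    (∀ c ∈ T.conclusions, f c = c) ∧ T.rename f ∈ (taylor i R e).components Q Q₀ k ∧
      HasLevel Q (T.rename f) s' := by
  obtain ⟨hsymm, hcore, hf1, hf2, hf3⟩ := hf
  have hR := h.isCircPS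
  have hlen := length_eq_of_shape hss
  have hsub := DiffPS.components.sub hT
  have hff : ∀ n, f (f n) = n := fun n => by rw [← hsymm (f n), f.symm_apply_apply]
  -- If `t` were as long as `s`, both `s` and `s'` would be equal to `t`.
  have htlen : t.length < s.length := by
    refine lt_of_le_of_ne hts.length_le fun hl => hne ?_
    rw [← hts.eq_of_length hl, ← hts'.eq_of_length (hl.trans hlen)]
  have hnet : ∀ {l : List (ExpStep α)}, l <+: t → l ≠ s ∧ l ≠ s' := by
    intro l hl
    have := hl.length_le
    exact ⟨by rintro rfl; omega, by rintro rfl; omega⟩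
  -- The two kinds of ports of `T`: noncritical ones, which move from `s` to `s'`, and critical
  -- ones, which are conclusions and hence lie strictly outside both copies, where `f` is the
  -- identity.
  have hcase : ∀ n ∈ T.ground.ports, (n ∉ Q ∧ n.lvl = s ∧ (f n).lvl = s' ∧ f n ∉ Q) ∨
      (n ∈ Q ∧ n.lvl <+: t ∧ f n = n) := by
    intro n hn
    by_cases hnQ : n ∈ Q
    · have h1 := hc n (DiffPS.components.conclusion_of_mem hT hn hnQ)
      exact Or.inr ⟨hnQ, h1, hf3 n (hnet h1).1 (hnet h1).2⟩
    · have h1 := hs n hn hnQ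
      refine Or.inl ⟨hnQ, h1, hf1 n h1, fun hc => hnQ ?_⟩
      refine h.move hc (h1 ▸ hs0) (hcore n) ?_
      rw [hf1 n h1, h1, hss]
  have hlvl : ∀ n ∈ T.ground.ports, n.lvl <+: s ∧ (f n).lvl <+: s' ∧
      n.lvl.length = (f n).lvl.length := by
    intro n hn
    rcases hcase n hn with ⟨-, h1, h2, -⟩ | ⟨-, h1, h2⟩
    · rw [h1, h2]
      exact ⟨List.prefix_rfl, List.prefix_rfl, hlen⟩
    · rw [h2]
      exact ⟨h1.trans hts, h1.trans hts', rfl⟩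
  have htarget : ∀ {w n}, w.lvl = s → n ∈ T.ground.ports →
      ((taylor i R e).ground.target (f w) = some (f n) ↔
        (taylor i R e).ground.target w = some n) := by
    intro w n hw hn
    obtain ⟨h1, h2, h3⟩ := hlvl n hn
    have hfw := hf1 w hw
    constructor
    · intro ht
      exact target_move hR ht (hw ▸ hs0) (hcore w) (by rw [hw, hfw, hss]) (hcore n)
        (hw ▸ h1) h3.symm
    · intro ht
      exact target_move hR ht (hfw ▸ hs') (hcore w).symm (by rw [hw, hfw, hss]) (hcore n).symm
        (hfw ▸ h2) h3
  have hboxes : ∀ {b}, b.lvl = s → (f b ∈ (taylor i R e).boxes0 ↔ b ∈ (taylor i R e).boxes0) := by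
    intro b hb
    have hfb := hf1 b hb
    constructor
    · intro ht
      exact boxes0_move hR ht (hb ▸ hs0) (hcore b) (by rw [hb, hfb, hss])
    · intro ht
      exact boxes0_move hR ht (hfb ▸ hs') (hcore b).symm (by rw [hb, hfb, hss])
  have hdoor : ∀ {b n r}, b.lvl = s → b ∈ (taylor i R e).boxes0 → n ∈ T.ground.ports →
      (taylor i R e).door b r = some n → (taylor i R e).door (f b) r = some (f n) := by
    intro b n r hb hb0 hn ht
    obtain ⟨h1, h2, h3⟩ := hlvl n hn
    have hfb := hf1 b hb
    exact door_move hR hb0 ht (hfb ▸ hs') (hcore b).symm (by rw [hb, hfb, hss]) (hcore n).symm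
      (hfb ▸ h2) h3
  have hdoor' : ∀ {b n x r}, b.lvl = s → b ∈ (taylor i R e).boxes0 → b ∈ T.ground.ports →
      x ∈ T.ground.ports → x ∉ Q → (taylor i R e).Coh x b →
      (taylor i R e).door (f b) r = some n →
      ∃ n₀ ∈ T.ground.ports, n = f n₀ ∧ (taylor i R e).door b r = some n₀ := by
    intro b n x r hb hb0 hbT hx hxQ hxb ht
    have hfb := hf1 b hb
    obtain ⟨n₀, hn₀⟩ := door_move_exists hR ((hboxes hb).2 hb0) ht (hb ▸ hs0) (hcore b)
      (by rw [hb, hfb, hss])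
    have h2 := DiffPS.components.closed hT hbT (h.box_not_mem hb0) (coh_box hR hb0 hn₀).symm
    have h3 := hdoor hb hb0 h2 hn₀
    rw [ht] at h3
    exact ⟨n₀, h2, Option.some.inj h3, hn₀⟩
  have hports : ∀ n, n ∈ (T.rename f).ground.ports ↔ f n ∈ T.ground.ports := fun n => by
    rw [← hsymm n]
    exact Ground.mem_rename_ports f
  have hfports : ∀ n, f n ∈ (T.rename f).ground.ports ↔ n ∈ T.ground.ports := fun n => by
    rw [hports, hff]
  have hbox0 : ∀ o, f o ∈ (T.rename f).boxes0 ↔ o ∈ T.boxes0 := fun n => by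
    rw [DiffPS.mem_rename_boxes0, f.symm_apply_apply]
  -- As `f` is an involution, properties of the renamed component need only be checked at ports
  -- written `f n`.
  have hsurj : ∀ {p : PortName R → Prop}, (∀ n, p (f n)) → ∀ n, p n := fun hp n => by
    have := hp (f n)
    rwa [hff] at this
  have hQf : ∀ n ∈ T.ground.ports, (f n ∈ Q ↔ n ∈ Q) := by
    intro n hn
    rcases hcase n hn with ⟨h1, -, -, h2⟩ | ⟨h1, -, h2⟩
    · simp [h1, h2]
    · rw [h2]
  have hmove : ∀ n ∈ T.ground.ports, n ∈ (taylor i R e).ground.ports ∧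
      IsLevel i ⟨R, e⟩ (f n).lvl ∧ n.core = (f n).core ∧ shape n.lvl = shape (f n).lvl := by
    intro n hn
    refine ⟨hsub.ports hn, ?_, (hcore n).symm, ?_⟩
    · rcases hcase n hn with ⟨-, -, h1, -⟩ | ⟨-, -, h1⟩
      · rw [h1]; exact hs'
      · rw [h1]; exact isLevel_of_mem (hsub.ports hn)
    · rcases hcase n hn with ⟨-, h0, h1, -⟩ | ⟨-, -, h1⟩
      · rw [h1, h0, hss]
      · rw [h1]
  have hSub : DiffPS.SubstructureAt Q (T.rename f) (taylor i R e) := by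
    refine DiffPS.SubstructureAt.of_target (hsub.isDiffPS.rename f) hsub.exponential ?_ ?_ ?_ ?_ ?_
      ?_ ?_ ?_ ?_
    · refine fun n => hsurj (p := fun n => n ∈ _ → n ∈ _) (fun n hn => ?_) n
      obtain ⟨h1, h2, h3, h4⟩ := hmove n ((hfports n).1 hn)
      exact ports_move h1 h2 h3 h4
    · refine hsurj fun n hn => ?_
      obtain ⟨h1, h2, h3, h4⟩ := hmove n ((hfports n).1 hn)
      rw [label_move h1 h2 h3 h4, ← hsub.label n ((hfports n).1 hn)]
      simp [DiffPS.rename, Ground.rename]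
    · refine hsurj fun w => hsurj fun p => ?_
      rw [show (T.rename f).ground.target (f w) = some (f p) ↔ T.ground.target w = some p from by
        have := Ground.rename_target (G := T.ground) f (p := f w) (q := f p)
        rw [f.symm_apply_apply, f.symm_apply_apply] at this
        exact this, hsub.target_eq_some, hfports, hfports]
      refine and_congr_right fun hw => ?_
      rw [hQf w hw]
      refine and_congr_right fun hwQ => and_congr_right fun hp => ?_
      exact (htarget (hs w hw hwQ) hp).symm
    · refine hsurj fun w => hsurj fun p => fun ht hp hl => ?_
      have hp' : p ∈ T.ground.multiplicative := by
        have := (Ground.mem_rename_multiplicative (G := T.ground) f (p := f p)).1 hp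
        rwa [f.symm_apply_apply] at this
      have hpT := (Ground.mem_multiplicative.1 hp').1
      have hpe := hsub.not_exponential_of_mult hp'
      have hpQ : p ∉ Q := fun hc => hpe (hsub.exponential hc)
      have hps := hs p hpT hpQ
      have hwp := mem_ports_of_taylor_target hR ht
      -- Targets that cross levels are exponential, so a premise of a multiplicative port is at the
      -- same level as this port.
      have hfw : (f w).lvl = s' := by
        rw [← hf1 p hps]
        by_contra hne
        obtain ⟨h1, h2⟩ := (taylor_target_eq_some hR).1 ht
        have h3 := tgtL_cross (ρ := ⟨R, e⟩) hR (isLevel_of_mem h1) h2 (Ne.symm hne)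
        have h4 := Ground.mem_exponential.1 (mem_taylor_exponential h3.1 h3.2)
        obtain ⟨h5, h6, h7, h8⟩ := hmove p hpT
        rw [label_move h5 h6 h7 h8] at h4
        exact hpe (Ground.mem_exponential.2 ⟨h5, h4.2⟩)
      have hw := hf2 _ hfw
      rw [hff] at hw
      have ht' := (htarget hw hpT).1 ht
      have h1 := (left_move (mem_ports_of_taylor_target hR ht') (hfw ▸ hs') (hcore w).symm
        (by rw [hw, hfw, hss])).1 hl
      have h2 := (hsub.left w).2 ⟨h1, p, hp', ht'⟩
      simpa [DiffPS.rename, Ground.rename] using h2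
    · refine hsurj fun w hw => ?_
      have hw' : w ∈ T.ground.left := by simpa [DiffPS.rename, Ground.rename] using hw
      obtain ⟨p, -, hp⟩ := hsub.isDiffPS.isDifferential.left_wire w hw'
      obtain ⟨h1, h2, h3, h4⟩ := hmove w (hsub.isDiffPS.isDifferential.wire w p hp).1
      exact (left_move h1 h2 h3 h4).2 ((hsub.left w).1 hw').1
    · refine hsurj fun n hn => ?_
      obtain ⟨h1, h2, h3, h4⟩ := hmove n ((hfports n).1 hn)
      rw [typ_move h1 h2 h3 h4, ← hsub.typ n ((hfports n).1 hn)]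
      simp [DiffPS.rename, Ground.rename]
    · refine hsurj fun o => ?_
      rw [hbox0, hfports, hsub.boxes0]
      refine and_congr_left fun ho => ?_
      rcases hcase o ho with ⟨-, h1, -, -⟩ | ⟨-, -, h1⟩
      · exact (hboxes h1).symm
      · rw [h1]
    · refine hsurj fun o ho => ?_
      have ho' := (hbox0 o).1 ho
      obtain ⟨h5, h6⟩ := (hsub.boxes0 o).1 ho'
      obtain ⟨h1, h2, h3, h4⟩ := hmove o h6
      rw [box_move hR h5 h2 h3 h4, ← hsub.box o ho']
      simp [DiffPS.rename]
    · refine hsurj fun o ho => ?_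
      have ho' := (hbox0 o).1 ho
      obtain ⟨h5, h6⟩ := (hsub.boxes0 o).1 ho'
      have hos := hs o h6 (h.box_not_mem h5)
      funext r
      ext q
      have hr := DiffPS.rename_door (T := T) f (p := f o) (q := q) (r := r)
      rw [f.symm_apply_apply, hsymm, hsub.door_eq_some] at hr
      rw [hr]
      constructor
      · rintro ⟨-, h7⟩
        have h8 := DiffPS.components.closed hT h6 (h.box_not_mem h5) (coh_box hR h5 h7).symm
        have h9 := hdoor hos h5 h8 h7
        rwa [hff] at h9
      · intro h7
        obtain ⟨r', hr'⟩ := taylor_exists_main hR h5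
        obtain ⟨n₀, h8, rfl, h9⟩ := hdoor' hos h5 h6 h6 (h.box_not_mem h5) (coh_box hR h5 hr') h7
        rw [hff]
        exact ⟨ho', h9⟩
  have hcoh : ∀ a b, a ∈ T.ground.ports → a ∉ Q → b ∈ T.ground.ports →
      (taylor i R e).Coh a b → (taylor i R e).Coh (f a) (f b) := by
    rintro a b ha haQ hb ⟨-, -, h1 | h1 | ⟨o, ho, ⟨r, hr⟩, r', hr'⟩⟩
    · exact coh_of_target hR ((htarget (hs a ha haQ) hb).2 h1)
    · rcases hcase b hb with ⟨-, h2, -, -⟩ | ⟨-, h2, -⟩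
      · exact (coh_of_target hR ((htarget h2 ha).2 h1)).symm
      · have h3 := ((taylor_target_prefix hR h1).trans h2).length_le
        rw [hs a ha haQ] at h3
        omega
    · have h2 := DiffPS.components.closed hT ha haQ (coh_box hR ho hr)
      have h3 := hs o h2 (h.box_not_mem ho)
      exact coh_of_doors hR ((hboxes h3).2 ho) (hdoor h3 ho ha hr) (hdoor h3 ho hb hr')
  refine ⟨fun c hcT => hf3 c (hnet (hc c hcT)).1 (hnet (hc c hcT)).2,
    DiffPS.mem_components.2 ⟨hSub, ?_, ?_, ?_, ?_, ?_⟩, ?_⟩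
  · intro x hx hxQ p hp
    have hx' := (hports x).1 hx
    have h1 := (DiffPS.mem_components.1 hT).2.1 (f x) hx'
      (fun hc => hxQ (by rw [← hQf _ hx', hff] at hc; exact hc)) (f p) ((hports p).1 hp)
    have h2 : Relation.ReflTransGen (DiffPS.Adj (taylor i R e) (T.rename f) Q)
        (f (f x)) (f (f p)) := by
      refine h1.lift f ?_
      rintro a b ⟨ha, haQ, hb, hab⟩
      exact ⟨(hfports a).2 ha, fun hc => haQ ((hQf a ha).1 hc), (hfports b).2 hb,
        hcoh a b ha haQ hb hab⟩
    rwa [hff, hff] at h2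
  · rw [DiffPS.rename_cosize]
    exact (DiffPS.mem_components.1 hT).2.2.1
  · intro c hcT
    have h1 : f c ∈ T.conclusions := by
      have := (Ground.mem_rename_conclusions (G := T.ground) f).1 hcT
      rwa [hsymm] at this
    have h2 := hf3 _ (hnet (hc _ h1)).1 (hnet (hc _ h1)).2
    rw [hff] at h2
    rw [h2]
    exact (DiffPS.mem_components.1 hT).2.2.2.1 h1
  · obtain ⟨x, hx, hxQ⟩ := DiffPS.components.exists_not_mem hT
    exact ⟨f x, (hfports x).2 hx, fun hc => hxQ ((hQf x hx).1 hc)⟩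
  · refine hsurj fun p hp hpQ q hpq => ?_
    have hp := (hfports p).1 hp
    have hpQ : p ∉ Q := fun hc => hpQ ((hQf p hp).2 hc)
    have hps := hs p hp hpQ
    have hfp := hf1 p hps
    rw [hports]
    -- A link of `f p` with something strictly inside `s'` is transported to a link of `p` with
    -- something strictly inside `s`. Such a link is impossible, since `T` is closed and its ports
    -- are at `s` or at prefixes of `t`.
    have hinner : ∀ {l : List (ExpStep α)}, IsLevel i ⟨R, e⟩ l → s' <+: l → l ≠ s' →
        ∃ l₀, IsLevel i ⟨R, e⟩ l₀ ∧ s <+: l₀ ∧ s ≠ l₀ ∧ shape l = shape l₀ := by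
      rintro l hl ⟨v, rfl⟩ hv
      obtain ⟨hl1, hl2⟩ := (isLevel_append _ _ _ _).1 hl
      obtain ⟨v', hv', hsv⟩ := (h.inj.endSt hs0).exists_shape h.one_lt
        (endSt_congr rfl hss.symm) hl2
      refine ⟨s ++ v', (isLevel_append _ _ _ _).2 ⟨hs0, hv'⟩, List.prefix_append _ _, ?_,
        by simp [hss, hsv]⟩
      intro hv0
      have hv0 : v' = [] := by simpa using hv0
      subst hv0
      have := length_eq_of_shape hsv
      simp only [List.length_nil, eq_comm, List.length_eq_zero_iff] at this
      exact hv (by simp [this])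
    obtain ⟨-, -, h1 | h1 | ⟨o, ho, ⟨r, hr⟩, r', hr'⟩⟩ := hpq
    · obtain ⟨q₀, hq₀⟩ := target_move_exists hR h1 (hps ▸ hs0) (hcore p)
        (by rw [hps, hfp, hss])
      have h2 := DiffPS.components.closed hT hp hpQ (coh_of_target hR hq₀)
      have h3 := (htarget hps h2).2 hq₀
      rw [h1] at h3
      rw [Option.some.inj h3, hff]
      exact h2
    · have h2 := taylor_target_prefix hR h1
      rw [hfp] at h2
      have h3 := isLevel_of_mem (mem_ports_of_taylor_target hR h1)
      by_cases hq : q.lvl = s'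
      · have h4 := hf2 q hq
        have h5 : (taylor i R e).ground.target (f (f q)) = some (f p) := by rwa [hff]
        exact DiffPS.components.closed hT hp hpQ (coh_of_target hR ((htarget h4 hp).1 h5)).symm
      · obtain ⟨l₀, h4, h5, h6, h7⟩ := hinner h3 h2 hq
        obtain ⟨q₀, rfl, h8⟩ := exists_of_isLevel h4 q.core
        have h9 := target_move hR h1 h4 h8.symm h7 (hcore p) (hps ▸ h5) (by rw [hps, hfp, hlen])
        have h10 := DiffPS.components.closed hT hp hpQ (coh_of_target hR h9).symm
        rcases hcase q₀ h10 with ⟨-, h11, -, -⟩ | ⟨-, h11, -⟩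
        · exact absurd h11.symm h6
        · have := (h5.trans h11).length_le
          omega
    · have h2 := taylor_door_boxes0 hR ho hr
      rw [hfp] at h2
      have h3 := isLevel_of_mem (taylor_boxes0_ports hR ho)
      by_cases hq : o.lvl = s'
      · have h4 := hf2 o hq
        have h5 : f o ∈ (taylor i R e).boxes0 := (hboxes h4).1 (by rwa [hff])
        have h6 : (taylor i R e).door (f o) r = some p :=
          door_move hR ho hr (h4 ▸ hs0) (hcore o).symm (by rw [hq, h4, hss]) (hcore p)
            (by rw [h4, hps]) (by rw [hps, hfp, hlen])
        have h7 := coh_box hR h5 h6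
        have h8 := DiffPS.components.closed hT hp hpQ h7
        obtain ⟨q₀, h9, rfl, -⟩ := hdoor' h4 h5 h8 hp hpQ h7 (by rwa [hff])
        rw [hff]
        exact h9
      · obtain ⟨l₀, h4, h5, h6, h7⟩ := hinner h3 h2 hq
        obtain ⟨o₀, rfl, h8⟩ := exists_of_isLevel h4 o.core
        have h9 := door_move hR ho hr h4 h8.symm h7 (hcore p) (hps ▸ h5) (by rw [hps, hfp, hlen])
        have h10 := h.level_of_door hT hp hpQ (boxes0_move hR ho h4 h8.symm h7) h9
        exact absurd (hps.symm.trans h10.symm) h6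
  · refine hsurj fun x hx hxQ => ?_
    have hx := (hfports x).1 hx
    exact hf1 x (hs x hx fun hc => hxQ ((hQf x hx).2 hc))

end CriticalSetting

end

end

/-! ### Comparison of two successive partial expansions. -/

section

open PortName ExpState

namespace DiffPS

/-- Components only depend on the ports that they contain or to which they are linked. -/
theorem components.of_agree {N : Type u} {α : Type v} {S S' T : DiffPS N α} {Q Q₀ : Set N} {k : ℕ}
    (h : T ∈ S.components Q Q₀ k) (exponential : Q ⊆ S'.ground.exponential)
    (ports : T.ground.ports ⊆ S'.ground.ports)
    (label : ∀ p ∈ T.ground.ports, S.ground.label p = S'.ground.label p)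
    (typ : ∀ p ∈ T.ground.ports, S.ground.typ p = S'.ground.typ p)
    (left : ∀ p ∈ T.ground.ports, p ∈ S.ground.left ↔ p ∈ S'.ground.left)
    (target : ∀ w ∈ T.ground.ports, S.ground.target w = S'.ground.target w)
    (boxes0 : ∀ o ∈ T.ground.ports, o ∈ S.boxes0 ↔ o ∈ S'.boxes0)
    (box : ∀ o ∈ T.boxes0, S.box o = S'.box o) (door : ∀ o ∈ T.boxes0, S.door o = S'.door o)
    (coh : ∀ p ∈ T.ground.ports, p ∉ Q → ∀ q, S.Coh p q ↔ S'.Coh p q)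
    (coh' : ∀ w p, S'.ground.target w = some p → S'.Coh w p) : T ∈ S'.components Q Q₀ k := by
  obtain ⟨hsub, h1, h2, h3, h4, h5⟩ := mem_components.1 h
  refine mem_components.2 ⟨SubstructureAt.of_target hsub.isDiffPS exponential ports
    (fun p hp => (hsub.label p hp).trans (label p hp)) ?_ ?_ ?_
    (fun p hp => (hsub.typ p hp).trans (typ p hp)) ?_
    (fun o ho => (hsub.box o ho).trans (box o ho))
    (fun o ho => (hsub.door o ho).trans (door o ho)), ?_, h2, h3, h4,
    fun p hp hpQ q hq => h5 p hp hpQ q ((coh p hp hpQ q).2 hq)⟩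
  · intro w p
    rw [hsub.target_eq_some]
    refine and_congr_right fun hw => ?_
    rw [target w hw]
  · intro w p hw hp hl
    have hpT := (Ground.mem_multiplicative.1 hp).1
    have hpQ : p ∉ Q := fun hc => hsub.not_exponential_of_mult hp (hsub.exponential hc)
    have hwT := h5 p hpT hpQ w ((coh p hpT hpQ w).2 (coh' w p hw).symm)
    exact (hsub.left w).2 ⟨(left w hwT).2 hl, p, hp, (target w hwT).trans hw⟩
  · intro w hw
    obtain ⟨p, -, hp⟩ := hsub.isDiffPS.isDifferential.left_wire w hw
    exact (left w (hsub.isDiffPS.isDifferential.wire w p hp).1).1 ((hsub.left w).1 hw).1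
  · intro o
    rw [hsub.boxes0]
    exact and_congr_left fun ho => boxes0 o ho
  · intro x hx hxQ p hp
    refine (h1 x hx hxQ p hp).lift id ?_
    rintro a b ⟨ha, haQ, hb, hab⟩
    exact ⟨ha, haQ, hb, (coh a ha haQ b).1 hab⟩

end DiffPS

section

variable {α : Type u} {k i : ℕ} {R : CircPS α} {e : PseudoExp R}

/-- Both expansions use the same names; the next one loses the ports inside copies of contents of
depth `i`, whose boxes are kept instead. -/
theorem mem_taylor_succ_ports {n : PortName R} : n ∈ (taylor (i + 1) R e).ground.ports ↔
    n ∈ (taylor i R e).ground.ports ∧ IsLevel (i + 1) ⟨R, e⟩ n.lvl := by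
  rw [mem_taylor_ports, mem_taylor_ports]
  constructor
  · rintro ⟨h1, h2⟩
    exact ⟨⟨h1.mono (Nat.le_succ i), h2⟩, h1⟩
  · rintro ⟨⟨-, h2⟩, h1⟩
    exact ⟨h1, h2⟩

theorem taylor_succ_target_eq_some (hR : R.IsCircPS) {w n : PortName R} :
    (taylor (i + 1) R e).ground.target w = some n ↔ IsLevel (i + 1) ⟨R, e⟩ w.lvl ∧
      (taylor i R e).ground.target w = some n := by
  rw [taylor_target_eq_some hR, taylor_target_eq_some hR, mem_taylor_succ_ports]
  tauto

theorem taylor_succ_target (hR : R.IsCircPS) {w : PortName R}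
    (hw : w ∈ (taylor (i + 1) R e).ground.ports) :
    (taylor (i + 1) R e).ground.target w = (taylor i R e).ground.target w := by
  ext n
  rw [taylor_succ_target_eq_some hR, and_iff_right (mem_taylor_succ_ports.1 hw).2]

theorem mem_taylor_succ_boxes0 (hR : R.IsCircPS) {o : PortName R} :
    o ∈ (taylor (i + 1) R e).boxes0 ↔ o ∈ (taylor (i + 1) R e).ground.ports ∧
      (o ∈ (taylor i R e).boxes0 ∨ o.core ∈ (endSt ⟨R, e⟩ o.lvl).1.boxes0 ∧
        ((endSt ⟨R, e⟩ o.lvl).1.content o.core).depth = i) := by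
  rw [mem_taylor_boxes0 hR, mem_taylor_boxes0 hR, Nat.lt_succ_iff_lt_or_eq]
  have := mem_taylor_succ_ports (i := i) (n := o) (e := e)
  tauto

theorem taylor_succ_door (hR : R.IsCircPS) {o : PortName R} (ho : o ∈ (taylor i R e).boxes0)
    (ho' : o ∈ (taylor (i + 1) R e).boxes0) :
    (taylor (i + 1) R e).door o = (taylor i R e).door o := by
  funext r
  ext n
  rw [taylor_door_eq_some hR ho, taylor_door_eq_some hR ho']

theorem depth_of_not_isLevel_succ {ρ : ExpState α} {l : List (ExpStep α)} (h : IsLevel i ρ l)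
    (h' : ¬ IsLevel (i + 1) ρ l) : (endSt ρ l).1.depth = i := by
  refine le_antisymm ?_ (h.depth_end ?_)
  · by_contra hc
    exact h' (h.of_depth (by omega))
  · rintro rfl
    exact h' trivial

namespace CriticalSetting

variable {Q Q₀ : Set (PortName R)}

theorem succ_exponential (h : CriticalSetting k i R e Q) :
    Q ⊆ (taylor (i + 1) R e).ground.exponential := by
  intro n hn
  obtain ⟨h1, h2⟩ := IsCritical.aux (ρ := ⟨R, e⟩) h.isCircPS ((h.mem_iff n).1 hn)
  exact mem_taylor_exponential h1 h2

theorem exponential (h : CriticalSetting k i R e Q) : Q ⊆ (taylor i R e).ground.exponential := by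
  intro n hn
  obtain ⟨h1, h2⟩ := IsCritical.aux (ρ := ⟨R, e⟩) h.isCircPS ((h.mem_iff n).1 hn)
  exact mem_taylor_exponential ⟨h1.1.mono (Nat.le_succ i), h1.2⟩ h2

/-- A box that is kept only in the next expansion has a content of depth exactly `i`, so all its
doors are critical. -/
theorem door_mem (h : CriticalSetting k i R e Q) {o n : PortName R} {r : α}
    (ho : o ∈ (taylor (i + 1) R e).boxes0) (hoi : o ∉ (taylor i R e).boxes0)
    (hr : (taylor (i + 1) R e).door o r = some n) : n ∈ Q := by
  have h1 := (taylor_door_eq_some h.isCircPS ho r).1 hr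
  obtain ⟨h2, h3⟩ := (mem_taylor_succ_boxes0 h.isCircPS).1 ho
  rw [h.mem_iff]
  exact IsCritical.of_doorL (ρ := ⟨R, e⟩) h.one_lt h.inj h.isCircPS
    (isLevel_of_mem (mem_taylor_succ_ports.1 h2).1) (h3.resolve_left hoi).2 h1

/-- Outside of the critical ports, the links are the same in two successive partial
expansions. -/
theorem coh_iff (h : CriticalSetting k i R e Q) {p q : PortName R}
    (hp : p ∈ (taylor (i + 1) R e).ground.ports) (hpQ : p ∉ Q) :
    (taylor i R e).Coh p q ↔ (taylor (i + 1) R e).Coh p q := by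
  have hR := h.isCircPS
  have hpl := (mem_taylor_succ_ports.1 hp).2
  -- A source that is lost in the next expansion lies in a copy of a content of depth `i`; reaching
  -- `p` from there would make `p` critical.
  have hlevel : ∀ {w : PortName R}, w ∈ (taylor i R e).ground.ports →
      contrib i ⟨R, e⟩ w.lvl p.pos ≠ 0 → IsLevel (i + 1) ⟨R, e⟩ w.lvl := by
    intro w hw hc
    by_contra hl
    refine hpQ ((h.mem_iff p).2 (IsCritical.of_contrib (isLevel_of_mem hw)
      (depth_of_not_isLevel_succ (isLevel_of_mem hw) hl) ?_ hc))
    intro heq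
    exact hl (heq ▸ hpl)
  constructor
  · rintro ⟨-, -, h1 | h1 | ⟨o, ho, ⟨r, hr⟩, r', hr'⟩⟩
    · exact coh_of_target hR ((taylor_succ_target_eq_some hR).2 ⟨hpl, h1⟩)
    · obtain ⟨h2, h3⟩ := (taylor_target_eq_some hR).1 h1
      have h4 := hlevel h2 (contrib_ne_zero_of_tgtL (mem_taylor_ports.1 h2) h3)
      exact (coh_of_target hR ((taylor_succ_target_eq_some hR).2 ⟨h4, h1⟩)).symm
    · have h2 := taylor_boxes0_ports hR ho
      have h3 := hlevel h2 (contrib_ne_zero_of_doorL hR (isLevel_of_mem h2)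
        ((mem_taylor_boxes0 hR).1 ho).2.2 ((taylor_door_eq_some hR ho r).1 hr))
      have ho' := (mem_taylor_succ_boxes0 hR).2 ⟨mem_taylor_succ_ports.2 ⟨h2, h3⟩, Or.inl ho⟩
      rw [← taylor_succ_door hR ho ho'] at hr hr'
      exact coh_of_doors hR ho' hr hr'
  · rintro ⟨-, -, h1 | h1 | ⟨o, ho, ⟨r, hr⟩, r', hr'⟩⟩
    · exact coh_of_target hR ((taylor_succ_target_eq_some hR).1 h1).2
    · exact (coh_of_target hR ((taylor_succ_target_eq_some hR).1 h1).2).symm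
    · have ho' : o ∈ (taylor i R e).boxes0 := by
        by_contra hc
        exact hpQ (h.door_mem ho hc hr)
      rw [taylor_succ_door hR ho' ho] at hr hr'
      exact coh_of_doors hR ho' hr hr'

variable {T T' : DiffPS (PortName R) α}

/-- The components that are common to two successive partial expansions. -/
theorem mem_components_iff (h : CriticalSetting k i R e Q)
    (hports : T.ground.ports ⊆ (taylor (i + 1) R e).ground.ports)
    (hboxes : ∀ o ∈ T.ground.ports, o ∈ (taylor (i + 1) R e).boxes0 → o ∈ (taylor i R e).boxes0) :
    T ∈ (taylor i R e).components Q Q₀ k ↔ T ∈ (taylor (i + 1) R e).components Q Q₀ k := by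
  have hR := h.isCircPS
  have hports' : ∀ n ∈ T.ground.ports, n ∈ (taylor i R e).ground.ports :=
    fun n hn => (mem_taylor_succ_ports.1 (hports hn)).1
  have hlabel : ∀ p ∈ T.ground.ports,
      (taylor i R e).ground.label p = (taylor (i + 1) R e).ground.label p := fun p hp => by
    rw [taylor_label (hports hp), taylor_label (hports' p hp)]
  have htyp : ∀ p ∈ T.ground.ports,
      (taylor i R e).ground.typ p = (taylor (i + 1) R e).ground.typ p := fun p hp => by
    rw [taylor_typ (hports hp), taylor_typ (hports' p hp)]
  have hleft : ∀ p ∈ T.ground.ports,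
      p ∈ (taylor i R e).ground.left ↔ p ∈ (taylor (i + 1) R e).ground.left := fun p hp => by
    rw [taylor_left (hports hp), taylor_left (hports' p hp)]
  have hbox0 : ∀ o ∈ T.ground.ports,
      o ∈ (taylor i R e).boxes0 ↔ o ∈ (taylor (i + 1) R e).boxes0 := fun o ho =>
    ⟨fun ho' => (mem_taylor_succ_boxes0 hR).2 ⟨hports ho, Or.inl ho'⟩, hboxes o ho⟩
  have hbox : ∀ o ∈ T.ground.ports, o ∈ (taylor i R e).boxes0 →
      (taylor i R e).box o = (taylor (i + 1) R e).box o := fun o ho ho' => by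
    rw [taylor_box hR ho', taylor_box hR ((hbox0 o ho).1 ho')]
  have hdoor : ∀ o ∈ T.ground.ports, o ∈ (taylor i R e).boxes0 →
      (taylor i R e).door o = (taylor (i + 1) R e).door o := fun o ho ho' =>
    (taylor_succ_door hR ho' ((hbox0 o ho).1 ho')).symm
  constructor
  · intro hT
    have hb := (DiffPS.components.sub hT).boxes0
    exact DiffPS.components.of_agree hT h.succ_exponential hports hlabel htyp hleft
      (fun w hw => (taylor_succ_target hR (hports hw)).symm) hbox0
      (fun o ho => hbox o ((hb o).1 ho).2 ((hb o).1 ho).1)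
      (fun o ho => hdoor o ((hb o).1 ho).2 ((hb o).1 ho).1)
      (fun p hp hpQ q => h.coh_iff (hports hp) hpQ) fun w p hw => coh_of_target hR hw
  · intro hT
    have hb := (DiffPS.components.sub hT).boxes0
    have hb' : ∀ o ∈ T.boxes0, o ∈ T.ground.ports ∧ o ∈ (taylor i R e).boxes0 := fun o ho =>
      ⟨((hb o).1 ho).2, (hbox0 o ((hb o).1 ho).2).2 ((hb o).1 ho).1⟩
    exact DiffPS.components.of_agree hT h.exponential hports' (fun p hp => (hlabel p hp).symm)
      (fun p hp => (htyp p hp).symm) (fun p hp => (hleft p hp).symm)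
      (fun w hw => taylor_succ_target hR (hports hw)) (fun o ho => (hbox0 o ho).symm)
      (fun o ho => (hbox o (hb' o ho).1 (hb' o ho).2).symm)
      (fun o ho => (hdoor o (hb' o ho).1 (hb' o ho).2).symm)
      (fun p hp hpQ q => (h.coh_iff (hports hp) hpQ).symm) fun w p hw => coh_of_target hR hw

/-- The components of the next partial expansion that are equivalent to a component. -/
theorem mem_of_mem_succ (h : CriticalSetting k i R e Q)
    (hT : T ∈ (taylor i R e).components Q Q₀ k)
    (hT' : T' ∈ (taylor (i + 1) R e).components Q Q₀ k) (hTT : T.Equivalent T') :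
    T' ∈ (taylor i R e).components Q Q₀ k := by
  have hsub := DiffPS.components.sub hT
  have hsub' := DiffPS.components.sub hT'
  refine (h.mem_components_iff hsub'.ports fun o ho ho' => ?_).2 hT'
  -- A new box of `T'` is a critical port, hence a conclusion of `T'`. Conclusions and their being
  -- boxes are preserved by equivalence, so it would be a box of `T`, thus kept in the expansion for
  -- `i`.
  by_contra hc
  obtain ⟨r, hr⟩ := taylor_exists_main h.isCircPS ho'
  have h1 := DiffPS.components.conclusion_of_mem hT' ho (h.door_mem ho' hc hr)
  rw [hTT.conclusions_eq] at h1
  have h2 := (hTT.mem_boxes0_iff hsub.isDiffPS h1).1 ((hsub'.boxes0 o).2 ⟨ho', ho⟩)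
  exact hc ((hsub.boxes0 o).1 h2).1

/-- A component all of whose critical ports have a premise is a component of the next partial
expansion if its level belongs to it. -/
theorem mem_succ_of_level (h : CriticalSetting k i R e Q)
    (hT : T ∈ (taylor i R e).components Q Q₀ k) {s : List (ExpStep α)} (hs : HasLevel Q T s)
    (hs' : IsLevel (i + 1) ⟨R, e⟩ s) (hin : ∀ c ∈ T.conclusions, T.HasInput c) :
    T ∈ (taylor (i + 1) R e).components Q Q₀ k := by
  have hR := h.isCircPS
  have hsub := DiffPS.components.sub hT
  refine (h.mem_components_iff (fun n hn => mem_taylor_succ_ports.2 ⟨hsub.ports hn, ?_⟩)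
    fun o ho ho' => ?_).1 hT
  · by_cases hnQ : n ∈ Q
    · exact (IsCritical.aux (ρ := ⟨R, e⟩) hR ((h.mem_iff n).1 hnQ)).1.1
    · exact hs n hn hnQ ▸ hs'
  -- A new box of `T` would be a conclusion, hence have an input. This input comes from a copy of
  -- its own content, of depth `i`, which the level `s` forbids, or from the box itself, which is
  -- not kept for `i`.
  · by_contra hc
    obtain ⟨r, hr⟩ := taylor_exists_main hR ho'
    have h1 := hin o (DiffPS.components.conclusion_of_mem hT ho (h.door_mem ho' hc hr))
    obtain ⟨h2, h3⟩ := (mem_taylor_succ_boxes0 hR).1 ho'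
    have h3 := h3.resolve_left hc
    have hb := h3.1
    rw [((isLevel_of_mem h2).isCircPS hR).boxes0_eq] at hb
    obtain ⟨w, hw, hwQ, h4 | ⟨h4, r', h5⟩⟩ := h.exists_input hT h1
    · obtain ⟨h6, h7⟩ := (taylor_target_eq_some hR).1 h4
      obtain ⟨x, h8, h9⟩ := tgtL_bang (ρ := ⟨R, e⟩) hR (isLevel_of_mem h6) h7 hb
      rw [← hs w hw hwQ, h8] at hs'
      have h10 := (isLevel_snoc.1 hs').2
      have h11 := child_depth h10
      rw [child_content h10, h9, h3.2] at h11
      omega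
    · have h6 := (taylor_door_eq_some hR h4 r').1 h5
      obtain ⟨h7, h8⟩ := doorL_bang (ρ := ⟨R, e⟩) hR
        (isLevel_of_mem (taylor_boxes0_ports hR h4)) h6 hb
      exact hc (ext_lvl_core h7 h8.symm ▸ h4)

end CriticalSetting

end

end

/-! ### Components inside `R` and the decomposition of the cardinals by levels. -/

section

open PortName ExpState

theorem Set.ncard_eq_sum_fibers {ι β : Type*} {A : Set β} (hA : A.Finite) (I : Finset ι)
    (P : β → ι → Prop) (h : ∀ a ∈ A, ∃ s ∈ I, P a s)
    (huniq : ∀ a ∈ A, ∀ s s', P a s → P a s' → s = s') :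
    A.ncard = ∑ s ∈ I, {a | a ∈ A ∧ P a s}.ncard := by
  have h0 : ∀ a ∈ A, ∃ s, s ∈ I ∧ P a s := h
  rcases A.eq_empty_or_nonempty with rfl | ⟨a₀, ha₀⟩
  · simp
  obtain ⟨s₀, -⟩ := h0 a₀ ha₀
  have : Nonempty ι := ⟨s₀⟩
  choose! g hg1 hg2 using h0
  rw [Set.ncard_eq_toFinset_card A hA, Finset.card_eq_sum_card_fiberwise (f := g) (t := I)]
  · refine Finset.sum_congr rfl fun s _ => ?_
    rw [← Set.ncard_coe_finset]
    congr 1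
    ext a
    simp only [Finset.coe_filter, Set.Finite.mem_toFinset, Set.mem_ofPred_eq]
    refine and_congr_right fun ha => ⟨?_, fun hP => huniq a ha _ _ (hg2 a ha) hP⟩
    rintro rfl
    exact hg2 a ha
  · intro a ha
    exact hg1 a ((Set.Finite.mem_toFinset hA).1 ha)

namespace DiffPS

variable {N : Type u} {α : Type v} {T T' : DiffPS N α}

/-- Having all its `!`-ports as boxes is what a component must satisfy, besides lying at level `[]`,
in order to be a substructure of `R`; this property is invariant under equivalence. -/
theorem Equivalent.boxes0_of_bang (h : T.Equivalent T')
    (hT : ∀ o ∈ T.ground.ports, T.ground.label o = some .bang → o ∈ T.boxes0) :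
    ∀ o ∈ T'.ground.ports, T'.ground.label o = some .bang → o ∈ T'.boxes0 := by
  obtain ⟨f, hf, -⟩ := h
  intro o ho hl
  obtain ⟨o, ho', rfl⟩ := hf.ground.bij.surjOn ho
  rw [hf.ground.label o ho'] at hl
  rw [← Finset.mem_coe, ← hf.boxes0]
  exact ⟨o, hT o ho' hl, rfl⟩

theorem Equivalent.boxes0_of_bang' (h : T.Equivalent T') (hT₀ : T.IsDiffPS)
    (hT : ∀ o ∈ T'.ground.ports, T'.ground.label o = some .bang → o ∈ T'.boxes0) :
    ∀ o ∈ T.ground.ports, T.ground.label o = some .bang → o ∈ T.boxes0 := by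
  obtain ⟨f, hf, -⟩ := h
  intro o ho hl
  have h1 := hT (f o) (hf.ground.bij.mapsTo ho) (by rw [hf.ground.label o ho, hl])
  rw [← Finset.mem_coe, ← hf.boxes0] at h1
  obtain ⟨o', h2, h3⟩ := h1
  have h4 := (Ground.mem_portsOf.1 (hT₀.boxes0_bang o' h2).1).1
  exact hf.ground.bij.injOn h4 ho h3 ▸ h2

end DiffPS

section

variable {α : Type u} {k i : ℕ} {R : CircPS α} {e : PseudoExp R} {Q Q₀ : Set (PortName R)}
  {T T' : DiffPS (PortName R) α}

theorem eq_base {n : PortName R} (h : n.lvl = []) : n = base n.core := ext_lvl_core h rfl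

theorem DiffPS.Substructure.lvl_eq (h : T.Substructure R.toDiffPS) {n : PortName R}
    (hn : n ∈ T.ground.ports) : n.lvl = [] := by
  obtain ⟨Q', h⟩ := h
  obtain ⟨p, -, rfl⟩ := Finset.mem_image.1 (h.ports hn)
  rfl

theorem CircPS.mem_toDiffPS_boxes0 {n : PortName R} :
    n ∈ R.toDiffPS.boxes0 ↔ n.lvl = [] ∧ n.core ∈ R.boxes0 := by
  constructor
  · intro hn
    obtain ⟨p, hp, rfl⟩ := Finset.mem_image.1 hn
    exact ⟨rfl, hp⟩
  · rintro ⟨h1, h2⟩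
    exact Finset.mem_image.2 ⟨n.core, h2, (eq_base h1).symm⟩

theorem DiffPS.Substructure.boxes0_of_bang (h : T.Substructure R.toDiffPS) (hR : R.IsCircPS) :
    ∀ o ∈ T.ground.ports, T.ground.label o = some .bang → o ∈ T.boxes0 := by
  intro o ho hl
  have h0 := h.lvl_eq ho
  obtain ⟨Q', h⟩ := h
  refine (h.boxes0 o).2 ⟨CircPS.mem_toDiffPS_boxes0.2 ⟨h0, ?_⟩, ho⟩
  rw [h.label o ho] at hl
  have h1 := h.ports ho
  obtain ⟨p, hp, rfl⟩ := Finset.mem_image.1 h1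
  rw [hR.boxes0_eq]
  exact Ground.mem_portsOf.2 ⟨hp, hl⟩

/-- A substructure of a partial expansion that is at depth `0`. -/
theorem substructure_of_lvl (hR : R.IsCircPS) (h : DiffPS.SubstructureAt Q T (taylor i R e))
    (hlvl : ∀ n ∈ T.ground.ports, n.lvl = [])
    (hbang : ∀ o ∈ T.ground.ports, T.ground.label o = some .bang → o ∈ T.boxes0) :
    T.Substructure R.toDiffPS := by
  have hlabel : ∀ p, (taylor i R e).ground.label (base p) = R.toDiffPS.ground.label (base p) := by
    intro p; rw [taylor_eq]; rfl
  have htyp : ∀ p, (taylor i R e).ground.typ (base p) = R.toDiffPS.ground.typ (base p) := by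
    intro p; rw [taylor_eq]; rfl
  have htarget : ∀ p, (taylor i R e).ground.target (base p) =
      R.toDiffPS.ground.target (base p) := by
    intro p; rw [taylor_eq]; rfl
  have hleft : ∀ p, base p ∈ (taylor i R e).ground.left ↔ base p ∈ R.toDiffPS.ground.left := by
    intro p
    rw [taylor_eq]
    simp [expand, CircPS.toDiffPS]
  have hports : ∀ p, base p ∈ (taylor i R e).ground.ports ↔ base p ∈ R.toDiffPS.ground.ports := by
    intro p
    rw [mem_taylor_ports]
    simp [CircPS.toDiffPS]
  have key : ∀ {P : PortName R → Prop}, (∀ p, base p ∈ T.ground.ports → P (base p)) →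
      ∀ n ∈ T.ground.ports, P n := fun hP n hn => by
    have := eq_base (hlvl n hn)
    rw [this] at hn ⊢
    exact hP _ hn
  refine ⟨{n | n ∈ Q ∧ n ∈ T.ground.ports}, .of_target h.isDiffPS ?_
    (key fun p hp => (hports p).1 (h.ports hp)) (key fun p hp => (h.label _ hp).trans (hlabel p))
    ?_ ?_ ?_ (key fun p hp => (h.typ _ hp).trans (htyp p)) ?_ ?_ ?_⟩
  · rintro n ⟨hnQ, hn⟩
    have h1 := Ground.mem_exponential.1 (h.exponential hnQ)
    rw [eq_base (hlvl n hn), hports, hlabel] at h1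
    rw [eq_base (hlvl n hn)]
    exact Ground.mem_exponential.2 h1
  · intro w p
    rw [h.target_eq_some]
    refine and_congr_right fun hw => ?_
    rw [eq_base (hlvl w hw), htarget, ← eq_base (hlvl w hw)]
    simp [hw]
  · intro w p hwp hp hw
    have hw' := hw
    obtain ⟨w, -, rfl⟩ := hw'
    exact (h.left _).2 ⟨(hleft w).2 hw, p, hp, (htarget w).trans hwp⟩
  · intro w hw
    obtain ⟨p, -, hp⟩ := h.isDiffPS.isDifferential.left_wire w hw
    have hwT := (h.isDiffPS.isDifferential.wire w p hp).1
    have h1 := ((h.left w).1 hw).1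
    rw [eq_base (hlvl w hwT)] at h1 ⊢
    exact (hleft _).1 h1
  · intro o
    constructor
    · intro ho
      obtain ⟨h1, h2⟩ := (h.boxes0 o).1 ho
      have h3 := ((mem_taylor_boxes0 hR).1 h1).2.1
      rw [hlvl o h2] at h3
      exact ⟨CircPS.mem_toDiffPS_boxes0.2 ⟨hlvl o h2, h3⟩, h2⟩
    · rintro ⟨h1, h2⟩
      refine hbang o h2 ?_
      have h3 := (CircPS.mem_toDiffPS_boxes0.1 h1).2
      rw [hR.boxes0_eq] at h3
      rw [h.label o h2, eq_base (hlvl o h2), hlabel]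
      exact (Ground.mem_portsOf.1 h3).2
  · intro o ho
    obtain ⟨h1, h2⟩ := (h.boxes0 o).1 ho
    rw [h.box o ho]
    have h3 := ((mem_taylor_boxes0 hR).1 h1).2
    rw [hlvl o h2] at h3
    rw [eq_base (hlvl o h2), taylor_eq]
    simp only [endSt_nil] at h3
    rw [R.content_of_mem h3.1] at h3
    simp [expand, CircPS.toDiffPS, asBase, h3.1, h3.2]
  · intro o ho
    obtain ⟨h1, h2⟩ := (h.boxes0 o).1 ho
    rw [h.door o ho]
    have h3 := ((mem_taylor_boxes0 hR).1 h1).2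
    rw [hlvl o h2] at h3
    rw [eq_base (hlvl o h2), taylor_eq]
    simp only [endSt_nil] at h3
    rw [R.content_of_mem h3.1] at h3
    funext r
    simp [expand, CircPS.toDiffPS, asBase, h3.1, h3.2]

namespace CriticalSetting

/-- All `!`-ports of `T` are boxes already kept for `i`, so no new box can occur among its ports. -/
theorem mem_succ_of_substructure (h : CriticalSetting k i R e Q)
    (hT : T ∈ (taylor i R e).components Q Q₀ k) (hTR : T.Substructure R.toDiffPS) :
    T ∈ (taylor (i + 1) R e).components Q Q₀ k := by
  have hsub := DiffPS.components.sub hT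
  refine (h.mem_components_iff (fun n hn => mem_taylor_succ_ports.2 ⟨hsub.ports hn, ?_⟩)
    fun o ho ho' => ?_).1 hT
  · rw [hTR.lvl_eq hn]; trivial
  · have h1 := ((mem_taylor_boxes0 h.isCircPS).1 ho').2.1
    rw [((isLevel_of_mem (hsub.ports ho)).isCircPS h.isCircPS).boxes0_eq] at h1
    have h2 := (Ground.mem_portsOf.1 h1).2
    rw [← taylor_label (hsub.ports ho), ← hsub.label o ho] at h2
    exact ((hsub.boxes0 o).1 (hTR.boxes0_of_bang h.isCircPS o ho h2)).1

/-- The components at the level `s` that are equivalent to `T`. -/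
def levelClass (k i : ℕ) (e : PseudoExp R) (Q Q₀ : Set (PortName R)) (T : DiffPS (PortName R) α)
    (s : List (ExpStep α)) : Set (DiffPS (PortName R) α) :=
  {T' | (T' ∈ (taylor i R e).components Q Q₀ k ∧ T.Equivalent T') ∧ HasLevel Q T' s}

theorem levelClass_finite (s : List (ExpStep α)) : (levelClass k i e Q Q₀ T s).Finite :=
  DiffPS.components_finite.subset fun _ h => h.1.1

theorem ncard_eq_sum (h : CriticalSetting k i R e Q) :
    {T' | T' ∈ (taylor i R e).components Q Q₀ k ∧ T.Equivalent T'}.ncard =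
      ∑ s ∈ levels i ⟨R, e⟩, (levelClass k i e Q Q₀ T s).ncard := by
  refine Set.ncard_eq_sum_fibers (DiffPS.components_finite.subset fun _ h => h.1) _
    (fun T' s => HasLevel Q T' s) ?_ ?_
  · rintro T' ⟨hT', -⟩
    obtain ⟨s, h1, h2⟩ := h.exists_level hT'
    exact ⟨s, mem_levels.2 h1, h2⟩
  · rintro T' ⟨hT', -⟩ s s' hs hs'
    exact hs.unique hT' hs'

/-- The summands are those of `ncard_eq_sum`, defined in the expansion for `i`; only the index set
shrinks. -/
theorem ncard_succ_eq_sum (h : CriticalSetting k i R e Q)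
    (hT : T ∈ (taylor i R e).components Q Q₀ k) (hin : ∀ c ∈ T.conclusions, T.HasInput c) :
    {T' | T' ∈ (taylor (i + 1) R e).components Q Q₀ k ∧ T.Equivalent T'}.ncard =
      ∑ s ∈ levels (i + 1) ⟨R, e⟩, (levelClass k i e Q Q₀ T s).ncard := by
  rw [Set.ncard_eq_sum_fibers (A := {T' | T' ∈ (taylor (i + 1) R e).components Q Q₀ k ∧
    T.Equivalent T'}) (DiffPS.components_finite.subset fun _ h => h.1) (levels (i + 1) ⟨R, e⟩)
    (fun T' s => HasLevel Q T' s)]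
  · refine Finset.sum_congr rfl fun s hs => ?_
    congr 1
    ext T'
    constructor
    · rintro ⟨⟨h1, h2⟩, h3⟩
      exact ⟨⟨h.mem_of_mem_succ hT h1 h2, h2⟩, h3⟩
    · rintro ⟨⟨h1, h2⟩, h3⟩
      refine ⟨⟨h.mem_succ_of_level h1 h3 (mem_levels.1 hs) fun c hc => ?_, h2⟩, h3⟩
      rw [h2.conclusions_eq] at hc
      exact (h2.hasInput_iff (DiffPS.components.sub hT).isDiffPS
        (DiffPS.components.sub h1).isDiffPS hc).2 (hin c hc)
  · rintro T' ⟨hT', h2⟩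
    have h1 := h.mem_of_mem_succ hT hT' h2
    obtain ⟨s, -, h3⟩ := h.exists_level h1
    obtain ⟨x, hx, hxQ⟩ := DiffPS.components.exists_not_mem hT'
    exact ⟨s, mem_levels.2 (h3 x hx hxQ ▸ isLevel_of_mem
      ((DiffPS.components.sub hT').ports hx)), h3⟩
  · rintro T' ⟨hT', h2⟩ s s' hs hs'
    exact hs.unique (h.mem_of_mem_succ hT hT' h2) hs'

/-- Exchanging the copies `s` and `s'` is injective on components and fixes the conclusions. Used in
both directions, this makes the size of the class a function of the shape. -/
theorem ncard_levelClass_le (h : CriticalSetting k i R e Q) {s s' t : List (ExpStep α)}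
    (hs : IsLevel i ⟨R, e⟩ s) (hs' : IsLevel i ⟨R, e⟩ s') (hss : shape s = shape s')
    (hc : ∀ c ∈ T.conclusions, c.lvl <+: t) (hts : t <+: s) (hts' : t <+: s') :
    (levelClass k i e Q Q₀ T s).ncard ≤ (levelClass k i e Q Q₀ T s').ncard := by
  by_cases hne : s = s'
  · rw [hne]
  obtain ⟨f, hf⟩ := exists_isSwap hs hs'
  refine Set.ncard_le_ncard_of_injOn (fun T' => T'.rename f) ?_ ?_ (levelClass_finite s')
  · rintro T' ⟨⟨h1, h2⟩, h3⟩
    obtain ⟨h4, h5, h6⟩ := h.rename_mem h1 hf h3 hs hs' hss hne (t := t)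
      (by rwa [h2.conclusions_eq]) hts hts'
    rw [h2.conclusions_eq] at h4
    exact ⟨⟨h5, h2.rename f h4⟩, h6⟩
  · intro T₁ h₁ T₂ h₂ heq
    refine (DiffPS.components.sub h₁.1.1).eq_of_ports (DiffPS.components.sub h₂.1.1) ?_
    exact Finset.map_injective f.toEmbedding (congrArg (fun T' => T'.ground.ports) heq)

end CriticalSetting

end

end

/-! ### Digits of the cardinals and the theorem. -/

section

open PortName ExpState

section

variable {α : Type u} {k i : ℕ} {R : CircPS α} {e : PseudoExp R} {Q Q₀ : Set (PortName R)}
  {T T' : DiffPS (PortName R) α}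

namespace CriticalSetting

/-- There is a copy that contains the conclusions of all the components equivalent to `T`. -/
theorem exists_root (h : CriticalSetting k i R e Q)
    (hT : T ∈ (taylor i R e).components Q Q₀ k)
    (hin : ∀ c ∈ T.conclusions, c ∈ Q ∧ T.HasInput c) : ∃ t, IsLevel (i + 1) ⟨R, e⟩ t ∧
      (∃ c ∈ T.conclusions, c.lvl = t) ∧ (∀ c ∈ T.conclusions, c.lvl <+: t) ∧
      ∀ l, levelClass k i e Q Q₀ T l ≠ ∅ → t <+: l := by
  have hprefix : ∀ {T'}, T' ∈ (taylor i R e).components Q Q₀ k → T.Equivalent T' → ∀ {s},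
      HasLevel Q T' s → ∀ c ∈ T.conclusions, c.lvl <+: s := by
    intro T' h1 h2 s h3 c hc
    exact h.prefix_of_input h1 h3 ((h2.hasInput_iff (DiffPS.components.sub hT).isDiffPS
      (DiffPS.components.sub h1).isDiffPS hc).2 (hin c hc).2)
  -- Having inputs, all conclusions lie at prefixes of the level of `T`, so their levels are nested
  -- and the longest one is the root.
  obtain ⟨c, hc, hmax⟩ := Finset.exists_max_image T.conclusions (fun c => c.lvl.length)
    (DiffPS.components.conclusions_nonempty hT)
  obtain ⟨s, -, hs⟩ := h.exists_level hT
  have hs' : ∀ c ∈ T.conclusions, c.lvl <+: s := fun c hc =>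
    h.prefix_of_input hT hs (hin c hc).2
  refine ⟨c.lvl, ((h.mem_iff c).1 (hin c hc).1).isLevel_succ, ⟨c, hc, rfl⟩, fun c' hc' =>
    List.prefix_of_prefix_length_le (hs' c' hc') (hs' c hc) (hmax c' hc'), ?_⟩
  intro l hl
  obtain ⟨T', ⟨h1, h2⟩, h3⟩ := Set.nonempty_iff_ne_empty.2 hl
  exact hprefix h1 h2 h3 c hc

/-- Equivalent components have the same conclusions. A noncritical conclusion belongs to at most one
component, and a critical one without input determines the component through its target. -/
theorem eq_of_equivalent_of_not_input (h : CriticalSetting k i R e Q)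
    (hT : T ∈ (taylor i R e).components Q Q₀ k)
    (hin : ¬ ∀ c ∈ T.conclusions, c ∈ Q ∧ T.HasInput c) {T₁ T₂ : DiffPS (PortName R) α}
    (h₁ : T₁ ∈ (taylor i R e).components Q Q₀ k) (hT₁ : T.Equivalent T₁)
    (h₂ : T₂ ∈ (taylor i R e).components Q Q₀ k) (hT₂ : T.Equivalent T₂) : T₁ = T₂ := by
  push Not at hin
  obtain ⟨c, hc, hc'⟩ := hin
  have h1 := hc
  have h2 := hc
  rw [← hT₁.conclusions_eq] at h1
  rw [← hT₂.conclusions_eq] at h2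
  refine h.eq_of_not_input h₁ h₂ (Ground.mem_conclusions.1 h1).1 (Ground.mem_conclusions.1 h2).1 ?_
  by_cases hcQ : c ∈ Q
  · have h0 := (DiffPS.components.sub hT).isDiffPS
    rw [hT₁.hasInput_iff h0 (DiffPS.components.sub h₁).isDiffPS hc,
      hT₂.hasInput_iff h0 (DiffPS.components.sub h₂).isDiffPS hc]
    exact Or.inr ⟨hc' hcQ, hc' hcQ⟩
  · exact Or.inl hcQ

/-- The critical ports are conclusions, shared with `T₀` and hence at level `[]`; the property that
all `!`-ports are boxes is also inherited from `T₀`. -/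
theorem levelClass_nil (h : CriticalSetting k i R e Q)
    (hT : T ∈ (taylor i R e).components Q Q₀ k) {T₀ : DiffPS (PortName R) α}
    (hT₀ : T.Equivalent T₀) (hT₀R : T₀.Substructure R.toDiffPS) :
    levelClass k i e Q Q₀ T [] = {T' | (T' ∈ (taylor i R e).components Q Q₀ k ∧
      T.Equivalent T') ∧ T'.Substructure R.toDiffPS} := by
  ext T'
  refine and_congr_right fun ⟨h1, h2⟩ => ⟨fun hs => ?_, fun hs x hx _ => hs.lvl_eq hx⟩
  refine substructure_of_lvl h.isCircPS (DiffPS.components.sub h1) (fun n hn => ?_) ?_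
  · by_cases hnQ : n ∈ Q
    · have h3 := DiffPS.components.conclusion_of_mem h1 hn hnQ
      rw [h2.conclusions_eq, ← hT₀.conclusions_eq] at h3
      exact hT₀R.lvl_eq (Ground.mem_conclusions.1 h3).1
    · exact hs n hn hnQ
  · exact h2.boxes0_of_bang (hT₀.boxes0_of_bang' (DiffPS.components.sub hT).isDiffPS
      (hT₀R.boxes0_of_bang h.isCircPS))

/-- The digits of the numbers of components that are equivalent to `T`. -/
theorem baseDigit_ncard (h : CriticalSetting k i R e Q)
    (hT : T ∈ (taylor i R e).components Q Q₀ k)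
    (hin : ∀ c ∈ T.conclusions, c ∈ Q ∧ T.HasInput c) {t : List (ExpStep α)}
    (ht : IsLevel (i + 1) ⟨R, e⟩ t) (htc : ∃ c ∈ T.conclusions, c.lvl = t)
    (hct : ∀ c ∈ T.conclusions, c.lvl <+: t)
    (htl : ∀ l, levelClass k i e Q Q₀ T l ≠ ∅ → t <+: l) {i' : ℕ} (hi : i ≤ i')
    (hi' : i' ≤ i + 1) :
    let d := baseDigit k (∑ s ∈ levels i' ⟨R, e⟩, (levelClass k i e Q Q₀ T s).ncard)
    d 0 = (levelClass k i e Q Q₀ T t).ncard ∧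
    (∀ l x j, IsLevel i' ⟨R, e⟩ (l ++ [x]) → t <+: l → ncop (endSt ⟨R, e⟩ l) x.1 = k ^ j →
      d j = (levelClass k i e Q Q₀ T (l ++ [x])).ncard) ∧
    ∀ j, j ≠ 0 → d j ≠ 0 → ∃ l x, IsLevel i' ⟨R, e⟩ (l ++ [x]) ∧ t <+: l ∧
      ncop (endSt ⟨R, e⟩ l) x.1 = k ^ j := by
  refine baseDigit_sum_levels h.one_lt h.inj (ht.mono hi')
    (fun s => (levelClass k i e Q Q₀ T s).ncard) (fun l _ hl => htl l ?_)
    (fun l l' hl hl' h1 h2 hs => (h.ncard_levelClass_le (hl.mono hi) (hl'.mono hi) hs hct h1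
      h2).antisymm (h.ncard_levelClass_le (hl'.mono hi) (hl.mono hi) hs.symm hct h2 h1))
    fun l hl => ?_
  · rintro h0
    exact hl (by rw [h0, Set.ncard_empty])
  -- Any conclusion of `T` has an input in every component of the class, so there are fewer than `k`
  -- of them at the level `l`.
  · obtain ⟨c, hc, -⟩ := htc
    have hcS := (DiffPS.components.sub hT).ports (Ground.mem_conclusions.1 hc).1
    refine lt_of_le_of_lt (Set.ncard_le_ncard ?_
      (DiffPS.components_finite.subset fun _ hx => hx.1))
      (h.ncard_level_lt (Q₀ := Q₀) (hl.mono hi) hcS)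
    rintro T' ⟨⟨h1, h2⟩, h3⟩
    exact ⟨h1, h3, (h2.hasInput_iff (DiffPS.components.sub hT).isDiffPS
      (DiffPS.components.sub h1).isDiffPS hc).2 (hin c hc).2⟩

end CriticalSetting

end

end

open PortName ExpState

theorem mainTheorem5 {α : Type u} (R : CircPS α) (hR : R.IsCircPS)
    (k : ℕ) (hk : 1 < k) (hk_boxes : R.boxes.card < k) (hk_cosize : R.cosize < k)
    (e : PseudoExp R) (he : PseudoExp.KInjective k R e) (i : ℕ)
    (Q Q₀ : Set (PortName R))
    (hQ : Q = (taylor i R e).criticalPorts k (PseudoExp.setN k e i))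
    (hQ₀ : Q₀ = PortName.base '' (R.conclusions : Set α))
    (T : DiffPS (PortName R) α) (hT : T ∈ (taylor i R e).components Q Q₀ k)
    (𝒯 𝒯' : Set (DiffPS (PortName R) α))
    (h𝒯 : 𝒯 = {T' | T' ∈ (taylor i R e).components Q Q₀ k ∧ T.Equivalent T'})
    (h𝒯' : 𝒯' = {T' | T' ∈ (taylor (i + 1) R e).components Q Q₀ k ∧ T.Equivalent T'}) :
    𝒯.Finite ∧ 𝒯'.Finite ∧
    ∀ m m' : ℕ →₀ ℕ, (∀ j, m j < k) → (∀ j, m' j < k) →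
      𝒯.ncard = (m.sum fun j d => d * k ^ j) →
      𝒯'.ncard = (m'.sum fun j d => d * k ^ j) →
      (∀ j, j ≠ 0 → m j ≠ 0 → j ∈ PseudoExp.setM k e i) ∧
      (∀ j, j ≠ 0 → m' j ≠ 0 → j ∈ PseudoExp.setM k e (i + 1)) ∧
      (∀ j ∈ PseudoExp.setM k e (i + 1), m' j = m j) ∧
      ({T' | T' ∈ 𝒯 ∧ T'.Substructure R.toDiffPS}.Nonempty →
        m' 0 = {T' | T' ∈ 𝒯 ∧ T'.Substructure R.toDiffPS}.ncard ∧
        m 0 = {T' | T' ∈ 𝒯 ∧ T'.Substructure R.toDiffPS}.ncard) := by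
  have h : CriticalSetting k i R e Q := ⟨hk, hR, hk_cosize, he, fun n => by
    rw [hQ]
    exact mem_criticalPorts hk hR hk_boxes hk_cosize he⟩
  have hfin : 𝒯.Finite := h𝒯 ▸ DiffPS.components_finite.subset fun _ h => h.1
  have hfin' : 𝒯'.Finite := h𝒯' ▸ DiffPS.components_finite.subset fun _ h => h.1
  refine ⟨hfin, hfin', fun m m' hm hm' hn hn' => ?_⟩
  have hd := baseDigit_finsupp m hm hn
  have hd' := baseDigit_finsupp m' hm' hn'
  simp only [← hd, ← hd']
  -- Either the conclusions leave room for many copies of `T`, or one of them determines the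
  -- component.
  by_cases hin : ∀ c ∈ T.conclusions, c ∈ Q ∧ T.HasInput c
  · obtain ⟨t, ht, htc, hct, htl⟩ := h.exists_root hT hin
    obtain ⟨h1, h2, h3⟩ := h.baseDigit_ncard hT hin ht htc hct htl le_rfl (Nat.le_succ i)
    obtain ⟨h1', h2', h3'⟩ := h.baseDigit_ncard hT hin ht htc hct htl (Nat.le_succ i) le_rfl
    rw [← h.ncard_eq_sum, ← h𝒯] at h1 h2 h3
    rw [← h.ncard_succ_eq_sum hT fun c hc => (hin c hc).2, ← h𝒯'] at h1' h2' h3'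
    rw [PseudoExp.setM_eq hk hk_boxes he, PseudoExp.setM_eq hk hk_boxes he]
    refine ⟨fun j hj hj' => ?_, fun j hj hj' => ?_, ?_, ?_⟩
    · obtain ⟨l, x, h4, -, h5⟩ := h3 j hj hj'
      exact ⟨l, x, h4, h5⟩
    · obtain ⟨l, x, h4, -, h5⟩ := h3' j hj hj'
      exact ⟨l, x, h4, h5⟩
    · rintro j ⟨l, x, hl, hj⟩
      have hli := hl.mono (Nat.le_succ i)
      by_cases htl' : t <+: l
      · rw [h2' l x j hl htl' hj, h2 l x j hli htl' hj]
      -- The exponent `j` determines the pair of `l` and the box of `x`. If `l` does not extend `t`,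
      -- no admissible pair has this exponent and both digits vanish.
      · have hx := child_mem (isLevel_snoc.1 hl).2
        have hj0 : j ≠ 0 := by
          obtain ⟨j', h4, h5⟩ := h.inj.ncop_eq (isLevel_snoc.1 hl).1 hx
          rw [hj] at h5
          exact Nat.pow_right_injective hk h5 ▸ h4.ne'
        have hzero : ∀ {i'}, ¬ ∃ l' x', IsLevel i' ⟨R, e⟩ (l' ++ [x']) ∧ t <+: l' ∧
            ncop (endSt ⟨R, e⟩ l') x'.1 = k ^ j := by
          rintro i' ⟨l', x', h4, h5, h6⟩
          obtain ⟨rfl, -⟩ := h.inj.ncop_inj (isLevel_snoc.1 hl).1 (isLevel_snoc.1 h4).1 hx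
            (child_mem (isLevel_snoc.1 h4).2) (hj.trans h6.symm)
          exact htl' h5
        rw [not_not.1 fun hc => hzero (h3' j hj0 hc), not_not.1 fun hc => hzero (h3 j hj0 hc)]
    · rintro ⟨T₀, h4, h5⟩
      rw [h𝒯] at h4
      -- The root is the level of a conclusion, and the conclusions of a component inside `R` have
      -- level `[]`.
      have ht0 : t = [] := by
        obtain ⟨c, hc, rfl⟩ := htc
        rw [← h4.2.conclusions_eq] at hc
        exact h5.lvl_eq (Ground.mem_conclusions.1 hc).1
      subst ht0
      rw [h1, h1', h.levelClass_nil hT h4.2 h5, h𝒯]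
      exact ⟨rfl, rfl⟩
  · have hsub : 𝒯' ⊆ 𝒯 := by
      rw [h𝒯, h𝒯']
      exact fun T' hT' => ⟨h.mem_of_mem_succ hT hT'.1 hT'.2, hT'.2⟩
    have huniq : ∀ T₁ ∈ 𝒯, ∀ T₂ ∈ 𝒯, T₁ = T₂ := by
      rw [h𝒯]
      exact fun T₁ h₁ T₂ h₂ => h.eq_of_equivalent_of_not_input hT hin h₁.1 h₁.2 h₂.1 h₂.2
    have hle : 𝒯.ncard ≤ 1 := (Set.ncard_le_one hfin).2 huniq
    have hle' : 𝒯'.ncard ≤ 1 := (Set.ncard_le_ncard hsub hfin).trans hle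
    -- Both cardinals are at most `1 < k`, so only digit `0` can be nonzero.
    have hzero : ∀ {n j}, n ≤ 1 → j ≠ 0 → baseDigit k n j = 0 := by
      intro n j hn hj
      rw [baseDigit, Nat.div_eq_of_lt (hn.trans_lt (Nat.one_lt_pow hj hk)), Nat.zero_mod]
    refine ⟨fun j hj hj' => absurd (hzero hle hj) hj', fun j hj hj' => absurd (hzero hle' hj) hj',
      fun j hj => ?_, ?_⟩
    · have hj0 : j ≠ 0 := hj.1.ne'
      rw [hzero hle hj0, hzero hle' hj0]
    · rintro ⟨T₀, h4, h5⟩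
      have h6 : T₀ ∈ 𝒯' := by
        rw [h𝒯] at h4
        rw [h𝒯']
        exact ⟨h.mem_succ_of_substructure h4.1 h5, h4.2⟩
      have h7 : 𝒯 = {T₀} := Set.eq_singleton_iff_unique_mem.2 ⟨h4, fun T' hT' => huniq _ hT' _ h4⟩
      have h8 : 𝒯' = {T₀} := Set.eq_singleton_iff_unique_mem.2
        ⟨h6, fun T' hT' => huniq _ (hsub hT') _ h4⟩
      have h9 : {T' | T' ∈ 𝒯 ∧ T'.Substructure R.toDiffPS} = {T₀} :=
        Set.eq_singleton_iff_unique_mem.2 ⟨⟨h4, h5⟩, fun T' hT' => huniq _ hT'.1 _ h4⟩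
      rw [h9, h7, h8]
      simp [baseDigit, Nat.mod_eq_of_lt hk]
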